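/- Let $d\ge 1$. For $p\in[1,\infty]$ let $p'$ be the conjugate exponent, $\frac1p+\frac1{p'}=1$ (with $\frac1\infty=0$). Let $q,r,\tilde q,\tilde r\in[1,\infty]$ and suppose that one of the following holds: - $d=1$ and $r,\tilde r\in(2,\infty]$; - $d=2$ and $r,\tilde r\in(2,\infty)$; - $d\ge 3$ and $\displaystyle \frac{d-2}{r}\le\frac{d}{\tilde r}$, $\displaystyle \frac{d-2}{\tilde r}\le\frac{d}{r}$. Suppose moreover that $$d\Big(\frac12-\frac1r\Big)=\frac1q<\frac1{\tilde q'}=1-\frac d2\Big(\frac1r-\frac1{\tilde r}\Big),\qquad \frac1{\tilde r}\le\frac1r .$$ Then there is a finite constant $C$, depending only on $d,q,r,\tilde q,\tilde r$, such that for every $F\in L^{\tilde q'}(\mathbb R;L^{\tilde r'}(\mathbb R^d))$ the Duhamel integral $$u(t)=\int_{s<t}e^{i(t-s)\Delta}F(s,\cdot)\,ds ,$$ where $e^{i\tau\Delta}$ is the Fourier multiplier with symbol $e^{-i\tau|\xi|^2}$ (for the Fourier transform with kernel $e^{-ix\cdot\xi}$), converges weakly in the space of tempered distributions on $\mathbb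 R^d$ for almost every $t\in\mathbb R$, coincides for almost every $t$ with an element of $L^r(\mathbb R^d)$ depending strongly measurably on $t$, and satisfies $$\Big\|\int_{s<t}e^{i(t-s)\Delta}F(s,\cdot)\,ds\Big\|_{L^{q,\infty}_tL^r_x}\le C\,\|F\|_{L^{\tilde q'}_tL^{\tilde r'}_x}.$$ Here $\|u\|_{L^{q,\infty}_tL^r_x}=\sup_{\lambda>0}\lambda\,\big|\{t\in\mathbb R:\|u(t)\|_{L^r}>\lambda\}\big|^{1/q}$ for $q<\infty$, and $L^{\infty,\infty}_t=L^\infty_t$. -/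

import Mathlib

open MeasureTheory Set
open scoped ENNReal NNReal SchwartzMap

noncomputable section

/-- Euclidean space `ℝ^d`. -/
abbrev Rd (d : ℕ) : Type := EuclideanSpace ℝ (Fin d)

/-- The symbol of `e^{iτΔ}` for the Fourier transform `𝓕 f(ξ) = ∫ e^{-2πi⟨x, ξ⟩} f(x) dx`, for which
`Δ` is multiplication by `-(2π)²|ξ|²`; thus `e^{iτΔ}` is multiplication by `e^{-i(2π)²τ|ξ|²}`. -/
def schrodingerSymbol (d : ℕ) (τ : ℝ) (ξ : Rd d) : ℂ :=
  Complex.exp (((-((2 * Real.pi) ^ 2 * τ) * ‖ξ‖ ^ 2 : ℝ) : ℂ) * Complex.I)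

/-- The function `x ↦ e^{ix}` has temperate growth. -/
theorem hasTemperateGrowth_expI :
    Function.HasTemperateGrowth (fun x : ℝ ↦ Complex.exp ((x : ℂ) * Complex.I)) := by
  have hd : ∀ n : ℕ, iteratedDeriv n (fun x : ℝ ↦ Complex.exp ((x : ℂ) * Complex.I))
      = fun x : ℝ ↦ Complex.I ^ n * Complex.exp ((x : ℂ) * Complex.I) := by
    intro n
    induction n with
    | zero => simp
    | succ n ih =>
      rw [iteratedDeriv_succ, ih]
      funext x
      have h1 : HasDerivAt (fun x : ℝ ↦ (x : ℂ) * Complex.I) (1 * Complex.I) x :=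
        (Complex.ofRealCLM.hasDerivAt (x := x)).mul_const Complex.I
      have h2 := (h1.cexp).const_mul (Complex.I ^ n)
      rw [h2.deriv]
      ring
  refine ⟨(Complex.ofRealCLM.contDiff.mul contDiff_const).cexp, fun n ↦ ⟨0, 1, fun x ↦ ?_⟩⟩
  rw [norm_iteratedFDeriv_eq_norm_iteratedDeriv, hd]
  simp [Complex.norm_exp_ofReal_mul_I]

/-- The symbol has temperate growth, so that it is a Fourier multiplier on `𝓢'`. -/
theorem hasTemperateGrowth_schrodingerSymbol (d : ℕ) (τ : ℝ) :
    Function.HasTemperateGrowth (schrodingerSymbol d τ) := by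
  have h : Function.HasTemperateGrowth
      (fun ξ : Rd d ↦ -((2 * Real.pi) ^ 2 * τ) * ‖ξ‖ ^ 2) := by fun_prop
  exact hasTemperateGrowth_expI.comp h

/-- The free Schrödinger propagator `e^{iτΔ}` on tempered distributions on `ℝ^d`. -/
def schrodingerPropagator (d : ℕ) (τ : ℝ) : 𝓢'(Rd d, ℂ) →L[ℂ] 𝓢'(Rd d, ℂ) :=
  TemperedDistribution.fourierMultiplierCLM ℂ (schrodingerSymbol d τ)

/-- The integral `∫_{s<t} e^{i(t-s)Δ} F(s) ds` converges weakly in the space of tempered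
distributions, and its value is `v`. -/
def IsDuhamelIntegral {d : ℕ} (F : ℝ → 𝓢'(Rd d, ℂ)) (t : ℝ) (v : 𝓢'(Rd d, ℂ)) : Prop :=
  ∀ φ : 𝓢(Rd d, ℂ),
    IntegrableOn (fun s ↦ schrodingerPropagator d (t - s) (F s) φ) (Iio t) ∧
      v φ = ∫ s in Iio t, schrodingerPropagator d (t - s) (F s) φ

/-- The weak Lebesgue quasi-norm of `L^{p,∞}(μ)`, that is `sup_{λ>0} λ μ{‖f‖ > λ}^{1/p}` for `p < ∞`;
by the usual convention `L^{∞,∞} = L^∞`. -/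
def eWeakLpNorm {α ε : Type*} [MeasurableSpace α] [ENorm ε]
    (f : α → ε) (p : ℝ≥0∞) (μ : Measure α) : ℝ≥0∞ :=
  if p = ∞ then eLpNormEssSup f μ
  else ⨆ c : ℝ≥0, (c : ℝ≥0∞) * μ {x | (c : ℝ≥0∞) < ‖f x‖ₑ} ^ (1 / p.toReal)

end

/-!
Exponents are encoded by their reciprocals: `ρ = 1/r`, `ρt = 1/r̃`, `a = 1/q = d(1/2 - ρ)` and
`π = 1/q̃'`.

The past `s < t` is split into the dyadic windows `t - s ∈ [2^j, 2^(j+1))`. On one window the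
dispersive bound `L¹ → L^∞`, which has the decay `2^(-jd/2)`, is interpolated with a dual Strichartz
estimate, which bounds the superposition of the data in `L²`. The outcome
(`FinFamily.exists_norm_inner_evolve_le`) is a bound by `2^(-ja)` times the norm of the data in
`L^{1/π}(L^{r̃'})` over the window. Interpolation with parameter `θ = 2ρ` asks for the Strichartz
estimate with inverse space exponent `ρ₁ = ρt/(2ρ)`, and the acceptability condition
`(d-2)/r ≤ d/r̃` says exactly that it is admissible, for `d ≥ 3` up to the endpoint; the Strichartz
estimates are therefore all proved here (`FinFamily.exists_norm_evolve_le`), the endpoint by the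
argument of Keel and Tao. Its core, `exists_sum_bilin_le`, also yields the Hardy–Littlewood–Sobolev
inequality that gives the other ones.

It remains to sum over `j`. The operator `dyadicSum` that results acts on the norms of `F(s)` alone.
The `j`-th term is at most `2^(-ja)` times the norm `N` of `F`, and its norm in `L^{1/π}(dt)` is at
most `2^(j(π-a))N`. As `0 < a < π`, splitting at a `j` that depends on the level gives the weak type
`L^{1/π} → L^{1/a,∞}` (`exists_weak_dyadicSum_le`). For `a = 0` one has `r = 2`, and the Strichartz
estimate itself is used.

All this is carried out for step functions in time and space, so that the complex interpolation
(`bilin_interpolation`) takes place on finite-dimensional spaces. Duality extends the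
pointwise bound to step functions in time with values in the Schwartz space
(`exists_enorm_stepDuhamel_le`). For general `F` one takes approximants with errors `4^(-n)`: by the
weak-type bound and the Borel–Cantelli lemma their Duhamel integrals converge in `L^r` for almost
every `t`. The limit is the weak integral because the evolution of a test function lies in
`L^{q̃}(L^{r̃})`, again by dispersion (`exists_isDuhamelIntegral`).
-/

noncomputable section

/-! ### Interpolation of bilinear forms on finite mixed-norm spaces -/

/-- The `ℓ^{1/ρ}` norm with weights `v` of a finite family; exponents are encoded by their
inverses, so that interpolation is affine in them. -/
def wnorm {K : Type*} [Fintype K] (v : K → ℝ≥0) (ρ : ℝ) (x : K → ℂ) : ℝ :=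
  (∑ k, v k * ‖x k‖ ^ ρ⁻¹) ^ ρ

/-- The weighted mixed norm `ℓ^{1/π}(I; ℓ^{1/ρ}(K))`, again with inverse exponents. -/
def mixedNorm {I K : Type*} [Fintype I] [Fintype K] (u : I → ℝ≥0) (v : K → ℝ≥0) (π ρ : ℝ)
    (c : I → K → ℂ) : ℝ :=
  (∑ i, u i * wnorm v ρ (c i) ^ π⁻¹) ^ π

section MixedNorm

variable {I K : Type*} [Fintype I] [Fintype K] {u : I → ℝ≥0} {v : K → ℝ≥0}

theorem wnorm_nonneg (ρ : ℝ) (x : K → ℂ) : 0 ≤ wnorm v ρ x := by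
  unfold wnorm; positivity

theorem mixedSum_nonneg (π ρ : ℝ) (c : I → K → ℂ) :
    0 ≤ ∑ i, (u i : ℝ) * wnorm v ρ (c i) ^ π⁻¹ :=
  Finset.sum_nonneg fun i _ ↦ mul_nonneg (u i).2 (Real.rpow_nonneg (wnorm_nonneg _ _) _)

theorem mixedNorm_nonneg (π ρ : ℝ) (c : I → K → ℂ) : 0 ≤ mixedNorm u v π ρ c := by
  exact Real.rpow_nonneg (mixedSum_nonneg _ _ _) _

theorem wnorm_rpow_inv {ρ : ℝ} (hρ : 0 < ρ) (x : K → ℂ) :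
    wnorm v ρ x ^ ρ⁻¹ = ∑ k, v k * ‖x k‖ ^ ρ⁻¹ := by
  unfold wnorm
  rw [← Real.rpow_mul (by positivity), mul_inv_cancel₀ hρ.ne', Real.rpow_one]

theorem mixedNorm_rpow_inv {π : ℝ} (hπ : 0 < π) (ρ : ℝ) (c : I → K → ℂ) :
    mixedNorm u v π ρ c ^ π⁻¹ = ∑ i, u i * wnorm v ρ (c i) ^ π⁻¹ := by
  unfold mixedNorm
  rw [← Real.rpow_mul (mixedSum_nonneg _ _ _), mul_inv_cancel₀ hπ.ne', Real.rpow_one]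

theorem wnorm_smul {ρ : ℝ} (hρ : 0 < ρ) (a : ℂ) (x : K → ℂ) :
    wnorm v ρ (a • x) = ‖a‖ * wnorm v ρ x := by
  unfold wnorm
  have : ∀ k, (v k : ℝ) * ‖(a • x) k‖ ^ ρ⁻¹ = ‖a‖ ^ ρ⁻¹ * (v k * ‖x k‖ ^ ρ⁻¹) := by
    intro k
    rw [Pi.smul_apply, norm_smul, Real.mul_rpow (norm_nonneg _) (norm_nonneg _)]
    ring
  simp_rw [this]
  rw [← Finset.mul_sum, Real.mul_rpow (by positivity) (by positivity),
    ← Real.rpow_mul (norm_nonneg _), inv_mul_cancel₀ hρ.ne', Real.rpow_one]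

theorem mixedNorm_smul {π ρ : ℝ} (hπ : 0 < π) (hρ : 0 < ρ) (a : ℂ) (c : I → K → ℂ) :
    mixedNorm u v π ρ (a • c) = ‖a‖ * mixedNorm u v π ρ c := by
  have hw := fun i ↦ wnorm_nonneg (v := v) ρ (c i)
  unfold mixedNorm
  have : ∀ i, (u i : ℝ) * wnorm v ρ ((a • c) i) ^ π⁻¹
      = ‖a‖ ^ π⁻¹ * (u i * wnorm v ρ (c i) ^ π⁻¹) := by
    intro i
    rw [Pi.smul_apply, wnorm_smul hρ, Real.mul_rpow (norm_nonneg _) (hw i)]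
    ring
  simp_rw [this]
  rw [← Finset.mul_sum, Real.mul_rpow (by positivity) (mixedSum_nonneg _ _ _),
    ← Real.rpow_mul (norm_nonneg _), inv_mul_cancel₀ hπ.ne', Real.rpow_one]

theorem wnorm_one (x : K → ℂ) : wnorm v 1 x = ∑ k, v k * ‖x k‖ := by
  simp [wnorm]

theorem mixedNorm_unit [Unique I] {π : ℝ} (hπ : 0 < π) (ρ : ℝ) (c : I → K → ℂ) :
    mixedNorm (fun _ ↦ 1) v π ρ c = wnorm v ρ (c default) := by
  simp [mixedNorm, ← Real.rpow_mul (wnorm_nonneg _ _), inv_mul_cancel₀ hπ.ne']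

/-- The entries of the analytic family through `c`: the modulus of `c i k` and the row norm
`n = wnorm v ρ (c i)` are raised to complex powers, affine in `z`, equal to `1` and `0` at `θ`. -/
def interpEntry (π₀ π₁ ρ₀ ρ₁ π ρ : ℝ) (a : ℂ) (n : ℝ) (z : ℂ) : ℂ :=
  a / ‖a‖ * Complex.exp (((1 - z) * ρ₀ + z * ρ₁) / ρ * Real.log ‖a‖ +
    (((1 - z) * π₀ + z * π₁) / π - ((1 - z) * ρ₀ + z * ρ₁) / ρ) * Real.log n)

theorem norm_interpEntry (π₀ π₁ ρ₀ ρ₁ π ρ : ℝ) (a : ℂ) (ha : a ≠ 0) (n : ℝ) (z : ℂ) :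
    ‖interpEntry π₀ π₁ ρ₀ ρ₁ π ρ a n z‖ =
      Real.exp (((1 - z.re) * ρ₀ + z.re * ρ₁) / ρ * Real.log ‖a‖ +
    (((1 - z.re) * π₀ + z.re * π₁) / π - ((1 - z.re) * ρ₀ + z.re * ρ₁) / ρ) * Real.log n) := by
  have h : ‖a‖ ≠ 0 := norm_ne_zero_iff.mpr ha
  have h1 : ((((1 - z) * ρ₀ + z * ρ₁) / ρ * Real.log ‖a‖ +
    (((1 - z) * π₀ + z * π₁) / π - ((1 - z) * ρ₀ + z * ρ₁) / ρ) * Real.log n) : ℂ).re =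
    ((1 - z.re) * ρ₀ + z.re * ρ₁) / ρ * Real.log ‖a‖ +
    (((1 - z.re) * π₀ + z.re * π₁) / π - ((1 - z.re) * ρ₀ + z.re * ρ₁) / ρ) * Real.log n := by
    simp only [Complex.add_re, Complex.mul_re, Complex.sub_re, Complex.div_ofReal_re,
      Complex.ofReal_re, Complex.ofReal_im, mul_zero, sub_zero, Complex.one_re]
  rw [interpEntry, norm_mul, Complex.norm_exp, h1, norm_div, Complex.norm_real, norm_norm,
    div_self h, one_mul]

/-- The analytic family lies in the unit ball of the space interpolated at `z.re`, for every `z` in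
the strip. Rows of norm zero are treated apart, since there `Real.log 0 = 0` is a junk value. -/
theorem mixedNorm_interpEntry_le {π₀ π₁ ρ₀ ρ₁ π ρ : ℝ} (hπ : 0 < π) (hρ : 0 < ρ)
    (c : I → K → ℂ) (hc : mixedNorm u v π ρ c ≤ 1) (z : ℂ)
    (hπz : 0 < (1 - z.re) * π₀ + z.re * π₁) (hρz : 0 < (1 - z.re) * ρ₀ + z.re * ρ₁) :
    mixedNorm u v ((1 - z.re) * π₀ + z.re * π₁) ((1 - z.re) * ρ₀ + z.re * ρ₁)
      (fun i k ↦ interpEntry π₀ π₁ ρ₀ ρ₁ π ρ (c i k) (wnorm v ρ (c i)) z) ≤ 1 := by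
  set πs := (1 - z.re) * π₀ + z.re * π₁ with hπs
  set ρs := (1 - z.re) * ρ₀ + z.re * ρ₁ with hρs
  have key : ∀ i, wnorm v ρs (fun k ↦ interpEntry π₀ π₁ ρ₀ ρ₁ π ρ (c i k) (wnorm v ρ (c i)) z)
      ≤ wnorm v ρ (c i) ^ (πs / π) := by
    intro i
    set n := wnorm v ρ (c i) with hn
    have hn0 : 0 ≤ n := wnorm_nonneg _ _
    have hsum := wnorm_rpow_inv (v := v) hρ (c i)
    rw [← hn] at hsum
    rcases hn0.eq_or_lt with h0 | hpos
    · -- the row vanishes wherever the weight does not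
      have hz : ∀ k, (v k : ℝ) * ‖c i k‖ ^ ρ⁻¹ = 0 := by
        rw [← h0, Real.zero_rpow (inv_ne_zero hρ.ne')] at hsum
        exact fun k ↦ (Finset.sum_eq_zero_iff_of_nonneg (fun k _ ↦ by positivity)).1 hsum.symm k
          (Finset.mem_univ k)
      have : wnorm v ρs (fun k ↦ interpEntry π₀ π₁ ρ₀ ρ₁ π ρ (c i k) n z) = 0 := by
        unfold wnorm
        rw [Finset.sum_eq_zero, Real.zero_rpow hρz.ne']
        intro k _
        rcases mul_eq_zero.1 (hz k) with h | h
        · rw [h, zero_mul]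
        · have : c i k = 0 := by
            rw [Real.rpow_eq_zero (norm_nonneg _) (inv_ne_zero hρ.ne')] at h
            exact norm_eq_zero.1 h
          simp [interpEntry, this, Real.zero_rpow (inv_ne_zero hρz.ne')]
      rw [this]
      positivity
    · have hk : ∀ k, (v k : ℝ) * ‖interpEntry π₀ π₁ ρ₀ ρ₁ π ρ (c i k) n z‖ ^ ρs⁻¹
          = (v k * ‖c i k‖ ^ ρ⁻¹) * n ^ ((πs / π - ρs / ρ) / ρs) := by
        intro k
        by_cases hck : c i k = 0
        · simp [interpEntry, hck, Real.zero_rpow (inv_ne_zero hρz.ne'),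
            Real.zero_rpow (inv_ne_zero hρ.ne')]
        · have hp : 0 < ‖c i k‖ := norm_pos_iff.mpr hck
          rw [norm_interpEntry _ _ _ _ _ _ _ hck, mul_assoc, Real.rpow_def_of_pos hp,
            Real.rpow_def_of_pos hpos, ← Real.exp_add, ← Real.exp_mul]
          congr 2
          rw [← hπs, ← hρs]
          field_simp
      unfold wnorm
      simp_rw [hk]
      rw [← Finset.sum_mul, ← hsum, ← Real.rpow_add hpos, ← Real.rpow_mul hpos.le]
      apply le_of_eq
      congr 1
      field_simp
      ring
  have hw := fun i ↦ wnorm_nonneg (v := v) ρ (c i)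
  unfold mixedNorm
  apply Real.rpow_le_one _ _ hπz.le
  · exact mixedSum_nonneg _ _ _
  · have h1 : ∑ i, (u i : ℝ) * wnorm v ρ (c i) ^ π⁻¹ ≤ 1 := by
      rw [← mixedNorm_rpow_inv hπ]
      exact Real.rpow_le_one (mixedNorm_nonneg _ _ _) hc (by positivity)
    refine le_trans (Finset.sum_le_sum fun i _ ↦ mul_le_mul_of_nonneg_left ?_ (u i).2) h1
    calc _ ≤ (wnorm v ρ (c i) ^ (πs / π)) ^ πs⁻¹ :=
          Real.rpow_le_rpow (wnorm_nonneg _ _) (key i) (by positivity)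
      _ = wnorm v ρ (c i) ^ π⁻¹ := by
          rw [← Real.rpow_mul (hw i)]
          congr 1
          field_simp

theorem interpEntry_self {π₀ π₁ ρ₀ ρ₁ θ : ℝ} (hπ : 0 < (1 - θ) * π₀ + θ * π₁)
    (hρ : 0 < (1 - θ) * ρ₀ + θ * ρ₁) (a : ℂ) (n : ℝ) :
    interpEntry π₀ π₁ ρ₀ ρ₁ ((1 - θ) * π₀ + θ * π₁) ((1 - θ) * ρ₀ + θ * ρ₁) a n θ = a := by
  by_cases ha : a = 0
  · simp [interpEntry, ha]
  have h1 : ((1 - θ : ℂ) * π₀ + θ * π₁) / (((1 - θ) * π₀ + θ * π₁ : ℝ) : ℂ) = 1 := by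
    have : ((((1 - θ) * π₀ + θ * π₁ : ℝ)) : ℂ) ≠ 0 := by exact_mod_cast hπ.ne'
    push_cast at this ⊢
    exact div_self this
  have h2 : ((1 - θ : ℂ) * ρ₀ + θ * ρ₁) / (((1 - θ) * ρ₀ + θ * ρ₁ : ℝ) : ℂ) = 1 := by
    have : ((((1 - θ) * ρ₀ + θ * ρ₁ : ℝ)) : ℂ) ≠ 0 := by exact_mod_cast hρ.ne'
    push_cast at this ⊢
    exact div_self this
  have hp : 0 < ‖a‖ := norm_pos_iff.mpr ha
  have hp' : (‖a‖ : ℂ) ≠ 0 := by exact_mod_cast hp.ne'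
  rw [interpEntry, h1, h2, sub_self, zero_mul, add_zero, one_mul, ← Complex.ofReal_exp,
    Real.exp_log hp, div_mul_cancel₀ _ hp']

theorem differentiable_interpEntry (π₀ π₁ ρ₀ ρ₁ π ρ : ℝ) (a : ℂ) (n : ℝ) :
    Differentiable ℂ (interpEntry π₀ π₁ ρ₀ ρ₁ π ρ a n) := by
  unfold interpEntry
  fun_prop

theorem norm_interpEntry_le (π₀ π₁ ρ₀ ρ₁ π ρ : ℝ) (a : ℂ) (n : ℝ) :
    ∃ B, ∀ z : ℂ, 0 ≤ z.re → z.re ≤ 1 → ‖interpEntry π₀ π₁ ρ₀ ρ₁ π ρ a n z‖ ≤ B := by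
  by_cases ha : a = 0
  · exact ⟨0, fun z _ _ ↦ by simp [interpEntry, ha]⟩
  obtain ⟨B, hB⟩ := (isCompact_Icc (a := (0 : ℝ)) (b := 1)).exists_bound_of_continuousOn
    (f := fun x : ℝ ↦ Real.exp (((1 - x) * ρ₀ + x * ρ₁) / ρ * Real.log ‖a‖ +
    (((1 - x) * π₀ + x * π₁) / π - ((1 - x) * ρ₀ + x * ρ₁) / ρ) * Real.log n)) (by fun_prop)
  refine ⟨B, fun z h0 h1 ↦ ?_⟩
  rw [norm_interpEntry _ _ _ _ _ _ _ ha]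
  exact (le_abs_self _).trans (hB z.re ⟨h0, h1⟩)

/-- Removes the `ε` that is added to norms so as to normalise by them when they may vanish. -/
theorem le_mul_of_forall_gt {x M a b : ℝ}
    (h : ∀ ε : ℝ, 0 < ε → x ≤ M * (a + ε) * (b + ε)) : x ≤ M * a * b := by
  have h1 : Filter.Tendsto (fun ε : ℝ ↦ M * (a + ε) * (b + ε)) (nhdsWithin 0 (Ioi 0))
      (nhds (M * (a + 0) * (b + 0))) :=
    (Continuous.tendsto (by fun_prop) 0).mono_left nhdsWithin_le_nhds
  simp only [add_zero] at h1
  exact ge_of_tendsto h1 (eventually_nhdsWithin_of_forall fun ε hε ↦ h ε hε)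

open Complex.HadamardThreeLines in
/-- **Riesz–Thorin interpolation** for bilinear forms on finite mixed-norm spaces, with all
exponents finite and given by their inverses. -/
theorem bilin_interpolation {I' K' : Type*} [Fintype I'] [Fintype K']
    {u' : I' → ℝ≥0} {v' : K' → ℝ≥0}
    (B : (I → K → ℂ) →ₗ[ℂ] (I' → K' → ℂ) →ₗ[ℂ] ℂ)
    {π₀ π₁ ρ₀ ρ₁ π₀' π₁' ρ₀' ρ₁' M₀ M₁ θ : ℝ} (hθ : θ ∈ Icc (0 : ℝ) 1)
    (hM₀ : 0 ≤ M₀) (hM₁ : 0 ≤ M₁)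
    (hπ₀ : 0 < π₀) (hπ₁ : 0 < π₁) (hρ₀ : 0 < ρ₀) (hρ₁ : 0 < ρ₁)
    (hπ₀' : 0 < π₀') (hπ₁' : 0 < π₁') (hρ₀' : 0 < ρ₀') (hρ₁' : 0 < ρ₁')
    (h₀ : ∀ c g, ‖B c g‖ ≤ M₀ * mixedNorm u v π₀ ρ₀ c * mixedNorm u' v' π₀' ρ₀' g)
    (h₁ : ∀ c g, ‖B c g‖ ≤ M₁ * mixedNorm u v π₁ ρ₁ c * mixedNorm u' v' π₁' ρ₁' g)
    (c : I → K → ℂ) (g : I' → K' → ℂ) :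
    ‖B c g‖ ≤ M₀ ^ (1 - θ) * M₁ ^ θ *
      mixedNorm u v ((1 - θ) * π₀ + θ * π₁) ((1 - θ) * ρ₀ + θ * ρ₁) c *
      mixedNorm u' v' ((1 - θ) * π₀' + θ * π₁') ((1 - θ) * ρ₀' + θ * ρ₁') g := by
  have conv : ∀ {a b s : ℝ}, 0 < a → 0 < b → 0 ≤ s → s ≤ 1 → 0 < (1 - s) * a + s * b := by
    intro a b s ha hb h0 h1
    rcases h0.eq_or_lt with h | h
    · subst h; simpa using ha
    · have := mul_nonneg (sub_nonneg.2 h1) ha.le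
      have := mul_pos h hb
      linarith
  set π := (1 - θ) * π₀ + θ * π₁ with hπdef
  set ρ := (1 - θ) * ρ₀ + θ * ρ₁ with hρdef
  set π' := (1 - θ) * π₀' + θ * π₁' with hπ'def
  set ρ' := (1 - θ) * ρ₀' + θ * ρ₁' with hρ'def
  have hπ : 0 < π := conv hπ₀ hπ₁ hθ.1 hθ.2
  have hρ : 0 < ρ := conv hρ₀ hρ₁ hθ.1 hθ.2
  have hπ' : 0 < π' := conv hπ₀' hπ₁' hθ.1 hθ.2
  have hρ' : 0 < ρ' := conv hρ₀' hρ₁' hθ.1 hθ.2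
  -- the normalised case
  have main : ∀ c g, mixedNorm u v π ρ c ≤ 1 → mixedNorm u' v' π' ρ' g ≤ 1 →
      ‖B c g‖ ≤ M₀ ^ (1 - θ) * M₁ ^ θ := by
    intro c g hc hg
    let C : ℂ → I → K → ℂ := fun z i k ↦
      interpEntry π₀ π₁ ρ₀ ρ₁ π ρ (c i k) (wnorm v ρ (c i)) z
    let G : ℂ → I' → K' → ℂ := fun z i k ↦
      interpEntry π₀' π₁' ρ₀' ρ₁' π' ρ' (g i k) (wnorm v' ρ' (g i)) z
    have hCd : Differentiable ℂ C := differentiable_pi.2 fun i ↦ differentiable_pi.2 fun k ↦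
      differentiable_interpEntry _ _ _ _ _ _ _ _
    have hGd : Differentiable ℂ G := differentiable_pi.2 fun i ↦ differentiable_pi.2 fun k ↦
      differentiable_interpEntry _ _ _ _ _ _ _ _
    have hCθ : C θ = c := by
      ext i k; exact interpEntry_self hπ hρ _ _
    have hGθ : G θ = g := by
      ext i k; exact interpEntry_self hπ' hρ' _ _
    have hCb : ∃ b, 0 ≤ b ∧ ∀ z : ℂ, 0 ≤ z.re → z.re ≤ 1 → ‖C z‖ ≤ b := by
      choose b hb using fun i k ↦
        norm_interpEntry_le π₀ π₁ ρ₀ ρ₁ π ρ (c i k) (wnorm v ρ (c i))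
      refine ⟨∑ i, ∑ k, |b i k|, by positivity, fun z h0 h1 ↦ ?_⟩
      refine (pi_norm_le_iff_of_nonneg (by positivity)).2 fun i ↦
        (pi_norm_le_iff_of_nonneg (by positivity)).2 fun k ↦ (hb i k z h0 h1).trans ?_
      refine (le_abs_self _).trans ?_
      refine (Finset.single_le_sum (f := fun k ↦ |b i k|) (fun _ _ ↦ abs_nonneg _)
        (Finset.mem_univ k)).trans ?_
      exact Finset.single_le_sum (f := fun i ↦ ∑ k, |b i k|) (fun _ _ ↦ by positivity)
        (Finset.mem_univ i)
    have hGb : ∃ b, 0 ≤ b ∧ ∀ z : ℂ, 0 ≤ z.re → z.re ≤ 1 → ‖G z‖ ≤ b := by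
      choose b hb using fun i k ↦
        norm_interpEntry_le π₀' π₁' ρ₀' ρ₁' π' ρ' (g i k) (wnorm v' ρ' (g i))
      refine ⟨∑ i, ∑ k, |b i k|, by positivity, fun z h0 h1 ↦ ?_⟩
      refine (pi_norm_le_iff_of_nonneg (by positivity)).2 fun i ↦
        (pi_norm_le_iff_of_nonneg (by positivity)).2 fun k ↦ (hb i k z h0 h1).trans ?_
      refine (le_abs_self _).trans ?_
      refine (Finset.single_le_sum (f := fun k ↦ |b i k|) (fun _ _ ↦ abs_nonneg _)
        (Finset.mem_univ k)).trans ?_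
      exact Finset.single_le_sum (f := fun i ↦ ∑ k, |b i k|) (fun _ _ ↦ by positivity)
        (Finset.mem_univ i)
    obtain ⟨bC, hbC, hCb⟩ := hCb
    obtain ⟨bG, hbG, hGb⟩ := hGb
    let B' := LinearMap.toContinuousBilinearMap B
    have hB' : ∀ c g, B' c g = B c g := fun _ _ ↦ rfl
    have hΦd : Differentiable ℂ (fun z ↦ B' (C z) (G z)) :=
      (B'.differentiable.comp hCd).clm_apply hGd
    have h := norm_le_interp_of_mem_verticalClosedStrip₀₁' (fun z ↦ B' (C z) (G z))
      (z := (θ : ℂ)) (a := M₀) (b := M₁) (by simpa [verticalClosedStrip] using hθ)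
      hΦd.diffContOnCl ?_ ?_ ?_
    · simpa only [hCθ, hGθ, hB', Complex.ofReal_re] using h
    · refine ⟨‖B'‖ * bC * bG, ?_⟩
      rintro _ ⟨z, hz, rfl⟩
      have h1 := hCb z hz.1 hz.2
      have h2 := hGb z hz.1 hz.2
      refine (B'.le_opNorm₂ _ _).trans ?_
      gcongr
    · intro z hz
      have hz : z.re = 0 := hz
      have e1 : mixedNorm u v π₀ ρ₀ (C z) ≤ 1 := by
        have := mixedNorm_interpEntry_le (u := u) (v := v) (π₀ := π₀) (π₁ := π₁) (ρ₀ := ρ₀)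
          (ρ₁ := ρ₁) hπ hρ c hc z (by simpa [hz]) (by simpa [hz])
        simpa [hz] using this
      have e2 : mixedNorm u' v' π₀' ρ₀' (G z) ≤ 1 := by
        have := mixedNorm_interpEntry_le (u := u') (v := v') (π₀ := π₀') (π₁ := π₁') (ρ₀ := ρ₀')
          (ρ₁ := ρ₁') hπ' hρ' g hg z (by simpa [hz]) (by simpa [hz])
        simpa [hz] using this
      refine (h₀ _ _).trans ?_
      have := mixedNorm_nonneg (u := u) (v := v) π₀ ρ₀ (C z)
      have := mixedNorm_nonneg (u := u') (v := v') π₀' ρ₀' (G z)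
      calc _ ≤ M₀ * 1 * 1 := by gcongr
        _ = M₀ := by ring
    · intro z hz
      have hz : z.re = 1 := hz
      have e1 : mixedNorm u v π₁ ρ₁ (C z) ≤ 1 := by
        have := mixedNorm_interpEntry_le (u := u) (v := v) (π₀ := π₀) (π₁ := π₁) (ρ₀ := ρ₀)
          (ρ₁ := ρ₁) hπ hρ c hc z (by simpa [hz]) (by simpa [hz])
        simpa [hz] using this
      have e2 : mixedNorm u' v' π₁' ρ₁' (G z) ≤ 1 := by
        have := mixedNorm_interpEntry_le (u := u') (v := v') (π₀ := π₀') (π₁ := π₁') (ρ₀ := ρ₀')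
          (ρ₁ := ρ₁') hπ' hρ' g hg z (by simpa [hz]) (by simpa [hz])
        simpa [hz] using this
      refine (h₁ _ _).trans ?_
      have := mixedNorm_nonneg (u := u) (v := v) π₁ ρ₁ (C z)
      have := mixedNorm_nonneg (u := u') (v := v') π₁' ρ₁' (G z)
      calc _ ≤ M₁ * 1 * 1 := by gcongr
        _ = M₁ := by ring
  apply le_mul_of_forall_gt
  intro ε hε
  have hNc := mixedNorm_nonneg (u := u) (v := v) π ρ c
  have hNg := mixedNorm_nonneg (u := u') (v := v') π' ρ' g
  set m := mixedNorm u v π ρ c + ε with hm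
  set m' := mixedNorm u' v' π' ρ' g + ε with hm'
  have hmp : 0 < m := by positivity
  have hmp' : 0 < m' := by positivity
  have := main (((m⁻¹ : ℝ) : ℂ) • c) (((m'⁻¹ : ℝ) : ℂ) • g)
    (by
      rw [mixedNorm_smul hπ hρ, Complex.norm_real, Real.norm_of_nonneg (by positivity),
        inv_mul_le_iff₀ hmp]
      linarith)
    (by
      rw [mixedNorm_smul hπ' hρ', Complex.norm_real, Real.norm_of_nonneg (by positivity),
        inv_mul_le_iff₀ hmp']
      linarith)
  rw [map_smul, map_smul, LinearMap.smul_apply, norm_smul, norm_smul, Complex.norm_real,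
    Complex.norm_real, Real.norm_of_nonneg (by positivity), Real.norm_of_nonneg (by positivity),
    inv_mul_le_iff₀ hmp', inv_mul_le_iff₀ hmp] at this
  linarith

end MixedNorm

/-! ### Dyadic summation of bilinear forms -/

/-- The sum of `2 ^ (-ε|a k + x|)` over `k ∈ ℤ` is bounded uniformly in the shift `x`. -/
theorem exists_sum_two_rpow_le {ε a : ℝ} (hε : 0 < ε) (ha : 0 < a) :
    ∃ C : ℝ, 0 ≤ C ∧ ∀ (x : ℝ) (S : Finset ℤ), ∑ k ∈ S, (2 : ℝ) ^ (-(ε * |a * k + x|)) ≤ C := by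
  have hsum : Summable fun n : ℤ ↦ ((2 : ℝ) ^ (-(ε * a))) ^ n.natAbs := by
    have h1 : (2 : ℝ) ^ (-(ε * a)) < 1 :=
      Real.rpow_lt_one_of_one_lt_of_neg one_lt_two (by nlinarith [mul_pos hε ha])
    have h0 : Summable fun n : ℕ ↦ ((2 : ℝ) ^ (-(ε * a))) ^ n :=
      summable_geometric_of_lt_one (by positivity) h1
    apply Summable.of_nat_of_neg
    · simpa using h0
    · simpa using h0
  refine ⟨2 ^ (ε * a) * ∑' n : ℤ, ((2 : ℝ) ^ (-(ε * a))) ^ n.natAbs, by positivity,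
    fun x S ↦ ?_⟩
  set m : ℤ := ⌊x / a⌋ with hm
  have hle : ∀ k : ℤ, (2 : ℝ) ^ (-(ε * |a * k + x|)) ≤
      2 ^ (ε * a) * ((2 : ℝ) ^ (-(ε * a))) ^ (k + m).natAbs := by
    intro k
    rw [← Real.rpow_natCast, ← Real.rpow_mul zero_le_two, ← Real.rpow_add two_pos]
    apply Real.rpow_le_rpow_of_exponent_le one_le_two
    have h1 : (((k + m).natAbs : ℕ) : ℝ) = |(k : ℝ) + m| := by
      rw [Nat.cast_natAbs]; push_cast; rfl
    rw [h1]
    have h2 : |(k : ℝ) + m| ≤ |k + x / a| + 1 := by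
      have h3 := Int.floor_le (x / a)
      have h4 := Int.lt_floor_add_one (x / a)
      have : (k : ℝ) + m = (k + x / a) + (m - x / a) := by ring
      rw [this]
      refine (abs_add_le _ _).trans ?_
      gcongr
      rw [abs_le]; constructor <;> linarith
    have h5 : |a * k + x| = a * |k + x / a| := by
      rw [← abs_of_pos ha, ← abs_mul, abs_of_pos ha]
      congr 1; field_simp
    rw [h5]
    nlinarith [mul_le_mul_of_nonneg_left h2 (mul_pos hε ha).le]
  calc _ ≤ ∑ k ∈ S, 2 ^ (ε * a) * ((2 : ℝ) ^ (-(ε * a))) ^ (k + m).natAbs :=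
        Finset.sum_le_sum fun k _ ↦ hle k
    _ = 2 ^ (ε * a) * ∑ k ∈ S.map (Equiv.addRight m).toEmbedding,
          ((2 : ℝ) ^ (-(ε * a))) ^ k.natAbs := by
        rw [← Finset.mul_sum, Finset.sum_map]; rfl
    _ ≤ _ := by
        gcongr
        exact hsum.sum_le_tsum _ fun _ _ ↦ by positivity

/-- The double Schur test behind dyadic summation: `A k` and `B l` interact at scale `j` only
when both `a k` and `a l` are close to `-σ j`. -/
theorem exists_triple_sum_le {ε a σ : ℝ} (hε : 0 < ε) (ha : 0 < a) (hσ : 0 < σ) :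
    ∃ C : ℝ, 0 ≤ C ∧ ∀ (J S T : Finset ℤ) (A B : ℤ → ℝ) (a' b' : ℝ), 0 ≤ a' → 0 ≤ b' →
      ∑ k ∈ S, A k ^ 2 ≤ a' ^ 2 → ∑ l ∈ T, B l ^ 2 ≤ b' ^ 2 →
      ∑ j ∈ J, ∑ k ∈ S, ∑ l ∈ T, (2 : ℝ) ^ (-(ε * |a * k + σ * j|)) *
        2 ^ (-(ε * |a * l + σ * j|)) * (A k * B l) ≤ C * a' * b' := by
  obtain ⟨C₁, hC₁, h₁⟩ := exists_sum_two_rpow_le hε ha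
  obtain ⟨C₂, hC₂, h₂⟩ := exists_sum_two_rpow_le hε hσ
  refine ⟨C₁ * C₂, by positivity, fun J S T A B a' b' ha' hb' hA hB ↦ ?_⟩
  set w : ℤ → ℤ → ℝ := fun j k ↦ (2 : ℝ) ^ (-(ε * |a * k + σ * j|)) with hw
  have hw0 : ∀ j k, 0 ≤ w j k := fun j k ↦ by positivity
  have hs1 : ∀ j (S : Finset ℤ), ∑ k ∈ S, w j k ≤ C₁ := fun j S ↦ h₁ (σ * j) S
  have hs2 : ∀ k (J : Finset ℤ), ∑ j ∈ J, w j k ≤ C₂ := fun k J ↦ by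
    simp only [hw]
    simp_rw [add_comm (a * (k : ℝ))]
    exact h₂ _ J
  have hsch : ∀ (S T : Finset ℤ) (A : ℤ → ℝ),
      ∑ j ∈ J, ∑ k ∈ S, ∑ l ∈ T, w j k * w j l * A k ^ 2 ≤ C₁ * C₂ * ∑ k ∈ S, A k ^ 2 := by
    intro S T A
    calc _ ≤ ∑ j ∈ J, ∑ k ∈ S, C₁ * (w j k * A k ^ 2) := by
          refine Finset.sum_le_sum fun j _ ↦ Finset.sum_le_sum fun k _ ↦ ?_
          have : ∑ l ∈ T, w j k * w j l * A k ^ 2 = (∑ l ∈ T, w j l) * (w j k * A k ^ 2) := by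
            rw [Finset.sum_mul]; exact Finset.sum_congr rfl fun _ _ ↦ by ring
          rw [this]
          have := hw0 j k
          gcongr
          exact hs1 j T
      _ = ∑ k ∈ S, C₁ * A k ^ 2 * ∑ j ∈ J, w j k := by
          rw [Finset.sum_comm]
          simp_rw [Finset.mul_sum]
          exact Finset.sum_congr rfl fun _ _ ↦ Finset.sum_congr rfl fun _ _ ↦ by ring
      _ ≤ ∑ k ∈ S, C₁ * A k ^ 2 * C₂ := by
          gcongr with k _
          exact hs2 k J
      _ = _ := by rw [← Finset.sum_mul, ← Finset.mul_sum]; ring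
  -- pass to sums over triples and apply the Cauchy–Schwarz inequality there
  have e : ∀ f : ℤ → ℤ → ℤ → ℝ, ∑ j ∈ J, ∑ k ∈ S, ∑ l ∈ T, f j k l =
      ∑ x ∈ J ×ˢ (S ×ˢ T), f x.1 x.2.1 x.2.2 := by
    intro f
    rw [Finset.sum_product]
    exact Finset.sum_congr rfl fun j _ ↦ by rw [Finset.sum_product]
  change ∑ j ∈ J, ∑ k ∈ S, ∑ l ∈ T, w j k * w j l * (A k * B l) ≤ _
  rw [e fun j k l ↦ w j k * w j l * (A k * B l)]
  have hcs := Finset.sum_mul_sq_le_sq_mul_sq (J ×ˢ (S ×ˢ T))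
    (fun x ↦ √(w x.1 x.2.1 * w x.1 x.2.2) * A x.2.1)
    (fun x ↦ √(w x.1 x.2.1 * w x.1 x.2.2) * B x.2.2)
  have e1 : ∀ x : ℤ × ℤ × ℤ, √(w x.1 x.2.1 * w x.1 x.2.2) * A x.2.1 *
      (√(w x.1 x.2.1 * w x.1 x.2.2) * B x.2.2) =
      w x.1 x.2.1 * w x.1 x.2.2 * (A x.2.1 * B x.2.2) := by
    intro x
    have := Real.mul_self_sqrt (mul_nonneg (hw0 x.1 x.2.1) (hw0 x.1 x.2.2))
    linear_combination (A x.2.1 * B x.2.2) * this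
  simp only [e1, mul_pow, Real.sq_sqrt (mul_nonneg (hw0 _ _) (hw0 _ _))] at hcs
  have hA' : ∑ x ∈ J ×ˢ (S ×ˢ T), w x.1 x.2.1 * w x.1 x.2.2 * A x.2.1 ^ 2 ≤
      C₁ * C₂ * a' ^ 2 := by
    rw [← e fun j k l ↦ w j k * w j l * A k ^ 2]
    refine (hsch S T A).trans ?_
    gcongr
  have hB' : ∑ x ∈ J ×ˢ (S ×ˢ T), w x.1 x.2.1 * w x.1 x.2.2 * B x.2.2 ^ 2 ≤
      C₁ * C₂ * b' ^ 2 := by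
    rw [← e fun j k l ↦ w j k * w j l * B l ^ 2]
    have := hsch T S B
    refine le_trans (le_of_eq ?_) (this.trans (by gcongr))
    refine Finset.sum_congr rfl fun j _ ↦ ?_
    rw [Finset.sum_comm]
    exact Finset.sum_congr rfl fun _ _ ↦ Finset.sum_congr rfl fun _ _ ↦ by ring
  refine (le_abs_self _).trans (abs_le_of_sq_le_sq ?_ (by positivity))
  refine hcs.trans ((mul_le_mul hA' hB' ?_ (by positivity)).trans (le_of_eq (by ring)))
  exact Finset.sum_nonneg fun x _ ↦
    mul_nonneg (mul_nonneg (hw0 _ _) (hw0 _ _)) (sq_nonneg _)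

section Slices
variable {I K : Type*} [Fintype I] [Fintype K] {u : I → ℝ≥0} {v : K → ℝ≥0}

/-- Decomposition of `c` into slices of dyadic height relative to the row norms. The slice at
height `2 ^ k` is controlled in `ℓ²(ℓ^{1/(ρ-δ)})` for all `δ ≤ ρ - 1/2` at once, with a factor
that is exponential in `k`, and the bounds are square summable. -/
theorem exists_slices {ρ : ℝ} (hρ : 0 < ρ) (c : I → K → ℂ) :
    ∃ (S : Finset ℤ) (C : ℤ → I → K → ℂ) (A : ℤ → ℝ), (∀ k, 0 ≤ A k) ∧ ∑ k ∈ S, C k = c ∧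
      ∑ k ∈ S, A k ^ 2 ≤ (2 * mixedNorm u v (1 / 2) ρ c) ^ 2 ∧
      ∀ (k : ℤ) (δ : ℝ), 1 / 2 ≤ ρ - δ →
        mixedNorm u v (1 / 2) (ρ - δ) (C k) ≤ (2 : ℝ) ^ (k * (δ / ρ)) * A k := by
  classical
  set φ : I → ℝ := fun i ↦ wnorm v ρ (c i) with hφ
  have hφ0 : ∀ i, 0 ≤ φ i := fun i ↦ wnorm_nonneg _ _
  have hφs : ∀ i, φ i ^ ρ⁻¹ = ∑ k, v k * ‖c i k‖ ^ ρ⁻¹ := fun i ↦ wnorm_rpow_inv hρ _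
  -- `h` is the dyadic height of an entry relative to its row norm, and `β k i` the share of the
  -- slice `k` in the row `i`
  let h : I → K → ℤ := fun i m ↦ ⌊Real.logb 2 (‖c i m‖ / φ i)⌋
  let C : ℤ → I → K → ℂ := fun k i m ↦ if h i m = k then c i m else 0
  let s : ℤ → I → ℝ := fun k i ↦ ∑ m, v m * ‖C k i m‖ ^ ρ⁻¹
  let β : ℤ → I → ℝ := fun k i ↦ s k i / φ i ^ ρ⁻¹
  let S : Finset ℤ := Finset.univ.image fun x : I × K ↦ h x.1 x.2
  have hs0 : ∀ k i, 0 ≤ s k i := fun k i ↦ by positivity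
  have hβ0 : ∀ k i, 0 ≤ β k i := fun k i ↦ div_nonneg (hs0 k i) (Real.rpow_nonneg (hφ0 i) _)
  have hCle : ∀ k i m, ‖C k i m‖ ^ ρ⁻¹ ≤ ‖c i m‖ ^ ρ⁻¹ := by
    intro k i m
    simp only [C]
    split_ifs
    · rfl
    · rw [norm_zero, Real.zero_rpow (inv_ne_zero hρ.ne')]; positivity
  have hsφ : ∀ k i, s k i ≤ φ i ^ ρ⁻¹ := by
    intro k i
    rw [hφs]
    exact Finset.sum_le_sum fun m _ ↦ mul_le_mul_of_nonneg_left (hCle k i m) (v m).2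
  have hβ1 : ∀ k i, β k i ≤ 1 := fun k i ↦
    div_le_one_of_le₀ (hsφ k i) (Real.rpow_nonneg (hφ0 i) _)
  have hβsum : ∀ i, ∑ k ∈ S, β k i ≤ 1 := by
    intro i
    simp only [β]
    rw [← Finset.sum_div]
    refine div_le_one_of_le₀ (le_of_eq ?_) (Real.rpow_nonneg (hφ0 i) _)
    rw [hφs, Finset.sum_comm]
    refine Finset.sum_congr rfl fun m _ ↦ ?_
    rw [← Finset.mul_sum, Finset.sum_eq_single (h i m)]
    · simp [C]
    · intro k _ hk
      simp [C, Ne.symm hk, Real.zero_rpow (inv_ne_zero hρ.ne')]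
    · intro hk
      exact absurd (Finset.mem_image.2 ⟨(i, m), Finset.mem_univ _, rfl⟩) hk
  refine ⟨S, C, fun k ↦ √(∑ i, u i * (2 * φ i) ^ 2 * β k i), fun k ↦ Real.sqrt_nonneg _,
    ?_, ?_, ?_⟩
  · ext i m
    rw [Finset.sum_apply, Finset.sum_apply, Finset.sum_eq_single (h i m)]
    · simp [C]
    · intro k _ hk
      simp [C, Ne.symm hk]
    · intro hk
      exact absurd (Finset.mem_image.2 ⟨(i, m), Finset.mem_univ _, rfl⟩) hk
  · have hN : mixedNorm u v (1 / 2) ρ c ^ 2 = ∑ i, u i * φ i ^ 2 := by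
      have := mixedNorm_rpow_inv (u := u) (v := v) (π := 1 / 2) (by norm_num) ρ c
      simpa using this
    have : ∀ k, √(∑ i, u i * (2 * φ i) ^ 2 * β k i) ^ 2 = ∑ i, u i * (2 * φ i) ^ 2 * β k i :=
      fun k ↦ Real.sq_sqrt (Finset.sum_nonneg fun i _ ↦ mul_nonneg (by positivity) (hβ0 k i))
    simp_rw [this]
    rw [Finset.sum_comm, mul_pow, hN, Finset.mul_sum]
    refine Finset.sum_le_sum fun i _ ↦ ?_
    rw [← Finset.mul_sum]
    calc _ ≤ u i * (2 * φ i) ^ 2 * 1 := by gcongr; exact hβsum i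
      _ = _ := by ring
  · intro k δ hδ
    set ρ' := ρ - δ with hρ'
    have hρ'0 : 0 < ρ' := by linarith
    have key : ∀ i, wnorm v ρ' (C k i) ≤ 2 ^ (k * (δ / ρ)) * (2 * φ i * √(β k i)) := by
      intro i
      -- a row of norm zero vanishes wherever the weight does not; the heights are junk there
      rcases (hφ0 i).eq_or_lt with h0 | hpos
      · have hz : ∀ m, (v m : ℝ) * ‖c i m‖ ^ ρ⁻¹ = 0 := by
          have := hφs i
          rw [← h0, Real.zero_rpow (inv_ne_zero hρ.ne')] at this
          exact fun k ↦ (Finset.sum_eq_zero_iff_of_nonneg (fun k _ ↦ by positivity)).1 this.symm k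
            (Finset.mem_univ k)
        have : wnorm v ρ' (C k i) = 0 := by
          unfold wnorm
          rw [Finset.sum_eq_zero, Real.zero_rpow hρ'0.ne']
          intro m _
          rcases mul_eq_zero.1 (hz m) with h | h
          · rw [h, zero_mul]
          · have : c i m = 0 := by
              rw [Real.rpow_eq_zero (norm_nonneg _) (inv_ne_zero hρ.ne')] at h
              exact norm_eq_zero.1 h
            simp [C, this, Real.zero_rpow (inv_ne_zero hρ'0.ne')]
        rw [this, ← h0]; simp
      · set H : ℝ := 2 ^ (k : ℝ) * φ i with hH
        have hHpos : 0 < H := by positivity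
        let t : ℝ := ∑ m, if C k i m = 0 then 0 else (v m : ℝ)
        have ht0 : 0 ≤ t := Finset.sum_nonneg fun m _ ↦ by split_ifs <;> simp
        have hbd : ∀ m, C k i m ≠ 0 → H ≤ ‖C k i m‖ ∧ ‖C k i m‖ ≤ 2 * H := by
          intro m hm
          have hk : h i m = k := by
            by_contra hne; exact hm (by simp [C, hne])
          have hCc : C k i m = c i m := by simp [C, hk]
          rw [hCc] at hm ⊢
          have hcp : 0 < ‖c i m‖ / φ i := div_pos (norm_pos_iff.2 hm) hpos
          have h1 : (k : ℝ) ≤ Real.logb 2 (‖c i m‖ / φ i) := by rw [← hk]; exact Int.floor_le _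
          have h2 : Real.logb 2 (‖c i m‖ / φ i) ≤ k + 1 := by
            rw [← hk]; exact (Int.lt_floor_add_one _).le
          rw [Real.le_logb_iff_rpow_le one_lt_two hcp, le_div_iff₀ hpos] at h1
          rw [Real.logb_le_iff_le_rpow one_lt_two hcp, div_le_iff₀ hpos,
            Real.rpow_add two_pos, Real.rpow_one] at h2
          exact ⟨h1, h2.trans (le_of_eq (by rw [hH]; ring))⟩
        -- `t` is the weight of the support of the slice, where the entries lie between `H` and `2 H`
        have hlow : t * H ^ ρ⁻¹ ≤ s k i := by
          simp only [t, s, Finset.sum_mul]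
          refine Finset.sum_le_sum fun m _ ↦ ?_
          split_ifs with h0
          · simp only [zero_mul]; positivity
          · have := (hbd m h0).1
            gcongr
        have hup : wnorm v ρ' (C k i) ≤ t ^ ρ' * (2 * H) := by
          have h1 : ∑ m, (v m : ℝ) * ‖C k i m‖ ^ ρ'⁻¹ ≤ t * (2 * H) ^ ρ'⁻¹ := by
            simp only [t, Finset.sum_mul]
            refine Finset.sum_le_sum fun m _ ↦ ?_
            split_ifs with h0
            · simp [h0, Real.zero_rpow (inv_ne_zero hρ'0.ne')]
            · have := (hbd m h0).2
              gcongr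
          calc _ ≤ (t * (2 * H) ^ ρ'⁻¹) ^ ρ' := by unfold wnorm; gcongr
            _ = _ := by
              rw [Real.mul_rpow ht0 (by positivity), ← Real.rpow_mul (by positivity),
                inv_mul_cancel₀ hρ'0.ne', Real.rpow_one]
        have hHφ : H ^ ρ⁻¹ = 2 ^ (k / ρ) * φ i ^ ρ⁻¹ := by
          rw [hH, Real.mul_rpow (by positivity) hpos.le, ← Real.rpow_mul zero_le_two]; rfl
        have htβ : t ≤ β k i * 2 ^ (-(k / ρ)) := by
          rw [Real.rpow_neg zero_le_two, ← div_eq_mul_inv]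
          simp only [β]
          rw [div_div, le_div_iff₀ (by positivity), mul_comm (φ i ^ ρ⁻¹), ← hHφ]
          exact hlow
        have hβh : β k i ^ ρ' ≤ √(β k i) := by
          rw [Real.sqrt_eq_rpow]
          exact Real.rpow_le_rpow_of_exponent_ge' (hβ0 k i) (hβ1 k i) (by norm_num) hδ
        calc _ ≤ t ^ ρ' * (2 * H) := hup
          _ ≤ (β k i * 2 ^ (-(k / ρ))) ^ ρ' * (2 * H) := by gcongr
          _ = β k i ^ ρ' * (2 ^ (-(k / ρ) * ρ' + k) * (2 * φ i)) := by
              rw [Real.mul_rpow (hβ0 k i) (by positivity), ← Real.rpow_mul zero_le_two,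
                Real.rpow_add two_pos, hH]
              ring
          _ ≤ √(β k i) * (2 ^ (-(k / ρ) * ρ' + k) * (2 * φ i)) := by gcongr
          _ = 2 ^ (k * (δ / ρ)) * (2 * φ i * √(β k i)) := by
              have : -((k : ℝ) / ρ) * ρ' + k = k * (δ / ρ) := by
                rw [hρ']; field_simp; ring
              rw [this]; ring
    have hN : mixedNorm u v (1 / 2) ρ' (C k) = √(∑ i, u i * wnorm v ρ' (C k i) ^ 2) := by
      rw [Real.sqrt_eq_rpow]; simp [mixedNorm]
    rw [hN]
    have hR : (0 : ℝ) ≤ 2 ^ (k * (δ / ρ)) := by positivity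
    rw [← Real.sqrt_sq hR, ← Real.sqrt_mul (sq_nonneg _)]
    apply Real.sqrt_le_sqrt
    rw [Finset.mul_sum]
    refine Finset.sum_le_sum fun i _ ↦ ?_
    calc _ ≤ (u i : ℝ) * (2 ^ (k * (δ / ρ)) * (2 * φ i * √(β k i))) ^ 2 := by
          have := wnorm_nonneg (v := v) ρ' (C k i)
          gcongr
          exact key i
      _ = _ := by
          rw [mul_pow, mul_pow _ (√(β k i)), Real.sq_sqrt (hβ0 k i)]
          ring

/-- Dyadic summation at an endpoint (Keel–Tao): bilinear forms `B j` that obey four bounds around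
the exponent `ρ`, growing or decaying in `j` according to the direction of the deviation, are
summable in `j` at the exponent `ρ` itself. -/
theorem exists_sum_bilin_le {ρ ε σ : ℝ} (hε : 0 < ε) (hσ : 0 < σ) (hρ : 1 / 2 ≤ ρ - ε) :
    ∃ C : ℝ, 0 ≤ C ∧ ∀ {I K I' K' : Type} [Fintype I] [Fintype K] [Fintype I'] [Fintype K']
      (u : I → ℝ≥0) (v : K → ℝ≥0) (u' : I' → ℝ≥0) (v' : K' → ℝ≥0)
      (B : ℤ → (I → K → ℂ) →ₗ[ℂ] (I' → K' → ℂ) →ₗ[ℂ] ℂ) (M : ℝ),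
      0 ≤ M →
      (∀ (j : ℤ) (δ₁ δ₂ : ℝ), (δ₁ = ε ∨ δ₁ = -ε) → (δ₂ = ε ∨ δ₂ = -ε) → ∀ c g,
        ‖B j c g‖ ≤ M * 2 ^ (j * (σ * (δ₁ + δ₂))) * mixedNorm u v (1 / 2) (ρ - δ₁) c *
          mixedNorm u' v' (1 / 2) (ρ - δ₂) g) →
      ∀ (J : Finset ℤ) c g, ∑ j ∈ J, ‖B j c g‖ ≤
        C * M * mixedNorm u v (1 / 2) ρ c * mixedNorm u' v' (1 / 2) ρ g := by
  have hρ0 : 0 < ρ := by linarith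
  obtain ⟨C, hC, hsum⟩ := exists_triple_sum_le hε (inv_pos.2 hρ0) hσ
  refine ⟨4 * C, by positivity, ?_⟩
  intro I K I' K' _ _ _ _ u v u' v' B M hM hB J c g
  obtain ⟨S, c', A, hA0, hcs, hA, hcb⟩ := exists_slices (u := u) (v := v) hρ0 c
  obtain ⟨T, g', A', hA0', hgs, hA', hgb⟩ := exists_slices (u := u') (v := v') hρ0 g
  -- of the four bounds, use for each pair of slices the one whose deviations have the good signs
  have hsign : ∀ x : ℝ, ∃ δ : ℝ, (δ = ε ∨ δ = -ε) ∧ δ * x = -(ε * |x|) := by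
    intro x
    rcases le_total 0 x with h | h
    · exact ⟨-ε, Or.inr rfl, by rw [abs_of_nonneg h]; ring⟩
    · exact ⟨ε, Or.inl rfl, by rw [abs_of_nonpos h]; ring⟩
  have hterm : ∀ j k l, ‖B j (c' k) (g' l)‖ ≤ M * ((2 : ℝ) ^ (-(ε * |ρ⁻¹ * k + σ * j|)) *
        2 ^ (-(ε * |ρ⁻¹ * l + σ * j|)) * (A k * A' l)) := by
    intro j k l
    obtain ⟨δ₁, hδ₁, e₁⟩ := hsign (ρ⁻¹ * k + σ * j)
    obtain ⟨δ₂, hδ₂, e₂⟩ := hsign (ρ⁻¹ * l + σ * j)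
    have h1 : 1 / 2 ≤ ρ - δ₁ := by rcases hδ₁ with h | h <;> rw [h] <;> linarith
    have h2 : 1 / 2 ≤ ρ - δ₂ := by rcases hδ₂ with h | h <;> rw [h] <;> linarith
    have h3 := hcb k δ₁ h1
    have h4 := hgb l δ₂ h2
    have := mixedNorm_nonneg (u := u) (v := v) (1 / 2) (ρ - δ₁) (c' k)
    have := mixedNorm_nonneg (u := u') (v := v') (1 / 2) (ρ - δ₂) (g' l)
    have := hA0 k
    calc _ ≤ M * 2 ^ (j * (σ * (δ₁ + δ₂))) * (2 ^ (k * (δ₁ / ρ)) * A k) *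
          (2 ^ (l * (δ₂ / ρ)) * A' l) := by
          refine (hB j δ₁ δ₂ hδ₁ hδ₂ _ _).trans ?_
          gcongr
      _ = M * ((2 : ℝ) ^ (j * (σ * (δ₁ + δ₂)) + k * (δ₁ / ρ) + l * (δ₂ / ρ)) *
          (A k * A' l)) := by
          rw [Real.rpow_add two_pos, Real.rpow_add two_pos]; ring
      _ = _ := by
          rw [← Real.rpow_add two_pos, ← e₁, ← e₂]
          have : j * (σ * (δ₁ + δ₂)) + k * (δ₁ / ρ) + l * (δ₂ / ρ) =
            δ₁ * (ρ⁻¹ * k + σ * j) + δ₂ * (ρ⁻¹ * l + σ * j) := by ring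
          rw [this]
  calc ∑ j ∈ J, ‖B j c g‖ ≤ ∑ j ∈ J, ∑ k ∈ S, ∑ l ∈ T, ‖B j (c' k) (g' l)‖ := by
        refine Finset.sum_le_sum fun j _ ↦ ?_
        have e : B j c g = ∑ k ∈ S, ∑ l ∈ T, B j (c' k) (g' l) := by
          rw [← hcs, ← hgs, map_sum (B j), LinearMap.sum_apply]
          exact Finset.sum_congr rfl fun k _ ↦ map_sum _ _ _
        rw [e]
        exact (norm_sum_le _ _).trans (Finset.sum_le_sum fun k _ ↦ norm_sum_le _ _)
    _ ≤ ∑ j ∈ J, ∑ k ∈ S, ∑ l ∈ T, M * ((2 : ℝ) ^ (-(ε * |ρ⁻¹ * k + σ * j|)) *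
        2 ^ (-(ε * |ρ⁻¹ * l + σ * j|)) * (A k * A' l)) := by
        gcongr with j _ k _ l _
        exact hterm j k l
    _ = M * ∑ j ∈ J, ∑ k ∈ S, ∑ l ∈ T, ((2 : ℝ) ^ (-(ε * |ρ⁻¹ * k + σ * j|)) *
        2 ^ (-(ε * |ρ⁻¹ * l + σ * j|)) * (A k * A' l)) := by
        simp_rw [Finset.mul_sum]
    _ ≤ M * (C * (2 * mixedNorm u v (1 / 2) ρ c) * (2 * mixedNorm u' v' (1 / 2) ρ g)) := by
        have := mixedNorm_nonneg (u := u) (v := v) (1 / 2) ρ c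
        have := mixedNorm_nonneg (u := u') (v := v') (1 / 2) ρ g
        gcongr
        exact hsum J S T A A' _ _ (by positivity) (by positivity) hA hA'
    _ = _ := by ring
end Slices

/-! ### The propagator on Schwartz functions -/

section Symbol

variable (d : ℕ)

theorem norm_schrodingerSymbol (τ : ℝ) (ξ : Rd d) : ‖schrodingerSymbol d τ ξ‖ = 1 :=
  Complex.norm_exp_ofReal_mul_I _

theorem schrodingerSymbol_zero : schrodingerSymbol d 0 = fun _ ↦ 1 := by
  funext ξ; simp [schrodingerSymbol]

theorem schrodingerSymbol_mul (τ τ' : ℝ) :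
    schrodingerSymbol d τ * schrodingerSymbol d τ' = schrodingerSymbol d (τ + τ') := by
  funext ξ
  simp only [schrodingerSymbol, Pi.mul_apply, ← Complex.exp_add]
  congr 1
  push_cast
  ring

theorem norm_schrodingerSymbol_sub_le (τ τ' : ℝ) (ξ : Rd d) :
    ‖schrodingerSymbol d τ ξ - schrodingerSymbol d τ' ξ‖ ≤
      (2 * Real.pi) ^ 2 * |τ - τ'| * ‖ξ‖ ^ 2 := by
  have h : schrodingerSymbol d τ ξ - schrodingerSymbol d τ' ξ = schrodingerSymbol d τ' ξ *
      (Complex.exp (Complex.I * (((-((2 * Real.pi) ^ 2 * (τ - τ')) * ‖ξ‖ ^ 2 : ℝ)) : ℂ)) - 1) := by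
    rw [mul_sub, mul_one, schrodingerSymbol, schrodingerSymbol, ← Complex.exp_add]
    congr 2
    push_cast
    ring
  rw [h, norm_mul, norm_schrodingerSymbol, one_mul]
  refine Real.norm_exp_I_mul_ofReal_sub_one_le.trans (le_of_eq ?_)
  rw [Real.norm_eq_abs, abs_mul, abs_neg, abs_mul, abs_of_nonneg (sq_nonneg (2 * Real.pi)),
    abs_of_nonneg (sq_nonneg ‖ξ‖)]

end Symbol

section Schwartz

open FourierTransform

variable {d : ℕ}

/-- The free Schrödinger propagator on Schwartz functions. -/
def schwartzPropagator (d : ℕ) (τ : ℝ) : 𝓢(Rd d, ℂ) →L[ℂ] 𝓢(Rd d, ℂ) :=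
  SchwartzMap.fourierMultiplierCLM ℂ (schrodingerSymbol d τ)

theorem schwartzPropagator_eq (τ : ℝ) (φ : 𝓢(Rd d, ℂ)) : schwartzPropagator d τ φ =
    𝓕⁻ (SchwartzMap.smulLeftCLM ℂ (schrodingerSymbol d τ) (𝓕 φ)) := rfl

theorem schwartzPropagator_add (τ τ' : ℝ) (φ : 𝓢(Rd d, ℂ)) :
    schwartzPropagator d τ (schwartzPropagator d τ' φ) = schwartzPropagator d (τ + τ') φ := by
  rw [schwartzPropagator, schwartzPropagator,
    SchwartzMap.fourierMultiplierCLM_fourierMultiplierCLM_apply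
      (hasTemperateGrowth_schrodingerSymbol d τ) (hasTemperateGrowth_schrodingerSymbol d τ'),
    schrodingerSymbol_mul, schwartzPropagator]

theorem schwartzPropagator_zero (φ : 𝓢(Rd d, ℂ)) : schwartzPropagator d 0 φ = φ := by
  rw [schwartzPropagator, schrodingerSymbol_zero, SchwartzMap.fourierMultiplierCLM_const]
  simp

theorem schwartzPropagator_apply (τ : ℝ) (φ : 𝓢(Rd d, ℂ)) (x : Rd d) :
    schwartzPropagator d τ φ x = ∫ ξ, Complex.exp (((2 * Real.pi * inner ℝ ξ x : ℝ) : ℂ) *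
      Complex.I) * (schrodingerSymbol d τ ξ * 𝓕 φ ξ) := by
  rw [schwartzPropagator_eq, SchwartzMap.fourierInv_coe, Real.fourierInv_eq']
  simp [SchwartzMap.smulLeftCLM_apply_apply (hasTemperateGrowth_schrodingerSymbol d τ)]

/-- As the symbol is even, the transpose of the propagator is the propagator itself. -/
theorem fourier_smul_fourierInv (τ : ℝ) (φ : 𝓢(Rd d, ℂ)) :
    𝓕 (SchwartzMap.smulLeftCLM ℂ (schrodingerSymbol d τ) (𝓕⁻ φ)) = schwartzPropagator d τ φ := by
  ext x
  rw [schwartzPropagator_apply, SchwartzMap.fourier_coe, Real.fourier_eq',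
    ← integral_neg_eq_self]
  congr 1
  funext ξ
  simp only [SchwartzMap.smulLeftCLM_apply_apply (hasTemperateGrowth_schrodingerSymbol d τ),
    smul_eq_mul, SchwartzMap.fourierInv_coe, Real.fourierInv_eq_fourier_neg, neg_neg,
    SchwartzMap.fourier_coe, inner_neg_left]
  simp [schrodingerSymbol]

theorem schrodingerPropagator_apply (τ : ℝ) (f : 𝓢'(Rd d, ℂ)) (φ : 𝓢(Rd d, ℂ)) :
    schrodingerPropagator d τ f φ = f (schwartzPropagator d τ φ) := by
  rw [schrodingerPropagator, TemperedDistribution.fourierMultiplierCLM_apply_apply,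
    fourier_smul_fourierInv]

theorem integral_schwartzPropagator_mul (τ : ℝ) (f g : 𝓢(Rd d, ℂ)) :
    ∫ x, schwartzPropagator d τ f x * g x = ∫ x, f x * schwartzPropagator d τ g x := by
  have h := TemperedDistribution.fourierMultiplierCLM_toTemperedDistributionCLM_eq
    (hasTemperateGrowth_schrodingerSymbol d τ) f
  have h2 := congrArg (fun T : 𝓢'(Rd d, ℂ) ↦ T g) h
  simp only [TemperedDistribution.fourierMultiplierCLM_apply_apply, fourier_smul_fourierInv,
    SchwartzMap.toTemperedDistributionCLM_apply_apply, smul_eq_mul] at h2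
  rw [← schwartzPropagator] at h2
  simp_rw [mul_comm _ (g _), mul_comm (f _)]
  exact h2.symm

theorem norm_fourierInv_toLp_two (f : 𝓢(Rd d, ℂ)) : ‖(𝓕⁻ f).toLp 2‖ = ‖f.toLp 2‖ := by
  rw [← SchwartzMap.norm_fourier_toL2_eq (𝓕⁻ f), FourierTransform.fourier_fourierInv_eq]

theorem norm_schwartzPropagator_toLp_two (τ : ℝ) (f : 𝓢(Rd d, ℂ)) :
    ‖(schwartzPropagator d τ f).toLp 2‖ = ‖f.toLp 2‖ := by
  rw [schwartzPropagator_eq, norm_fourierInv_toLp_two, ← SchwartzMap.norm_fourier_toL2_eq f,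
    SchwartzMap.norm_toLp, SchwartzMap.norm_toLp]
  congr 1
  apply eLpNorm_congr_norm_ae
  refine Filter.Eventually.of_forall fun x ↦ ?_
  simp [SchwartzMap.smulLeftCLM_apply_apply (hasTemperateGrowth_schrodingerSymbol d τ),
    norm_schrodingerSymbol]

theorem norm_schwartzPropagator_le (τ : ℝ) (φ : 𝓢(Rd d, ℂ)) (x : Rd d) :
    ‖schwartzPropagator d τ φ x‖ ≤ ∫ ξ, ‖𝓕 φ ξ‖ := by
  rw [schwartzPropagator_apply]
  refine (norm_integral_le_integral_norm _).trans (le_of_eq ?_)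
  congr 1
  funext ξ
  rw [norm_mul, norm_mul, Complex.norm_exp_ofReal_mul_I, norm_schrodingerSymbol, one_mul, one_mul]

/-- The constant `(4π)^{-d/2}` of the dispersive estimate. -/
def dispersiveConst (d : ℕ) : ℝ := (Real.pi / (2 * Real.pi) ^ 2) ^ ((d : ℝ) / 2)

theorem dispersiveConst_pos (d : ℕ) : 0 < dispersiveConst d := by
  unfold dispersiveConst
  have := Real.pi_pos
  positivity

/-- The dispersive estimate. The kernel is computed for `e^{iτΔ + εΔ}`, a Gaussian, and `ε → 0`. -/
theorem norm_schwartzPropagator_le_dispersive {τ : ℝ} (hτ : τ ≠ 0) (φ : 𝓢(Rd d, ℂ)) (x : Rd d) :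
    ‖schwartzPropagator d τ φ x‖ ≤
      dispersiveConst d * |τ| ^ (-((d : ℝ) / 2)) * ∫ y, ‖φ y‖ := by
  have hpi := Real.pi_pos
  set a : ℝ := (2 * Real.pi) ^ 2 * τ with ha
  have ha0 : a ≠ 0 := by positivity
  let b : ℝ → ℂ := fun ε ↦ ε + a * Complex.I
  have hbre : ∀ ε, (b ε).re = ε := by intro ε; simp [b]
  have hbim : ∀ ε, (b ε).im = a := by intro ε; simp [b]
  let g : ℝ → Rd d → ℂ := fun ε ξ ↦
    Complex.exp (-(b ε) * ‖ξ‖ ^ 2 + 2 * Real.pi * Complex.I * (inner ℝ x ξ : ℝ))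
  have hgint : ∀ ε, 0 < ε → Integrable (g ε) := by
    intro ε hε
    exact GaussianFourier.integrable_cexp_neg_mul_sq_norm_add (by rw [hbre]; exact hε)
      (2 * Real.pi * Complex.I) x
  have hφ : Integrable φ := φ.integrable
  have hFφ : Integrable (𝓕 φ : 𝓢(Rd d, ℂ)) := (𝓕 φ).integrable
  have hgF : ∀ ε, 0 < ε → ∀ w, ‖𝓕 (g ε) w‖ ≤ (Real.pi / |a|) ^ ((d : ℝ) / 2) := by
    intro ε hε w
    have hre : 0 < (b ε).re := by rw [hbre]; exact hε
    have hb0 : b ε ≠ 0 := by intro h; rw [h] at hre; simp at hre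
    have : 𝓕 (g ε) w = _ := fourier_gaussian_innerProductSpace' hre x w
    rw [this, norm_mul]
    have h1 : ((Module.finrank ℝ (Rd d) : ℂ) / 2) = (((d : ℝ) / 2 : ℝ) : ℂ) := by
      simp [finrank_euclideanSpace]
    rw [h1, Complex.norm_cpow_real, norm_div, Complex.norm_real, Real.norm_of_nonneg hpi.le]
    have h2 : |a| ≤ ‖b ε‖ := by rw [← hbim ε]; exact Complex.abs_im_le_norm _
    have h3 : ‖Complex.exp (-Real.pi ^ 2 * ‖x - w‖ ^ 2 / b ε)‖ ≤ 1 := by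
      rw [Complex.norm_exp, Real.exp_le_one_iff]
      have : (-(Real.pi : ℂ) ^ 2 * ‖x - w‖ ^ 2 / b ε) =
          (((-Real.pi ^ 2 * ‖x - w‖ ^ 2 : ℝ)) : ℂ) / b ε := by push_cast; rfl
      rw [this, Complex.div_re]
      simp only [Complex.ofReal_re, Complex.ofReal_im, zero_mul, zero_div, add_zero]
      apply div_nonpos_of_nonpos_of_nonneg _ (Complex.normSq_nonneg _)
      apply mul_nonpos_of_nonpos_of_nonneg _ hre.le
      nlinarith [sq_nonneg (Real.pi * ‖x - w‖)]
    have h4 : 0 < |a| := abs_pos.2 ha0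
    calc _ ≤ (Real.pi / |a|) ^ ((d : ℝ) / 2) * 1 := by gcongr
      _ = _ := mul_one _
  have hflip : ∀ ε, 0 < ε → ‖∫ ξ, 𝓕 φ ξ * g ε ξ‖ ≤
      (Real.pi / |a|) ^ ((d : ℝ) / 2) * ∫ y, ‖φ y‖ := by
    intro ε hε
    have h := VectorFourier.integral_fourierIntegral_smul_eq_flip (μ := volume) (ν := volume)
      (L := innerₗ (Rd d)) (f := φ) (g := g ε) Real.continuous_fourierChar continuous_inner hφ
      (hgint ε hε)
    rw [flip_innerₗ] at h
    have h' : ∫ ξ, 𝓕 φ ξ * g ε ξ = ∫ y, φ y * 𝓕 (g ε) y := h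
    rw [h', ← integral_const_mul]
    refine norm_integral_le_of_norm_le (hφ.norm.const_mul _)
      (Filter.Eventually.of_forall fun y ↦ ?_)
    rw [norm_mul, mul_comm]
    gcongr
    exact hgF ε hε y
  have hlim : Filter.Tendsto (fun ε ↦ ∫ ξ, 𝓕 φ ξ * g ε ξ) (nhdsWithin 0 (Ioi 0))
      (nhds (∫ ξ, 𝓕 φ ξ * g 0 ξ)) := by
    apply tendsto_integral_filter_of_dominated_convergence (fun ξ ↦ ‖𝓕 φ ξ‖)
    · refine eventually_nhdsWithin_of_forall fun ε _ ↦ ?_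
      refine hFφ.aestronglyMeasurable.mul (Continuous.aestronglyMeasurable ?_)
      simp only [g]
      fun_prop
    · refine eventually_nhdsWithin_of_forall fun ε hε ↦ Filter.Eventually.of_forall fun ξ ↦ ?_
      rw [norm_mul]
      refine mul_le_of_le_one_right (norm_nonneg _) ?_
      simp only [g]
      rw [Complex.norm_exp, Real.exp_le_one_iff]
      have hε' : (0 : ℝ) < ε := hε
      have e : (-(b ε) * (‖ξ‖ : ℂ) ^ 2 + 2 * Real.pi * Complex.I * (inner ℝ x ξ : ℝ)).re =
          - (ε * ‖ξ‖ ^ 2) := by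
        have : (-(b ε) * (‖ξ‖ : ℂ) ^ 2 + 2 * Real.pi * Complex.I * (inner ℝ x ξ : ℝ)) =
          ((-(ε * ‖ξ‖ ^ 2) : ℝ) : ℂ) +
          ((-(a * ‖ξ‖ ^ 2) + 2 * Real.pi * inner ℝ x ξ : ℝ) : ℂ) * Complex.I := by
          simp only [b]; push_cast; ring
        rw [this]
        simp only [Complex.add_re, Complex.re_ofReal_mul, Complex.I_re, mul_zero, add_zero,
          Complex.ofReal_re]
      rw [e]
      have : 0 ≤ ε * ‖ξ‖ ^ 2 := by positivity
      linarith
    · exact hFφ.norm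
    · refine Filter.Eventually.of_forall fun ξ ↦ ?_
      refine Filter.Tendsto.mono_left ?_ nhdsWithin_le_nhds
      apply Continuous.tendsto
      simp only [g, b]
      fun_prop
  have hS : schwartzPropagator d τ φ x = ∫ ξ, 𝓕 φ ξ * g 0 ξ := by
    rw [schwartzPropagator_apply]
    congr 1
    funext ξ
    rw [← mul_assoc, mul_comm]
    congr 1
    simp only [g, b, schrodingerSymbol, ← Complex.exp_add]
    congr 1
    rw [real_inner_comm x ξ, ha]
    push_cast
    ring
  have hC : dispersiveConst d * |τ| ^ (-((d : ℝ) / 2)) = (Real.pi / |a|) ^ ((d : ℝ) / 2) := by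
    rw [dispersiveConst, Real.rpow_neg (abs_nonneg _), ← Real.inv_rpow (abs_nonneg _),
      ← Real.mul_rpow (by positivity) (by positivity), ha, abs_mul,
      abs_of_nonneg (sq_nonneg (2 * Real.pi)), ← div_eq_mul_inv, div_div]
  rw [hS, hC]
  exact le_of_tendsto hlim.norm (eventually_nhdsWithin_of_forall fun ε hε ↦ hflip ε hε)

/-- The Fourier transform of `-(2π)⁻²Δφ`. -/
def sqNormFourier (φ : 𝓢(Rd d, ℂ)) : 𝓢(Rd d, ℂ) :=
  SchwartzMap.smulLeftCLM ℂ (fun ξ : Rd d ↦ ‖ξ‖ ^ 2) (𝓕 φ)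

theorem sqNormFourier_apply (φ : 𝓢(Rd d, ℂ)) (ξ : Rd d) :
    sqNormFourier φ ξ = (‖ξ‖ ^ 2 : ℝ) • 𝓕 φ ξ :=
  SchwartzMap.smulLeftCLM_apply_apply (by fun_prop) _ _

theorem norm_symbol_sub_mul_le (τ τ' : ℝ) (φ : 𝓢(Rd d, ℂ)) (ξ : Rd d) :
    ‖schrodingerSymbol d τ ξ * 𝓕 φ ξ - schrodingerSymbol d τ' ξ * 𝓕 φ ξ‖ ≤
      (2 * Real.pi) ^ 2 * |τ - τ'| * ‖sqNormFourier φ ξ‖ := by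
  rw [← sub_mul, norm_mul, sqNormFourier_apply, norm_smul, Real.norm_of_nonneg (by positivity),
    ← mul_assoc]
  gcongr
  exact norm_schrodingerSymbol_sub_le d τ τ' ξ

theorem norm_schwartzPropagator_sub_le (τ τ' : ℝ) (φ : 𝓢(Rd d, ℂ)) (x : Rd d) :
    ‖schwartzPropagator d τ φ x - schwartzPropagator d τ' φ x‖ ≤
      (2 * Real.pi) ^ 2 * |τ - τ'| * ∫ ξ, ‖sqNormFourier φ ξ‖ := by
  have hint : ∀ τ, Integrable fun ξ ↦ Complex.exp (((2 * Real.pi * inner ℝ ξ x : ℝ) : ℂ) *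
      Complex.I) * (schrodingerSymbol d τ ξ * 𝓕 φ ξ) := by
    intro τ
    have hc : Continuous (schrodingerSymbol d τ) := by unfold schrodingerSymbol; fun_prop
    refine Integrable.mono (𝓕 φ).integrable (Continuous.aestronglyMeasurable ?_)
      (Filter.Eventually.of_forall fun ξ ↦ ?_)
    · have := (𝓕 φ).continuous
      fun_prop
    · rw [norm_mul, norm_mul, Complex.norm_exp_ofReal_mul_I, norm_schrodingerSymbol, one_mul,
        one_mul]
  rw [schwartzPropagator_apply, schwartzPropagator_apply, ← integral_sub (hint τ) (hint τ'),
    ← integral_const_mul]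
  refine norm_integral_le_of_norm_le ((sqNormFourier φ).integrable.norm.const_mul _)
    (Filter.Eventually.of_forall fun ξ ↦ ?_)
  rw [← mul_sub, norm_mul, Complex.norm_exp_ofReal_mul_I, one_mul]
  exact norm_symbol_sub_mul_le τ τ' φ ξ

theorem norm_schwartzPropagator_sub_toLp_two_le (τ τ' : ℝ) (φ : 𝓢(Rd d, ℂ)) :
    ‖(schwartzPropagator d τ φ - schwartzPropagator d τ' φ).toLp 2‖ ≤
      (2 * Real.pi) ^ 2 * |τ - τ'| * ‖(sqNormFourier φ).toLp 2‖ := by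
  have hsub : ∀ a b : 𝓢(Rd d, ℂ), 𝓕⁻ a - 𝓕⁻ b = 𝓕⁻ (a - b) := fun a b ↦
    (map_sub (FourierTransform.fourierInvCLM ℂ 𝓢(Rd d, ℂ)) a b).symm
  rw [schwartzPropagator_eq, schwartzPropagator_eq, hsub, norm_fourierInv_toLp_two]
  apply Lp.norm_le_mul_norm_of_ae_le_mul
  filter_upwards [SchwartzMap.coeFn_toLp (sqNormFourier φ) 2,
    SchwartzMap.coeFn_toLp (SchwartzMap.smulLeftCLM ℂ (schrodingerSymbol d τ) (𝓕 φ) -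
    SchwartzMap.smulLeftCLM ℂ (schrodingerSymbol d τ') (𝓕 φ)) 2] with x h1 h2
  rw [h1, h2]
  simp only [sub_apply, SchwartzMap.smulLeftCLM_apply_apply
    (hasTemperateGrowth_schrodingerSymbol d _), smul_eq_mul]
  exact norm_symbol_sub_mul_le τ τ' φ x

/-- Interpolation of the norm of `L^r`, `2 ≤ r ≤ ∞`, between those of `L^2` and `L^∞`. -/
theorem eLpNorm_le_top_rpow_mul_two_rpow {α E : Type*} [MeasurableSpace α] {μ : Measure α}
    [NormedAddCommGroup E] {f : α → E} (hf : AEStronglyMeasurable f μ) {r : ℝ≥0∞} (hr : 2 ≤ r) :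
    eLpNorm f r μ ≤ eLpNorm f ∞ μ ^ (1 - 2 * (r⁻¹).toReal) *
      eLpNorm f 2 μ ^ (2 * (r⁻¹).toReal) := by
  rcases eq_or_ne r ∞ with rfl | hr'
  · simp
  have hr0 : r ≠ 0 := (zero_lt_two.trans_le hr).ne'
  set s := r.toReal with hs
  have hs2 : 2 ≤ s := by
    have := ENNReal.toReal_mono hr' hr
    simpa using this
  have hs0 : 0 < s := by linarith
  have hinv : (r⁻¹).toReal = s⁻¹ := ENNReal.toReal_inv r
  rw [hinv, eLpNorm_eq_lintegral_rpow_enorm_toReal hr0 hr',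
    eLpNorm_eq_lintegral_rpow_enorm_toReal (p := 2) (by simp) (by simp), ← hs]
  simp only [ENNReal.toReal_ofNat]
  calc _ ≤ (∫⁻ x, eLpNorm f ∞ μ ^ (s - 2) * ‖f x‖ₑ ^ (2 : ℝ) ∂μ) ^ (1 / s) := by
        gcongr ?_ ^ _
        apply lintegral_mono_ae
        filter_upwards [enorm_ae_le_eLpNormEssSup f μ] with x hx
        rw [eLpNorm_exponent_top]
        calc ‖f x‖ₑ ^ s = ‖f x‖ₑ ^ (s - 2) * ‖f x‖ₑ ^ (2 : ℝ) := by
              rw [← ENNReal.rpow_add_of_nonneg _ _ (by linarith) (by norm_num)]; congr 1; ring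
          _ ≤ _ := by gcongr
    _ ≤ (eLpNorm f ∞ μ ^ (s - 2) * ∫⁻ x, ‖f x‖ₑ ^ (2 : ℝ) ∂μ) ^ (1 / s) := by
        rw [lintegral_const_mul'' _ (hf.enorm.pow_const _)]
    _ = _ := by
        rw [ENNReal.mul_rpow_of_nonneg _ _ (by positivity), ← ENNReal.rpow_mul,
          ← ENNReal.rpow_mul]
        congr 2
        · field_simp
        · field_simp

theorem two_mul_inv_toReal_le_one {r : ℝ≥0∞} (hr : 2 ≤ r) : 2 * (r⁻¹).toReal ≤ 1 := by
  have h : (r⁻¹).toReal ≤ ((2 : ℝ≥0∞)⁻¹).toReal :=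
    ENNReal.toReal_mono (by simp) (ENNReal.inv_le_inv.2 hr)
  rw [ENNReal.toReal_inv 2, ENNReal.toReal_ofNat] at h
  linarith

theorem norm_toLp_le_rpow_mul_rpow (f : 𝓢(Rd d, ℂ)) {r : ℝ≥0∞} (hr : 2 ≤ r) {B : ℝ}
    (hB : ∀ x, ‖f x‖ ≤ B) :
    ‖f.toLp r‖ ≤ B ^ (1 - 2 * (r⁻¹).toReal) * ‖f.toLp 2‖ ^ (2 * (r⁻¹).toReal) := by
  have hB0 : 0 ≤ B := (norm_nonneg _).trans (hB 0)
  have h1 := two_mul_inv_toReal_le_one hr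
  have htop : eLpNorm f ∞ volume ≤ ENNReal.ofReal B := by
    rw [eLpNorm_exponent_top]
    exact eLpNormEssSup_le_of_ae_bound (Filter.Eventually.of_forall hB)
  have h := eLpNorm_le_top_rpow_mul_two_rpow (μ := volume)
    f.continuous.aestronglyMeasurable hr
  have h2 : eLpNorm f r volume ≤ ENNReal.ofReal B ^ (1 - 2 * (r⁻¹).toReal) *
      eLpNorm f 2 volume ^ (2 * (r⁻¹).toReal) := by
    refine h.trans ?_
    gcongr
  have hfin := (SchwartzMap.eLpNorm_lt_top f 2 volume).ne
  rw [SchwartzMap.norm_toLp, SchwartzMap.norm_toLp]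
  have h3 := ENNReal.toReal_mono (ENNReal.mul_ne_top
    (ENNReal.rpow_ne_top_of_nonneg (by linarith) ENNReal.ofReal_ne_top)
    (ENNReal.rpow_ne_top_of_nonneg (by positivity) hfin)) h2
  rwa [ENNReal.toReal_mul, ← ENNReal.toReal_rpow, ← ENNReal.toReal_rpow,
    ENNReal.toReal_ofReal hB0] at h3

/-- The propagator on a Schwartz function is Lipschitz in time, in every `L^r` with `r ≥ 2`. -/
theorem exists_norm_schwartzPropagator_sub_toLp_le (φ : 𝓢(Rd d, ℂ)) {r : ℝ≥0∞} (hr : 2 ≤ r) :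
    ∃ C : ℝ, ∀ τ τ', ‖(schwartzPropagator d τ φ - schwartzPropagator d τ' φ).toLp r‖ ≤
      C * |τ - τ'| := by
  have h1 := two_mul_inv_toReal_le_one hr
  have h0 : 0 ≤ (r⁻¹).toReal := ENNReal.toReal_nonneg
  refine ⟨((2 * Real.pi) ^ 2 * ∫ ξ, ‖sqNormFourier φ ξ‖) ^ (1 - 2 * (r⁻¹).toReal) *
    ((2 * Real.pi) ^ 2 * ‖(sqNormFourier φ).toLp 2‖) ^ (2 * (r⁻¹).toReal), fun τ τ' ↦ ?_⟩
  refine (norm_toLp_le_rpow_mul_rpow _ hr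
    (fun x ↦ norm_schwartzPropagator_sub_le τ τ' φ x)).trans ?_
  have hI : 0 ≤ ∫ ξ, ‖sqNormFourier φ ξ‖ := integral_nonneg fun _ ↦ norm_nonneg _
  calc _ ≤ ((2 * Real.pi) ^ 2 * |τ - τ'| * ∫ ξ, ‖sqNormFourier φ ξ‖) ^ (1 - 2 * (r⁻¹).toReal) *
        ((2 * Real.pi) ^ 2 * |τ - τ'| * ‖(sqNormFourier φ).toLp 2‖) ^ (2 * (r⁻¹).toReal) := by
        gcongr
        exact norm_schwartzPropagator_sub_toLp_two_le τ τ' φ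
    _ = _ := by
        have e1 : (2 * Real.pi) ^ 2 * |τ - τ'| * ∫ ξ, ‖sqNormFourier φ ξ‖ =
          ((2 * Real.pi) ^ 2 * ∫ ξ, ‖sqNormFourier φ ξ‖) * |τ - τ'| := by ring
        have e2 : (2 * Real.pi) ^ 2 * |τ - τ'| * ‖(sqNormFourier φ).toLp 2‖ =
          ((2 * Real.pi) ^ 2 * ‖(sqNormFourier φ).toLp 2‖) * |τ - τ'| := by ring
        rw [e1, e2, Real.mul_rpow (by positivity) (abs_nonneg _),
          Real.mul_rpow (by positivity) (abs_nonneg _)]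
        have e3 : |τ - τ'| ^ (1 - 2 * (r⁻¹).toReal) * |τ - τ'| ^ (2 * (r⁻¹).toReal) =
            |τ - τ'| := by
          rw [← Real.rpow_add_of_nonneg (abs_nonneg _) (by linarith) (by positivity)]
          simp
        linear_combination (((2 * Real.pi) ^ 2 * ∫ ξ, ‖sqNormFourier φ ξ‖) ^
          (1 - 2 * (r⁻¹).toReal) * ((2 * Real.pi) ^ 2 * ‖(sqNormFourier φ).toLp 2‖) ^
          (2 * (r⁻¹).toReal)) * e3

theorem toLp_sub (f g : 𝓢(Rd d, ℂ)) (p : ℝ≥0∞) [Fact (1 ≤ p)] :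
    (f - g).toLp p volume = f.toLp p volume - g.toLp p volume :=
  map_sub (SchwartzMap.toLpCLM ℂ ℂ p volume) f g

theorem continuous_schwartzPropagator_toLp (φ : 𝓢(Rd d, ℂ)) {r : ℝ≥0∞} [Fact (1 ≤ r)]
    (hr : 2 ≤ r) : Continuous fun τ ↦ (schwartzPropagator d τ φ).toLp r := by
  obtain ⟨C, hC⟩ := exists_norm_schwartzPropagator_sub_toLp_le φ hr
  apply LipschitzWith.continuous (K := C.toNNReal)
  apply LipschitzWith.of_dist_le_mul
  intro τ τ'
  rw [dist_eq_norm, ← toLp_sub, Real.dist_eq]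
  refine (hC τ τ').trans ?_
  gcongr
  exact Real.le_coe_toNNReal C

/-- Decay of the propagator on a Schwartz function: the dispersive bound for large times and
boundedness for small ones. -/
theorem exists_norm_schwartzPropagator_toLp_le (φ : 𝓢(Rd d, ℂ)) {r : ℝ≥0∞} (hr : 2 ≤ r) :
    ∃ C : ℝ, 0 ≤ C ∧ ∀ τ, ‖(schwartzPropagator d τ φ).toLp r‖ ≤
      C * (1 + |τ|) ^ (-((d : ℝ) * (1 / 2 - (r⁻¹).toReal))) := by
  have h1 := two_mul_inv_toReal_le_one hr
  have h0 : 0 ≤ (r⁻¹).toReal := ENNReal.toReal_nonneg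
  obtain ⟨B, hB0, hB⟩ : ∃ B : ℝ, 0 ≤ B ∧ ∀ τ x, ‖schwartzPropagator d τ φ x‖ ≤
      B * (1 + |τ|) ^ (-((d : ℝ) / 2)) := by
    have hI1 : 0 ≤ ∫ ξ, ‖𝓕 φ ξ‖ := integral_nonneg fun _ ↦ norm_nonneg _
    have hI2 : 0 ≤ ∫ ξ, ‖φ ξ‖ := integral_nonneg fun _ ↦ norm_nonneg _
    have hd0 := dispersiveConst_pos d
    refine ⟨2 ^ ((d : ℝ) / 2) * (∫ ξ, ‖𝓕 φ ξ‖) +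
      2 ^ ((d : ℝ) / 2) * (dispersiveConst d * ∫ y, ‖φ y‖), by positivity, fun τ x ↦ ?_⟩
    rcases le_total |τ| 1 with hτ | hτ
    · have h2 : (1 : ℝ) ≤ 2 ^ ((d : ℝ) / 2) * (1 + |τ|) ^ (-((d : ℝ) / 2)) := by
        rw [Real.rpow_neg (by positivity), ← div_eq_mul_inv, one_le_div (by positivity)]
        gcongr
        linarith
      calc _ ≤ ∫ ξ, ‖𝓕 φ ξ‖ := norm_schwartzPropagator_le τ φ x
        _ ≤ (∫ ξ, ‖𝓕 φ ξ‖) * (2 ^ ((d : ℝ) / 2) * (1 + |τ|) ^ (-((d : ℝ) / 2))) :=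
            le_mul_of_one_le_right hI1 h2
        _ ≤ (∫ ξ, ‖𝓕 φ ξ‖) * (2 ^ ((d : ℝ) / 2) * (1 + |τ|) ^ (-((d : ℝ) / 2))) +
            2 ^ ((d : ℝ) / 2) * (dispersiveConst d * ∫ y, ‖φ y‖) *
              (1 + |τ|) ^ (-((d : ℝ) / 2)) := le_add_of_nonneg_right (by positivity)
        _ = _ := by ring
    · have hτ0 : τ ≠ 0 := by rintro rfl; simp at hτ; linarith
      have h2 : |τ| ^ (-((d : ℝ) / 2)) ≤ 2 ^ ((d : ℝ) / 2) * (1 + |τ|) ^ (-((d : ℝ) / 2)) := by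
        have hp : 0 < |τ| := abs_pos.2 hτ0
        rw [Real.rpow_neg (by positivity), Real.rpow_neg (by positivity), ← div_eq_mul_inv,
          inv_le_comm₀ (by positivity) (by positivity), inv_div, ← Real.div_rpow (by positivity)
          (by positivity)]
        gcongr
        linarith
      calc _ ≤ dispersiveConst d * |τ| ^ (-((d : ℝ) / 2)) * ∫ y, ‖φ y‖ :=
            norm_schwartzPropagator_le_dispersive hτ0 φ x
        _ ≤ dispersiveConst d * (2 ^ ((d : ℝ) / 2) * (1 + |τ|) ^ (-((d : ℝ) / 2))) *
            ∫ y, ‖φ y‖ := by gcongr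
        _ ≤ 2 ^ ((d : ℝ) / 2) * (∫ ξ, ‖𝓕 φ ξ‖) * (1 + |τ|) ^ (-((d : ℝ) / 2)) +
            dispersiveConst d * (2 ^ ((d : ℝ) / 2) * (1 + |τ|) ^ (-((d : ℝ) / 2))) *
            ∫ y, ‖φ y‖ := le_add_of_nonneg_left (by positivity)
        _ = _ := by ring
  refine ⟨B ^ (1 - 2 * (r⁻¹).toReal) * ‖φ.toLp 2‖ ^ (2 * (r⁻¹).toReal), by positivity,
    fun τ ↦ (norm_toLp_le_rpow_mul_rpow _ hr (hB τ)).trans (le_of_eq ?_)⟩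
  rw [norm_schwartzPropagator_toLp_two, Real.mul_rpow hB0 (by positivity),
    ← Real.rpow_mul (by positivity)]
  have : -((d : ℝ) / 2) * (1 - 2 * (r⁻¹).toReal) = -((d : ℝ) * (1 / 2 - (r⁻¹).toReal)) := by ring
  rw [this]
  ring

end Schwartz

/-! ### The propagator on `L²` -/

section Hilbert

open FourierTransform

/-- The Hilbert space `L²(ℝ^d)`. -/
abbrev L2d (d : ℕ) : Type := Lp ℂ 2 (volume : Measure (Rd d))

variable {d : ℕ}

/-- The propagator on Schwartz functions as a linear equivalence. -/
def schwartzPropagatorEquiv (d : ℕ) (τ : ℝ) : 𝓢(Rd d, ℂ) ≃ₗ[ℂ] 𝓢(Rd d, ℂ) where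
  __ := (schwartzPropagator d τ).toLinearMap
  invFun := schwartzPropagator d (-τ)
  left_inv f := by
    change schwartzPropagator d (-τ) (schwartzPropagator d τ f) = f
    rw [schwartzPropagator_add, neg_add_cancel, schwartzPropagator_zero]
  right_inv f := by
    change schwartzPropagator d τ (schwartzPropagator d (-τ) f) = f
    rw [schwartzPropagator_add, add_neg_cancel, schwartzPropagator_zero]

theorem denseRange_toLp_two : DenseRange (SchwartzMap.toLpCLM ℂ (E := Rd d) ℂ 2 volume) :=
  SchwartzMap.denseRange_toLpCLM ENNReal.ofNat_ne_top

/-- The unitary propagator `e^{iτΔ}` on `L²`. -/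
def l2Propagator (d : ℕ) (τ : ℝ) : L2d d ≃ₗᵢ[ℂ] L2d d :=
  (schwartzPropagatorEquiv d τ).extendOfIsometry
    (SchwartzMap.toLpCLM ℂ (E := Rd d) ℂ 2 volume).toLinearMap
    (SchwartzMap.toLpCLM ℂ (E := Rd d) ℂ 2 volume).toLinearMap
    denseRange_toLp_two denseRange_toLp_two (norm_schwartzPropagator_toLp_two τ)

theorem l2Propagator_toLp (τ : ℝ) (φ : 𝓢(Rd d, ℂ)) :
    l2Propagator d τ (φ.toLp 2) = (schwartzPropagator d τ φ).toLp 2 :=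
  LinearEquiv.extendOfIsometry_eq (schwartzPropagatorEquiv d τ)
    (SchwartzMap.toLpCLM ℂ (E := Rd d) ℂ 2 volume).toLinearMap
    (SchwartzMap.toLpCLM ℂ (E := Rd d) ℂ 2 volume).toLinearMap
    denseRange_toLp_two denseRange_toLp_two (norm_schwartzPropagator_toLp_two τ) φ

theorem l2Propagator_add (τ τ' : ℝ) (f : L2d d) :
    l2Propagator d τ (l2Propagator d τ' f) = l2Propagator d (τ + τ') f := by
  refine denseRange_toLp_two.induction_on f (isClosed_eq (by fun_prop) (by fun_prop)) fun φ ↦ ?_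
  simp only [SchwartzMap.toLpCLM_apply]
  rw [l2Propagator_toLp, l2Propagator_toLp, l2Propagator_toLp, schwartzPropagator_add]

theorem l2Propagator_zero (f : L2d d) : l2Propagator d 0 f = f := by
  refine denseRange_toLp_two.induction_on f (isClosed_eq (by fun_prop) (by fun_prop)) fun φ ↦ ?_
  simp only [SchwartzMap.toLpCLM_apply]
  rw [l2Propagator_toLp, schwartzPropagator_zero]

theorem inner_l2Propagator (τ : ℝ) (f g : L2d d) :
    inner ℂ f (l2Propagator d τ g) = inner ℂ (l2Propagator d (-τ) f) g := by
  rw [← LinearIsometryEquiv.inner_map_map (l2Propagator d τ) (l2Propagator d (-τ) f) g,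
    l2Propagator_add, add_neg_cancel, l2Propagator_zero]

theorem inner_l2Propagator_l2Propagator (τ τ' : ℝ) (f g : L2d d) :
    inner ℂ (l2Propagator d τ f) (l2Propagator d τ' g) =
      inner ℂ f (l2Propagator d (τ' - τ) g) := by
  rw [inner_l2Propagator, inner_l2Propagator, l2Propagator_add]
  congr 3
  ring

theorem continuous_l2Propagator (f : L2d d) : Continuous fun τ ↦ l2Propagator d τ f := by
  refine continuous_of_uniform_approx_of_continuous fun u hu ↦ ?_
  obtain ⟨ε, hε, hεu⟩ := Metric.mem_uniformity_dist.1 hu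
  obtain ⟨φ, hφ⟩ := denseRange_toLp_two.exists_dist_lt f hε
  refine ⟨fun τ ↦ (schwartzPropagator d τ φ).toLp 2,
    continuous_schwartzPropagator_toLp φ le_rfl, fun τ ↦ hεu ?_⟩
  change dist (l2Propagator d τ f) ((schwartzPropagator d τ φ).toLp 2 volume) < ε
  rw [← l2Propagator_toLp, LinearIsometryEquiv.dist_map]
  exact hφ

/-- Indicators are approximated in `L^2` by Schwartz functions without much increase of the norm of
`L^1`, so that the dispersive estimate passes to the limit. -/
theorem exists_schwartz_approx_indicator {E : Set (Rd d)} (hE : MeasurableSet E)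
    (hfin : volume E ≠ ∞) {η : ℝ} (hη : 0 < η) :
    ∃ g : 𝓢(Rd d, ℂ), ‖g.toLp 2 volume - indicatorConstLp 2 hE hfin (1 : ℂ)‖ ≤ η ∧
      ∫ x, ‖g x‖ ≤ volume.real E + η := by
  set η' : ℝ := min η (η ^ 2 / 2) with hη'
  have hη'0 : 0 < η' := by positivity
  obtain ⟨K, hKE, hK, hKd⟩ := hE.exists_isCompact_sdiff_lt hfin
    (ε := ENNReal.ofReal η') (by simpa using hη'0)
  obtain ⟨O, hEO, hO, hOlt⟩ := E.exists_isOpen_lt_add hfin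
    (ε := ENNReal.ofReal η') (by simpa using hη'0)
  have hOfin : volume O ≠ ∞ := (hOlt.trans (by finiteness)).ne
  obtain ⟨R, hR⟩ := hK.isBounded.subset_ball 0
  obtain ⟨f, hfs, hf01, hfsupp, hf1⟩ := exists_contMDiff_support_eq_eq_one_iff
    (n := (⊤ : ℕ∞)) (modelWithCornersSelf ℝ (Rd d)) (hO.inter Metric.isOpen_ball) hK.isClosed
    (subset_inter (hKE.trans hEO) hR)
  have hfs' : ContDiff ℝ (⊤ : ℕ∞) (Complex.ofRealCLM ∘ f) :=
    Complex.ofRealCLM.contDiff.comp hfs.contDiff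
  have hcs : HasCompactSupport f := HasCompactSupport.of_support_subset_isCompact
    (isCompact_closedBall (0 : Rd d) R) (by
      rw [hfsupp]; exact inter_subset_right.trans Metric.ball_subset_closedBall)
  have hcs' : HasCompactSupport (Complex.ofRealCLM ∘ f) := hcs.comp_left rfl
  let g : 𝓢(Rd d, ℂ) := hcs'.toSchwartzMap hfs'
  have hg : ∀ x, g x = f x := fun x ↦ rfl
  have hf0 : ∀ x, 0 ≤ f x ∧ f x ≤ 1 := fun x ↦ hf01 (mem_range_self x)
  have hfO : ∀ x, x ∉ O → f x = 0 := by
    intro x hx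
    by_contra h
    have : x ∈ Function.support f := h
    rw [hfsupp] at this
    exact hx this.1
  refine ⟨g, ?_, ?_⟩
  · have hmeas : MeasurableSet (O \ K) := hO.measurableSet.diff hK.measurableSet
    have hvol : volume (O \ K) ≤ ENNReal.ofReal (η ^ 2) := by
      have h1 : O \ K ⊆ (O \ E) ∪ (E \ K) := fun x hx ↦ by
        by_cases hxE : x ∈ E
        · exact Or.inr ⟨hxE, hx.2⟩
        · exact Or.inl ⟨hx.1, hxE⟩
      have h2 : volume (O \ E) ≤ ENNReal.ofReal η' := by
        rw [measure_sdiff hEO hE.nullMeasurableSet hfin, tsub_le_iff_left]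
        exact hOlt.le
      calc _ ≤ ENNReal.ofReal η' + ENNReal.ofReal η' :=
            (measure_mono h1).trans ((measure_union_le _ _).trans (add_le_add h2 hKd.le))
        _ = ENNReal.ofReal (η' + η') := (ENNReal.ofReal_add hη'0.le hη'0.le).symm
        _ ≤ _ := ENNReal.ofReal_le_ofReal (by have := min_le_right η (η ^ 2 / 2); linarith)
    rw [Lp.norm_def]
    apply ENNReal.toReal_le_of_le_ofReal hη.le
    calc _ ≤ eLpNorm ((O \ K).indicator fun _ ↦ (1 : ℂ)) 2 volume := by
          apply eLpNorm_mono_ae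
          filter_upwards [Lp.coeFn_sub (g.toLp 2) (indicatorConstLp 2 hE hfin (1 : ℂ)),
            g.coeFn_toLp 2, indicatorConstLp_coeFn (p := 2) (hs := hE) (hμs := hfin)
            (c := (1 : ℂ))] with x h1 h2 h3
          rw [h1, Pi.sub_apply, h2, h3, hg]
          obtain ⟨h0, h1⟩ := hf0 x
          by_cases hxK : x ∈ K
          · have : f x = 1 := (hf1 x).1 hxK
            simp [this, hKE hxK]
          by_cases hxO : x ∈ O
          · rw [indicator_of_mem (show x ∈ O \ K from ⟨hxO, hxK⟩)]
            by_cases hxE : x ∈ E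
            · rw [indicator_of_mem hxE, ← Complex.ofReal_one, ← Complex.ofReal_sub,
                Complex.norm_real, Complex.norm_real, norm_one, Real.norm_eq_abs, abs_le]
              constructor <;> linarith
            · rw [indicator_of_notMem hxE, sub_zero, Complex.norm_real, norm_one,
                Real.norm_eq_abs, abs_le]
              constructor <;> linarith
          · rw [hfO x hxO, indicator_of_notMem (fun h ↦ hxO (hEO h))]
            simp
      _ = volume (O \ K) ^ (1 / 2 : ℝ) := by
          rw [eLpNorm_indicator_const hmeas (by simp) (by simp)]; simp
      _ ≤ ENNReal.ofReal (η ^ 2) ^ (1 / 2 : ℝ) := by gcongr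
      _ = ENNReal.ofReal η := by
          rw [ENNReal.ofReal_rpow_of_nonneg (by positivity) (by norm_num), ← Real.sqrt_eq_rpow,
            Real.sqrt_sq hη.le]
  · calc ∫ x, ‖g x‖ ≤ ∫ x, O.indicator (fun _ ↦ (1 : ℝ)) x := by
          apply integral_mono g.integrable.norm
          · exact (integrable_indicator_iff hO.measurableSet).2 (integrableOn_const hOfin)
          · intro x
            simp only [hg, Complex.norm_real, Real.norm_of_nonneg (hf0 x).1]
            by_cases hxO : x ∈ O
            · simpa [hxO] using (hf0 x).2
            · simp [hxO, hfO x hxO]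
      _ = volume.real O := by rw [integral_indicator hO.measurableSet]; simp
      _ ≤ volume.real E + η := by
          have h := ENNReal.toReal_mono (by finiteness) hOlt.le
          rw [ENNReal.toReal_add hfin (by finiteness), ENNReal.toReal_ofReal hη'0.le] at h
          have := min_le_left η (η ^ 2 / 2)
          simp only [Measure.real]
          linarith

/-- The dispersive estimate, tested on indicators. -/
theorem norm_inner_l2Propagator_indicator_le {τ : ℝ} (hτ : τ ≠ 0) {E E' : Set (Rd d)}
    (hE : MeasurableSet E) (hE' : MeasurableSet E') (hfin : volume E ≠ ∞)
    (hfin' : volume E' ≠ ∞) :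
    ‖inner ℂ (indicatorConstLp 2 hE' hfin' (1 : ℂ))
      (l2Propagator d τ (indicatorConstLp 2 hE hfin (1 : ℂ)))‖ ≤
      dispersiveConst d * |τ| ^ (-((d : ℝ) / 2)) * volume.real E' * volume.real E := by
  set e := indicatorConstLp 2 hE hfin (1 : ℂ) with he
  set e' := indicatorConstLp 2 hE' hfin' (1 : ℂ) with he'
  set D := dispersiveConst d * |τ| ^ (-((d : ℝ) / 2)) with hD
  have hD0 : 0 ≤ D := mul_nonneg (dispersiveConst_pos d).le (by positivity)
  have h1 : ∀ g : 𝓢(Rd d, ℂ), ‖inner ℂ (g.toLp 2) (l2Propagator d τ e)‖ ≤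
      D * (∫ x, ‖g x‖) * volume.real E := by
    intro g
    rw [inner_l2Propagator, l2Propagator_toLp, ← inner_conj_symm, RCLike.norm_conj, he,
      L2.inner_indicatorConstLp_one]
    refine norm_setIntegral_le_of_norm_le_const_ae hfin.lt_top ?_
    have hae := (schwartzPropagator d (-τ) g).coeFn_toLp 2 volume
    filter_upwards [ae_restrict_of_ae hae] with x hx
    rw [hx]
    have := norm_schwartzPropagator_le_dispersive (neg_ne_zero.2 hτ) g x
    rwa [abs_neg] at this
  have hlim : ∀ η : ℝ, 0 < η → ‖inner ℂ e' (l2Propagator d τ e)‖ ≤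
      D * (volume.real E' + η) * volume.real E + η * ‖e‖ := by
    intro η hη
    obtain ⟨g, hg1, hg2⟩ := exists_schwartz_approx_indicator hE' hfin' hη
    have h2 : inner ℂ e' (l2Propagator d τ e) = inner ℂ (g.toLp 2) (l2Propagator d τ e) -
        inner ℂ (g.toLp 2 volume - e') (l2Propagator d τ e) := by rw [inner_sub_left]; ring
    rw [h2]
    refine (norm_sub_le _ _).trans (add_le_add ((h1 g).trans ?_) ?_)
    · gcongr
    · refine (norm_inner_le_norm _ _).trans ?_
      rw [LinearIsometryEquiv.norm_map]
      gcongr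
  have ht : Filter.Tendsto (fun η : ℝ ↦ D * (volume.real E' + η) * volume.real E + η * ‖e‖)
      (nhdsWithin 0 (Ioi 0)) (nhds (D * (volume.real E' + 0) * volume.real E + 0 * ‖e‖)) :=
    (Continuous.tendsto (by fun_prop) 0).mono_left nhdsWithin_le_nhds
  have := ge_of_tendsto ht (eventually_nhdsWithin_of_forall fun η hη ↦ hlim η hη)
  simpa using this

end Hilbert

/-! ### Step functions and their evolution -/

/-- A finite family of pairwise disjoint measurable sets of finite measure, over which step
functions are formed. -/
structure FinFamily {α : Type*} [MeasurableSpace α] (μ : Measure α) (ι : Type*) where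
  /-- the sets of the family -/
  set : ι → Set α
  meas : ∀ i, MeasurableSet (set i)
  fin : ∀ i, μ (set i) ≠ ∞
  disj : Pairwise (Function.onFun Disjoint set)

namespace FinFamily

section General

variable {α ι : Type*} [MeasurableSpace α] {μ : Measure α} (A : FinFamily μ ι)

/-- The measures of the sets of the family. -/
def weight (i : ι) : ℝ≥0 := (μ (A.set i)).toNNReal

theorem coe_weight (i : ι) : (A.weight i : ℝ) = μ.real (A.set i) := rfl

theorem ennreal_coe_weight (i : ι) : (A.weight i : ℝ≥0∞) = μ (A.set i) :=
  ENNReal.coe_toNNReal (A.fin i)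

/-- The family of intersections with a measurable set. -/
def restrict {S : Set α} (hS : MeasurableSet S) : FinFamily μ ι where
  set i := A.set i ∩ S
  meas i := (A.meas i).inter hS
  fin i := measure_ne_top_of_subset inter_subset_left (A.fin i)
  disj _ _ h := (A.disj h).mono inter_subset_left inter_subset_left

variable [Fintype ι] {M : Type*} [AddCommGroup M] [Module ℂ M]

open Classical in
/-- The value at `s` of the step function with coefficients `c`. -/
def coef (s : α) : (ι → M) →ₗ[ℂ] M :=
  ∑ i, (if s ∈ A.set i then (1 : ℂ) else 0) • LinearMap.proj i

theorem coef_of_mem {s : α} {i : ι} (h : s ∈ A.set i) (c : ι → M) : A.coef s c = c i := by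
  classical
  rw [coef, LinearMap.sum_apply, Finset.sum_eq_single i]
  · simp [h]
  · intro j _ hj
    have : s ∉ A.set j := fun hs ↦ (A.disj hj).le_bot ⟨hs, h⟩
    simp [this]
  · simp

theorem coef_of_notMem {s : α} (h : ∀ i, s ∉ A.set i) (c : ι → M) : A.coef s c = 0 := by
  simp [coef, h]

/-- A function of a step function is a sum over the steps. -/
theorem apply_coef {N : Type*} [AddCommMonoid N] (f : α → M → N) (hf : ∀ s, f s 0 = 0)
    (c : ι → M) (s : α) :
    f s (A.coef s c) = ∑ i, (A.set i).indicator (fun s ↦ f s (c i)) s := by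
  classical
  by_cases h : ∃ i, s ∈ A.set i
  · obtain ⟨i, hi⟩ := h
    rw [A.coef_of_mem hi, Finset.sum_eq_single i]
    · rw [indicator_of_mem hi]
    · intro j _ hj
      exact indicator_of_notMem (fun hs ↦ (A.disj hj).le_bot ⟨hs, hi⟩) _
    · simp
  · push Not at h
    rw [A.coef_of_notMem h, hf]
    exact (Finset.sum_eq_zero fun i _ ↦ indicator_of_notMem (h i) _).symm

theorem coef_restrict {S : Set α} (hS : MeasurableSet S) (c : ι → M) (s : α) [Decidable (s ∈ S)] :
    (A.restrict hS).coef s c = if s ∈ S then A.coef s c else 0 := by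
  split_ifs with h
  · by_cases hi : ∃ i, s ∈ A.set i
    · obtain ⟨i, hi⟩ := hi
      rw [A.coef_of_mem hi, coef_of_mem (A.restrict hS) (i := i) ⟨hi, h⟩]
    · push Not at hi
      rw [A.coef_of_notMem hi]
      exact coef_of_notMem _ (fun i (h' : s ∈ A.set i ∩ S) ↦ hi i h'.1) _
  · exact coef_of_notMem _ (fun i (hi : s ∈ A.set i ∩ S) ↦ h hi.2) _

theorem lintegral_coef (f : M → ℝ≥0∞) (hf : f 0 = 0) (c : ι → M) :
    ∫⁻ s, f (A.coef s c) ∂μ = ∑ i, A.weight i * f (c i) := by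
  simp_rw [A.apply_coef (fun _ ↦ f) (fun _ ↦ hf) c]
  rw [lintegral_finsetSum _ fun i _ ↦ measurable_const.indicator (A.meas i)]
  refine Finset.sum_congr rfl fun i _ ↦ ?_
  rw [lintegral_indicator (A.meas i), setLIntegral_const, A.ennreal_coe_weight, mul_comm]

theorem measurable_coef {N : Type*} [MeasurableSpace N] [AddCommMonoid N] [MeasurableAdd₂ N]
    (f : α → M → N) (hf : ∀ s, f s 0 = 0) (hm : ∀ m, Measurable fun s ↦ f s m) (c : ι → M) :
    Measurable fun s ↦ f s (A.coef s c) := by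
  simp_rw [A.apply_coef f hf c]
  exact Finset.measurable_fun_sum _ fun i _ ↦ (hm _).indicator (A.meas i)

theorem map_coef {N : Type*} [AddCommGroup N] [Module ℂ N] (L : M →ₗ[ℂ] N) (c : ι → M) (s : α) :
    L (A.coef s c) = A.coef s fun i ↦ L (c i) := by
  by_cases h : ∃ i, s ∈ A.set i
  · obtain ⟨i, hi⟩ := h
    rw [A.coef_of_mem hi, A.coef_of_mem hi]
  · push Not at h
    rw [A.coef_of_notMem h, A.coef_of_notMem h, map_zero]

end General

/-- Applying a bounded continuous family of maps to a step function gives an integrable function. -/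
theorem integrable_apply_coef {ι M N : Type*} [Fintype ι] [AddCommGroup M] [Module ℂ M]
    [NormedAddCommGroup N] (A : FinFamily (volume : Measure ℝ) ι) (T : ℝ → M → N)
    (hT0 : ∀ s, T s 0 = 0) (hT : ∀ x, Continuous fun s ↦ T s x)
    (hb : ∀ x, ∃ C, ∀ s, ‖T s x‖ ≤ C) (c : ι → M) :
    Integrable fun s ↦ T s (A.coef s c) := by
  simp_rw [A.apply_coef T hT0 c]
  refine integrable_finsetSum _ fun i _ ↦ (integrable_indicator_iff (A.meas i)).2 ?_
  obtain ⟨C, hC⟩ := hb (c i)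
  exact Measure.integrableOn_of_bounded (M := C) (A.fin i) (hT _).aestronglyMeasurable
    (Filter.Eventually.of_forall hC)

section Space

variable {d : ℕ} {κ : Type*} [Fintype κ] (E : FinFamily (volume : Measure (Rd d)) κ)

/-- The element of `L²` with coefficients `x`. -/
def vec : (κ → ℂ) →ₗ[ℂ] L2d d :=
  Fintype.linearCombination ℂ fun k ↦ indicatorConstLp 2 (E.meas k) (E.fin k) (1 : ℂ)

theorem vec_apply (x : κ → ℂ) :
    E.vec x = ∑ k, x k • indicatorConstLp 2 (E.meas k) (E.fin k) (1 : ℂ) := by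
  rw [vec, Fintype.linearCombination_apply]

theorem norm_vec (x : κ → ℂ) : ‖E.vec x‖ = wnorm E.weight (1 / 2) x := by
  classical
  have h : ‖E.vec x‖ ^ 2 = ∑ k, E.weight k * ‖x k‖ ^ 2 := by
    rw [← RCLike.ofReal_inj (K := ℂ), RCLike.ofReal_pow, ← inner_self_eq_norm_sq_to_K (𝕜 := ℂ),
      E.vec_apply, sum_inner]
    push_cast
    refine Finset.sum_congr rfl fun k _ ↦ ?_
    rw [inner_sum, Finset.sum_eq_single k]
    · rw [inner_smul_left, inner_smul_right,
        L2.inner_indicatorConstLp_one_indicatorConstLp_one _ _ (E.fin k) (E.fin k),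
        inter_self, ← mul_assoc, RCLike.conj_mul, E.coe_weight]
      ring
    · intro l _ hl
      have : E.set k ∩ E.set l = ∅ := (E.disj hl.symm).inter_eq
      rw [inner_smul_left, inner_smul_right,
        L2.inner_indicatorConstLp_one_indicatorConstLp_one _ _ (E.fin k) (E.fin l), this]
      simp
    · simp
  unfold wnorm
  rw [← Real.sqrt_eq_rpow, ← Real.sqrt_sq (norm_nonneg (E.vec x)), h]
  simp

theorem wnorm_star (v : κ → ℝ≥0) (ρ : ℝ) (x : κ → ℂ) : wnorm v ρ (star x) = wnorm v ρ x := by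
  simp [wnorm]

theorem star_vec_smul (a : ℂ) (x : κ → ℂ) :
    E.vec (star (a • x)) = (starRingEnd ℂ) a • E.vec (star x) := by
  rw [← map_smul]
  congr 1
  ext k
  simp

variable {κ' : Type*} [Fintype κ'] (E' : FinFamily (volume : Measure (Rd d)) κ')

/-- The case `ρ = 1` of `norm_inner_vec_le`, summed over the steps of both functions. -/
theorem norm_inner_vec_le_one {τ : ℝ} (hτ : τ ≠ 0) (g : κ' → ℂ) (c : κ → ℂ) :
    ‖inner ℂ (E'.vec g) (l2Propagator d τ (E.vec c))‖ ≤
      dispersiveConst d * |τ| ^ (-((d : ℝ) / 2)) * wnorm E'.weight 1 g * wnorm E.weight 1 c := by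
  rw [E'.vec_apply, E.vec_apply, map_sum, sum_inner, wnorm_one, wnorm_one, mul_assoc,
    Finset.sum_mul_sum, Finset.mul_sum]
  refine (norm_sum_le _ _).trans (Finset.sum_le_sum fun k _ ↦ ?_)
  rw [inner_sum, Finset.mul_sum]
  refine (norm_sum_le _ _).trans (Finset.sum_le_sum fun l _ ↦ ?_)
  rw [inner_smul_left, map_smul, inner_smul_right, norm_mul, norm_mul, RCLike.norm_conj]
  calc _ ≤ ‖g k‖ * (‖c l‖ * (dispersiveConst d * |τ| ^ (-((d : ℝ) / 2)) *
        volume.real (E'.set k) * volume.real (E.set l))) := by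
        gcongr
        exact norm_inner_l2Propagator_indicator_le hτ (E.meas l) (E'.meas k) (E.fin l) (E'.fin k)
    _ = _ := by rw [← E.coe_weight, ← E'.coe_weight]; ring

/-- The dispersive estimates `L^{1/ρ} → L^{1/(1-ρ)}`, tested on step functions. -/
theorem norm_inner_vec_le {τ : ℝ} (hτ : τ ≠ 0) {ρ : ℝ} (hρ : ρ ∈ Icc (1 / 2 : ℝ) 1)
    (g : κ' → ℂ) (c : κ → ℂ) :
    ‖inner ℂ (E'.vec g) (l2Propagator d τ (E.vec c))‖ ≤
      dispersiveConst d ^ (2 * ρ - 1) * |τ| ^ (-((d : ℝ) * (ρ - 1 / 2))) *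
        wnorm E.weight ρ c * wnorm E'.weight ρ g := by
  have hD := dispersiveConst_pos d
  let B : (Unit → κ → ℂ) →ₗ[ℂ] (Unit → κ' → ℂ) →ₗ[ℂ] ℂ := LinearMap.mk₂ ℂ
    (fun c g ↦ inner ℂ (E'.vec (star (g ()))) (l2Propagator d τ (E.vec (c ()))))
    (fun c c' g ↦ by simp [inner_add_right])
    (fun a c g ↦ by simp [inner_smul_right])
    (fun c g g' ↦ by simp [inner_add_left])
    (fun a c g ↦ by simp only [Pi.smul_apply, star_vec_smul, inner_smul_left]; simp)
  have hB : ∀ c g, B c g =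
    inner ℂ (E'.vec (star (g ()))) (l2Propagator d τ (E.vec (c ()))) := fun _ _ ↦ rfl
  have h := bilin_interpolation (u := fun _ : Unit ↦ 1) (v := E.weight) (u' := fun _ : Unit ↦ 1)
    (v' := E'.weight) B (π₀ := 1) (π₁ := 1) (ρ₀ := 1) (ρ₁ := 1 / 2) (π₀' := 1) (π₁' := 1)
    (ρ₀' := 1) (ρ₁' := 1 / 2) (M₀ := dispersiveConst d * |τ| ^ (-((d : ℝ) / 2))) (M₁ := 1)
    (θ := 2 - 2 * ρ) ⟨by linarith [hρ.2], by linarith [hρ.1]⟩ (by positivity) (by norm_num)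
    (by norm_num) (by norm_num) (by norm_num) (by norm_num) (by norm_num) (by norm_num)
    (by norm_num) (by norm_num) ?_ ?_ (fun _ ↦ c) (fun _ ↦ star g)
  · rw [hB, star_star] at h
    refine h.trans (le_of_eq ?_)
    have e1 : (1 - (2 - 2 * ρ)) * 1 + (2 - 2 * ρ) * 1 = (1 : ℝ) := by ring
    have e2 : (1 - (2 - 2 * ρ)) * 1 + (2 - 2 * ρ) * (1 / 2) = ρ := by ring
    rw [e1, e2, mixedNorm_unit one_pos, mixedNorm_unit one_pos, wnorm_star, Real.one_rpow,
      mul_one, Real.mul_rpow hD.le (by positivity), ← Real.rpow_mul (abs_nonneg _)]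
    have e3 : 1 - (2 - 2 * ρ) = 2 * ρ - 1 := by ring
    have e4 : -((d : ℝ) / 2) * (2 * ρ - 1) = -((d : ℝ) * (ρ - 1 / 2)) := by ring
    rw [e3, e4]
  · intro c g
    rw [hB, mixedNorm_unit one_pos, mixedNorm_unit one_pos]
    refine (norm_inner_vec_le_one E E' hτ _ _).trans (le_of_eq ?_)
    rw [wnorm_star]; simp only [PUnit.default_eq_unit]; ring
  · intro c g
    rw [hB, mixedNorm_unit one_pos, mixedNorm_unit one_pos]
    refine (norm_inner_le_norm _ _).trans (le_of_eq ?_)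
    rw [LinearIsometryEquiv.norm_map, norm_vec, norm_vec, wnorm_star]
    simp only [PUnit.default_eq_unit]; ring

end Space

section Evolution

variable {d : ℕ} {I κ : Type*} [Fintype I] [Fintype κ] (A : FinFamily (volume : Measure ℝ) I)
  (E : FinFamily (volume : Measure (Rd d)) κ)

theorem integrable_propagator_coef (c : I → κ → ℂ) (t : ℝ) :
    Integrable fun s ↦ l2Propagator d (t - s) (E.vec (A.coef s c)) :=
  A.integrable_apply_coef (fun s x ↦ l2Propagator d (t - s) (E.vec x)) (by simp)
    (fun _ ↦ (continuous_l2Propagator _).comp (continuous_const.sub continuous_id))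
    (fun x ↦ ⟨‖E.vec x‖, fun _ ↦ (LinearIsometryEquiv.norm_map _ _).le⟩) c

/-- The superposition `∫ e^{i(t-s)Δ} F(s) ds` of a step function `F` with coefficients `c`. -/
def evolve (t : ℝ) : (I → κ → ℂ) →ₗ[ℂ] L2d d where
  toFun c := ∫ s, l2Propagator d (t - s) (E.vec (A.coef s c))
  map_add' c c' := by
    simp only [map_add]
    exact integral_add (integrable_propagator_coef A E c t) (integrable_propagator_coef A E c' t)
  map_smul' a c := by
    simp only [map_smul, RingHom.id_apply]
    exact integral_smul a _

theorem evolve_apply (t : ℝ) (c : I → κ → ℂ) :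
    evolve A E t c = ∫ s, l2Propagator d (t - s) (E.vec (A.coef s c)) := rfl

theorem inner_evolve (t : ℝ) (c : I → κ → ℂ) (h : L2d d) :
    inner ℂ h (evolve A E t c) = ∫ s, inner ℂ h (l2Propagator d (t - s) (E.vec (A.coef s c))) :=
  (integral_inner (integrable_propagator_coef A E c t) h).symm

/-- The norm does not depend on `t`, since the propagator is unitary. -/
theorem norm_evolve (t : ℝ) (c : I → κ → ℂ) : ‖evolve A E t c‖ = ‖evolve A E 0 c‖ := by
  have h : evolve A E t c = l2Propagator d t (evolve A E 0 c) := by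
    rw [evolve_apply, evolve_apply]
    have h2 := (l2Propagator d t).toContinuousLinearEquiv.toContinuousLinearMap.integral_comp_comm
      (integrable_propagator_coef A E c 0)
    refine Eq.trans ?_ h2
    congr 1
    funext s
    change _ = l2Propagator d t (l2Propagator d (0 - s) _)
    rw [l2Propagator_add]
    congr 3
    ring
  rw [h, LinearIsometryEquiv.norm_map]

/-- The step function `‖F(s)‖_{L^{1/ρ}}`. -/
def size (ρ : ℝ) (c : I → κ → ℂ) (s : ℝ) : ℝ≥0∞ :=
  ENNReal.ofReal (wnorm E.weight ρ (A.coef s c))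

theorem wnorm_zero {v : κ → ℝ≥0} {ρ : ℝ} (hρ : 0 < ρ) : wnorm v ρ (0 : κ → ℂ) = 0 := by
  have := wnorm_smul (v := v) hρ 0 (0 : κ → ℂ)
  simpa using this

theorem measurable_size {ρ : ℝ} (hρ : 0 < ρ) (c : I → κ → ℂ) : Measurable (size A E ρ c) :=
  A.measurable_coef (fun _ x ↦ ENNReal.ofReal (wnorm E.weight ρ x))
    (fun _ ↦ by simp [wnorm_zero hρ]) (fun _ ↦ measurable_const) c

theorem lintegral_size {ρ π : ℝ} (hρ : 0 < ρ) (hπ : 0 < π) (c : I → κ → ℂ) :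
    (∫⁻ s, size A E ρ c s ^ π⁻¹) ^ π = ENNReal.ofReal (mixedNorm A.weight E.weight π ρ c) := by
  have hw := fun i ↦ wnorm_nonneg (v := E.weight) ρ (c i)
  rw [mixedNorm, ← ENNReal.ofReal_rpow_of_nonneg (mixedSum_nonneg _ _ _) hπ.le,
    ENNReal.ofReal_sum_of_nonneg (f := fun i ↦ (A.weight i : ℝ) * wnorm E.weight ρ (c i) ^ π⁻¹)
      (fun i _ ↦ mul_nonneg (A.weight i).2 (Real.rpow_nonneg (hw i) _))]
  congr 1
  refine (A.lintegral_coef (fun x ↦ ENNReal.ofReal (wnorm E.weight ρ x) ^ π⁻¹)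
    (by simp [wnorm_zero hρ, hπ]) c).trans (Finset.sum_congr rfl fun i _ ↦ ?_)
  rw [ENNReal.ofReal_mul (NNReal.coe_nonneg _),
    ENNReal.ofReal_rpow_of_nonneg (hw i) (by positivity)]
  simp

/-- The `TT*` identity in the form of an inequality. -/
theorem ofReal_sq_norm_evolve_le (t : ℝ) (c : I → κ → ℂ) :
    ENNReal.ofReal (‖evolve A E t c‖ ^ 2) ≤ ∫⁻ s, ∫⁻ s',
      ‖inner ℂ (E.vec (A.coef s c)) (l2Propagator d (s - s') (E.vec (A.coef s' c)))‖ₑ := by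
  have h1 : ENNReal.ofReal (‖evolve A E t c‖ ^ 2) =
      ‖inner ℂ (evolve A E t c) (evolve A E t c)‖ₑ := by
    rw [inner_self_eq_norm_sq_to_K, ← ofReal_norm]
    simp
  rw [h1, inner_evolve]
  refine (enorm_integral_le_lintegral_enorm _).trans (lintegral_mono fun s ↦ ?_)
  have h2 : ∀ x y : L2d d, ‖inner ℂ x y‖ₑ = ‖inner ℂ y x‖ₑ := fun x y ↦ by
    rw [← ofReal_norm, ← ofReal_norm, norm_inner_symm]
  rw [h2, inner_evolve]
  refine (enorm_integral_le_lintegral_enorm _).trans (lintegral_mono fun s' ↦ ?_)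
  rw [inner_l2Propagator_l2Propagator]
  apply le_of_eq
  congr 4
  ring

/-- The kernel `|x|^{-γ}` in the dispersive estimate. -/
def decay (γ x : ℝ) : ℝ≥0∞ := ENNReal.ofReal (|x| ^ (-γ))

theorem measurable_decay (γ : ℝ) : Measurable (decay γ) := by
  unfold decay; fun_prop

theorem ofReal_sq_norm_evolve_le_decay {ρ : ℝ} (hρ : ρ ∈ Icc (1 / 2 : ℝ) 1) (t : ℝ)
    (c : I → κ → ℂ) :
    ENNReal.ofReal (‖evolve A E t c‖ ^ 2) ≤ ENNReal.ofReal (dispersiveConst d ^ (2 * ρ - 1)) *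
      ∫⁻ s, ∫⁻ s', decay (d * (ρ - 1 / 2)) (s - s') * (size A E ρ c s * size A E ρ c s') := by
  have hD := dispersiveConst_pos d
  refine (ofReal_sq_norm_evolve_le A E t c).trans ?_
  have hρ0 : 0 < ρ := by linarith [hρ.1]
  have hm := measurable_size A E hρ0 c
  rw [← lintegral_const_mul' _ _ ENNReal.ofReal_ne_top]
  refine lintegral_mono fun s ↦ ?_
  rw [← lintegral_const_mul' _ _ ENNReal.ofReal_ne_top]
  apply lintegral_mono_ae
  have : ∀ᵐ s' : ℝ, s' ≠ s := by simp [ae_iff]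
  filter_upwards [this] with s' hs'
  rw [size, size, decay, ← ENNReal.ofReal_mul (wnorm_nonneg _ _),
    ← ENNReal.ofReal_mul (by positivity), ← ENNReal.ofReal_mul (by positivity), ← ofReal_norm]
  apply ENNReal.ofReal_le_ofReal
  refine (norm_inner_vec_le E E (sub_ne_zero.2 hs'.symm) hρ _ _).trans (le_of_eq ?_)
  ring

end Evolution

end FinFamily

/-! ### Young's inequality and local Strichartz estimates -/

/-- Young's inequality on the line in its trilinear form, with inverse exponents `a`, `b` and
`2 - a - b`. -/
theorem lintegral_young {a b : ℝ} (ha0 : 0 < a) (ha : a < 1) (hb0 : 0 < b) (hb : b < 1)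
    (hab : 1 ≤ a + b) {f g k : ℝ → ℝ≥0∞} (hf : Measurable f) (hg : Measurable g)
    (hk : Measurable k) :
    ∫⁻ s, ∫⁻ t, k (s - t) * (f s * g t) ≤ (∫⁻ x, k x ^ (2 - a - b)⁻¹) ^ (2 - a - b) *
      (∫⁻ s, f s ^ a⁻¹) ^ a * (∫⁻ t, g t ^ b⁻¹) ^ b := by
  set m := (2 - a - b)⁻¹ with hm
  have hm0 : 0 < 2 - a - b := by linarith
  set F := ∫⁻ s, f s ^ a⁻¹
  set G := ∫⁻ t, g t ^ b⁻¹
  set K := ∫⁻ x, k x ^ m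
  let h : Fin 3 → ℝ × ℝ → ℝ≥0∞ := ![fun p ↦ f p.1 ^ a⁻¹ * g p.2 ^ b⁻¹,
    fun p ↦ f p.1 ^ a⁻¹ * k (p.1 - p.2) ^ m, fun p ↦ g p.2 ^ b⁻¹ * k (p.1 - p.2) ^ m]
  let w : Fin 3 → ℝ := ![a + b - 1, 1 - b, 1 - a]
  have hh : ∀ i, Measurable (h i) := by
    intro i
    fin_cases i <;> simp only [h, Fin.zero_eta, Fin.mk_one, Fin.reduceFinMk, Matrix.cons_val] <;>
      fun_prop
  have hmeas : Measurable fun p : ℝ × ℝ ↦ k (p.1 - p.2) * (f p.1 * g p.2) := by fun_prop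
  have hH := ENNReal.lintegral_prod_norm_pow_le (μ := (volume : Measure (ℝ × ℝ))) Finset.univ
    (f := h) (fun i _ ↦ (hh i).aemeasurable) (p := w) (by simp [w, Fin.sum_univ_three])
    (fun i _ ↦ by fin_cases i <;> simp [w] <;> linarith)
  have e1 : ∫⁻ p, h 0 p = F * G := by
    rw [Measure.volume_eq_prod]
    exact lintegral_prod_mul (hf.pow_const _).aemeasurable (hg.pow_const _).aemeasurable
  have e2 : ∫⁻ p, h 1 p = F * K := by
    rw [Measure.volume_eq_prod, lintegral_prod _ (hh 1).aemeasurable]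
    change ∫⁻ x, ∫⁻ y, f x ^ a⁻¹ * k (x - y) ^ m = _
    have (x : ℝ) : ∫⁻ y, f x ^ a⁻¹ * k (x - y) ^ m = f x ^ a⁻¹ * K := by
      rw [lintegral_const_mul _ (by fun_prop), lintegral_sub_left_eq_self (fun x ↦ k x ^ m)]
    rw [lintegral_congr this, lintegral_mul_const _ (hf.pow_const _)]
  have e3 : ∫⁻ p, h 2 p = G * K := by
    rw [Measure.volume_eq_prod, lintegral_prod_symm _ (hh 2).aemeasurable]
    change ∫⁻ y, ∫⁻ x, g y ^ b⁻¹ * k (x - y) ^ m = _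
    have (y : ℝ) : ∫⁻ x, g y ^ b⁻¹ * k (x - y) ^ m = g y ^ b⁻¹ * K := by
      rw [lintegral_const_mul _ (by fun_prop), lintegral_sub_right_eq_self (fun x ↦ k x ^ m)]
    rw [lintegral_congr this, lintegral_mul_const _ (hg.pow_const _)]
  rw [← lintegral_prod (fun p : ℝ × ℝ ↦ k (p.1 - p.2) * (f p.1 * g p.2)) hmeas.aemeasurable,
    ← Measure.volume_eq_prod]
  calc _ = ∫⁻ p, ∏ i, h i p ^ w i := by
        refine lintegral_congr fun p ↦ ?_
        simp only [Fin.prod_univ_three, h, w, Matrix.cons_val]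
        rw [ENNReal.mul_rpow_of_nonneg _ _ (by linarith),
          ENNReal.mul_rpow_of_nonneg _ _ (by linarith),
          ENNReal.mul_rpow_of_nonneg _ _ (by linarith)]
        have hf' : f p.1 = (f p.1 ^ a⁻¹) ^ (a + b - 1) * (f p.1 ^ a⁻¹) ^ (1 - b) := by
          rw [← ENNReal.rpow_add_of_nonneg _ _ (by linarith) (by linarith), ← ENNReal.rpow_mul]
          rw [show a⁻¹ * (a + b - 1 + (1 - b)) = 1 by field_simp; ring, ENNReal.rpow_one]
        have hg' : g p.2 = (g p.2 ^ b⁻¹) ^ (a + b - 1) * (g p.2 ^ b⁻¹) ^ (1 - a) := by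
          rw [← ENNReal.rpow_add_of_nonneg _ _ (by linarith) (by linarith), ← ENNReal.rpow_mul]
          rw [show b⁻¹ * (a + b - 1 + (1 - a)) = 1 by field_simp; ring, ENNReal.rpow_one]
        have hk' : k (p.1 - p.2) =
            (k (p.1 - p.2) ^ m) ^ (1 - b) * (k (p.1 - p.2) ^ m) ^ (1 - a) := by
          rw [← ENNReal.rpow_add_of_nonneg _ _ (by linarith) (by linarith), ← ENNReal.rpow_mul]
          rw [show m * (1 - b + (1 - a)) = 1 by rw [hm]; field_simp; ring, ENNReal.rpow_one]
        conv_lhs => rw [hf', hg', hk']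
        ring
    _ ≤ _ := hH
    _ = _ := by
        simp only [Fin.prod_univ_three, e1, e2, e3]
        simp only [w, Matrix.cons_val]
        rw [ENNReal.mul_rpow_of_nonneg _ _ (by linarith),
          ENNReal.mul_rpow_of_nonneg _ _ (by linarith),
          ENNReal.mul_rpow_of_nonneg _ _ (by linarith)]
        have hF : F ^ a = F ^ (a + b - 1) * F ^ (1 - b) := by
          rw [← ENNReal.rpow_add_of_nonneg _ _ (by linarith) (by linarith)]; congr 1; ring
        have hG : G ^ b = G ^ (a + b - 1) * G ^ (1 - a) := by
          rw [← ENNReal.rpow_add_of_nonneg _ _ (by linarith) (by linarith)]; congr 1; ring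
        have hK : K ^ (2 - a - b) = K ^ (1 - b) * K ^ (1 - a) := by
          rw [← ENNReal.rpow_add_of_nonneg _ _ (by linarith) (by linarith)]; congr 1; ring
        rw [hF, hG, hK]
        ring

/-- The dyadic shells of the line. -/
def shell (j : ℤ) : Set ℝ := {x | 2 ^ j ≤ |x| ∧ |x| < 2 ^ (j + 1)}

theorem measurableSet_shell (j : ℤ) : MeasurableSet (shell j) :=
  (measurableSet_le measurable_const measurable_abs).inter
    (measurableSet_lt measurable_abs measurable_const)

theorem volume_shell_le (j : ℤ) : volume (shell j) ≤ ENNReal.ofReal (4 * 2 ^ j) := by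
  have : shell j ⊆ Ioo (-(2 ^ (j + 1))) (2 ^ (j + 1)) := fun x hx ↦ abs_lt.1 hx.2
  refine (measure_mono this).trans (le_of_eq ?_)
  rw [Real.volume_Ioo, zpow_add_one₀ two_ne_zero]
  congr 1; ring

theorem pairwise_disjoint_shell : Pairwise (Function.onFun Disjoint shell) := by
  have h : ∀ i j : ℤ, i < j → Disjoint (shell i) (shell j) := fun i j hij ↦
    Set.disjoint_left.2 fun x hi hj ↦ absurd hi.2 (not_lt.2 ((zpow_le_zpow_right₀ one_le_two
      (by omega)).trans hj.1))
  intro i j hij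
  rcases lt_or_gt_of_ne hij with h' | h'
  · exact h i j h'
  · exact (h j i h').symm

theorem iUnion_shell : ⋃ j, shell j = {0}ᶜ := by
  ext x
  simp only [mem_iUnion, mem_compl_iff, mem_singleton_iff]
  constructor
  · rintro ⟨j, hj⟩ rfl
    have : (0 : ℝ) < 2 ^ j := by positivity
    have h2 := hj.1
    simp at h2
    linarith
  · intro hx
    obtain ⟨j, h⟩ := exists_mem_Ico_zpow (abs_pos.2 hx) (one_lt_two (α := ℝ))
    exact ⟨j, h⟩

namespace FinFamily

theorem decay_le_of_mem_shell {γ : ℝ} (hγ : 0 ≤ γ) {j : ℤ} {x : ℝ} (hx : x ∈ shell j) :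
    decay γ x ≤ ENNReal.ofReal (2 ^ (-(j * γ))) := by
  refine ENNReal.ofReal_le_ofReal ?_
  have : (2 : ℝ) ^ (-(j * γ)) = (2 ^ j : ℝ) ^ (-γ) := by
    rw [← Real.rpow_intCast, ← Real.rpow_mul zero_le_two]; congr 1; ring
  rw [this]
  exact Real.rpow_le_rpow_of_nonpos (by positivity) hx.1 (by linarith)

/-- Young's inequality for the piece of the kernel on a dyadic shell. The power of `2 ^ j`
vanishes at the exponents of the Hardy–Littlewood–Sobolev inequality. -/
theorem lintegral_shell_le {a b γ : ℝ} (ha0 : 0 < a) (ha : a < 1) (hb0 : 0 < b) (hb : b < 1)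
    (hab : 1 ≤ a + b) (hγ : 0 ≤ γ) (j : ℤ) {f g : ℝ → ℝ≥0∞} (hf : Measurable f)
    (hg : Measurable g) :
    ∫⁻ s, ∫⁻ t, (shell j).indicator (decay γ) (s - t) * (f s * g t) ≤
      ENNReal.ofReal (4 * 2 ^ (j * (2 - a - b - γ))) *
      (∫⁻ s, f s ^ a⁻¹) ^ a * (∫⁻ t, g t ^ b⁻¹) ^ b := by
  refine (lintegral_young ha0 ha hb0 hb hab hf hg
    ((measurable_decay γ).indicator (measurableSet_shell j))).trans ?_
  have hm0 : 0 < 2 - a - b := by linarith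
  gcongr
  have h1 : ∫⁻ x, (shell j).indicator (decay γ) x ^ (2 - a - b)⁻¹ ≤
      ENNReal.ofReal (2 ^ (-(j * γ))) ^ (2 - a - b)⁻¹ * ENNReal.ofReal (4 * 2 ^ j) := by
    calc _ ≤ ∫⁻ x in shell j, ENNReal.ofReal (2 ^ (-(j * γ))) ^ (2 - a - b)⁻¹ := by
          rw [← lintegral_indicator (measurableSet_shell j)]
          refine lintegral_mono fun x ↦ ?_
          by_cases hx : x ∈ shell j
          · simp only [indicator_of_mem hx]
            gcongr
            exact decay_le_of_mem_shell hγ hx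
          · simp [indicator_of_notMem hx, hm0]
      _ ≤ _ := by
          rw [setLIntegral_const]
          gcongr
          exact volume_shell_le j
  calc _ ≤ (ENNReal.ofReal (2 ^ (-(j * γ))) ^ (2 - a - b)⁻¹ * ENNReal.ofReal (4 * 2 ^ j)) ^
        (2 - a - b) := by gcongr
    _ = ENNReal.ofReal (2 ^ (-(j * γ)) * (4 ^ (2 - a - b) * 2 ^ (j * (2 - a - b)))) := by
        rw [ENNReal.mul_rpow_of_nonneg _ _ hm0.le, ← ENNReal.rpow_mul, inv_mul_cancel₀ hm0.ne',
          ENNReal.rpow_one, ENNReal.ofReal_rpow_of_nonneg (by positivity) hm0.le,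
          Real.mul_rpow (by norm_num) (by positivity), ← Real.rpow_intCast,
          ← Real.rpow_mul zero_le_two, ← ENNReal.ofReal_mul (by positivity)]
    _ ≤ _ := by
        apply ENNReal.ofReal_le_ofReal
        have h4 : (4 : ℝ) ^ (2 - a - b) ≤ 4 := by
          simpa using Real.rpow_le_rpow_of_exponent_le (x := 4) (by norm_num)
            (show 2 - a - b ≤ 1 by linarith)
        calc _ ≤ (2 : ℝ) ^ (-(j * γ)) * (4 * 2 ^ (j * (2 - a - b))) := by gcongr
          _ = 4 * (2 ^ (-(j * γ)) * 2 ^ (j * (2 - a - b))) := by ring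
          _ = _ := by rw [← Real.rpow_add two_pos]; congr 2; ring

theorem lintegral_decay_Icc {γ L : ℝ} (hγ : γ < 1) (hL : 0 < L) :
    ∫⁻ x, (Icc (-L) L).indicator (decay γ) x ≤ ENNReal.ofReal (2 * L ^ (1 - γ) / (1 - γ)) := by
  rw [lintegral_indicator measurableSet_Icc]
  have h0 : ∫⁻ x in Ioc 0 L, decay γ x = ENNReal.ofReal (L ^ (1 - γ) / (1 - γ)) := by
    have hi : IntervalIntegrable (fun x : ℝ ↦ x ^ (-γ)) volume 0 L :=
      intervalIntegral.intervalIntegrable_rpow' (by linarith)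
    have he := integral_rpow (a := 0) (b := L) (r := -γ) (Or.inl (by linarith))
    rw [intervalIntegral.integral_of_le hL.le] at he
    rw [show -γ + 1 = 1 - γ by ring, Real.zero_rpow (by linarith), sub_zero] at he
    rw [← he, ofReal_integral_eq_lintegral_ofReal
      ((intervalIntegrable_iff_integrableOn_Ioc_of_le hL.le).1 hi)]
    · refine setLIntegral_congr_fun measurableSet_Ioc fun x hx ↦ ?_
      simp only [decay, abs_of_pos hx.1]
    · filter_upwards [ae_restrict_mem measurableSet_Ioc] with x hx
      exact Real.rpow_nonneg hx.1.le _
  have h1 : ∫⁻ x in Ico (-L) 0, decay γ x = ∫⁻ x in Ioc 0 L, decay γ x := by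
    have := (Measure.measurePreserving_neg (volume : Measure ℝ)).setLIntegral_comp_preimage
      (s := Ioc 0 L) measurableSet_Ioc (measurable_decay γ)
    rw [← this]
    simp [decay]
  have hsub : Icc (-L) L ⊆ (Ico (-L) 0 ∪ Ioc 0 L) ∪ {0} := by
    intro x hx
    rcases lt_trichotomy x 0 with h | h | h
    · exact Or.inl (Or.inl ⟨hx.1, h⟩)
    · exact Or.inr h
    · exact Or.inl (Or.inr ⟨h, hx.2⟩)
  calc _ ≤ ∫⁻ x in (Ico (-L) 0 ∪ Ioc 0 L) ∪ {0}, decay γ x := lintegral_mono_set hsub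
    _ ≤ (∫⁻ x in Ico (-L) 0, decay γ x) + (∫⁻ x in Ioc 0 L, decay γ x) +
        ∫⁻ x in {0}, decay γ x := by
        refine (lintegral_union_le _ _ _).trans ?_
        gcongr
        exact lintegral_union_le _ _ _
    _ = _ := by
        rw [h1, h0, setLIntegral_measure_zero _ _ (by simp), add_zero, ← ENNReal.ofReal_add]
        · congr 1; ring
        all_goals exact div_nonneg (by positivity) (by linarith)

section Evolution

variable {d : ℕ} {I κ : Type*} [Fintype I] [Fintype κ] (A : FinFamily (volume : Measure ℝ) I)
  (E : FinFamily (volume : Measure (Rd d)) κ)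

/-- On a bounded time interval the kernel `|s - s'|^{-γ}`, `γ < 1`, is integrable, and Schur's test
gives a local Strichartz estimate with time exponent `2`. -/
theorem norm_evolve_le_local {ρ L : ℝ} (hρ : ρ ∈ Icc (1 / 2 : ℝ) 1) (hγ : d * (ρ - 1 / 2) < 1)
    (hL : 0 < L) (hA : ∀ i i', ∀ s ∈ A.set i, ∀ s' ∈ A.set i', |s - s'| ≤ L) (t : ℝ)
    (c : I → κ → ℂ) :
    ‖evolve A E t c‖ ≤ (dispersiveConst d ^ (2 * ρ - 1) * (2 * L ^ (1 - d * (ρ - 1 / 2)) /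
      (1 - d * (ρ - 1 / 2)))) ^ (1 / 2 : ℝ) * mixedNorm A.weight E.weight (1 / 2) ρ c := by
  have hD := dispersiveConst_pos d
  set γ := d * (ρ - 1 / 2) with hγd
  have hρ0 : 0 < ρ := by linarith [hρ.1]
  have hN := mixedNorm_nonneg (u := A.weight) (v := E.weight) (1 / 2) ρ c
  have hm := measurable_size A E hρ0 c
  have hK : 0 ≤ 2 * L ^ (1 - γ) / (1 - γ) := div_nonneg (by positivity) (by linarith)
  have hY := lintegral_young (a := 1 / 2) (b := 1 / 2) (by norm_num) (by norm_num) (by norm_num)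
    (by norm_num) (by norm_num) hm hm ((measurable_decay γ).indicator
      (measurableSet_Icc (a := -L) (b := L)))
  rw [lintegral_size A E hρ0 (by norm_num), show (2 : ℝ) - 1 / 2 - 1 / 2 = 1 by norm_num, inv_one,
    ENNReal.rpow_one] at hY
  simp_rw [ENNReal.rpow_one] at hY
  have h1 := ofReal_sq_norm_evolve_le_decay A E hρ t c
  have h2 : ∫⁻ s, ∫⁻ s', decay γ (s - s') * (size A E ρ c s * size A E ρ c s') ≤
      ∫⁻ s, ∫⁻ s', (Icc (-L) L).indicator (decay γ) (s - s') *
        (size A E ρ c s * size A E ρ c s') := by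
    refine lintegral_mono fun s ↦ lintegral_mono fun s' ↦ ?_
    by_cases h : ∃ i, s ∈ A.set i
    · by_cases h' : ∃ i, s' ∈ A.set i
      · obtain ⟨i, hi⟩ := h
        obtain ⟨i', hi'⟩ := h'
        rw [indicator_of_mem (show s - s' ∈ Icc (-L) L from abs_le.1 (hA i i' s hi s' hi'))]
      · push Not at h'
        simp [size, A.coef_of_notMem h', wnorm_zero hρ0]
    · push Not at h
      simp [size, A.coef_of_notMem h, wnorm_zero hρ0]
  have h3 := h1.trans (mul_le_mul_right (h2.trans (hY.trans (mul_le_mul_left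
    (mul_le_mul_left (lintegral_decay_Icc hγ hL) _) _))) _)
  rw [← ENNReal.ofReal_mul hK, ← ENNReal.ofReal_mul (by positivity),
    ← ENNReal.ofReal_mul (by positivity), ENNReal.ofReal_le_ofReal_iff (by positivity)] at h3
  refine abs_le_of_sq_le_sq' ?_ (by positivity) |>.2
  rw [mul_pow, ← Real.sqrt_eq_rpow, Real.sq_sqrt (by positivity)]
  refine h3.trans (le_of_eq (by ring))

end Evolution
end FinFamily

/-! ### Fractional integration and estimates away from the diagonal -/

namespace FinFamily

section Scalar

variable {α : Type*} [MeasurableSpace α] {μ : Measure α} {I : Type*} [Fintype I]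
  (A : FinFamily μ I)

theorem measurable_enorm_coef (c : I → ℂ) : Measurable fun s ↦ ‖A.coef s c‖ₑ :=
  A.measurable_coef (fun _ x ↦ ‖x‖ₑ) (by simp) (fun _ ↦ measurable_const) c

theorem lintegral_enorm_coef {ρ : ℝ} (hρ : 0 < ρ) (c : I → ℂ) :
    (∫⁻ s, ‖A.coef s c‖ₑ ^ ρ⁻¹ ∂μ) ^ ρ = ENNReal.ofReal (wnorm A.weight ρ c) := by
  rw [A.lintegral_coef (fun x ↦ ‖x‖ₑ ^ ρ⁻¹) (by simp [hρ]), wnorm,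
    ← ENNReal.ofReal_rpow_of_nonneg (by positivity) hρ.le,
    ENNReal.ofReal_sum_of_nonneg (f := fun i ↦ (A.weight i : ℝ) * ‖c i‖ ^ ρ⁻¹)
      (fun i _ ↦ by positivity)]
  congr 1
  refine Finset.sum_congr rfl fun i _ ↦ ?_
  rw [ENNReal.ofReal_mul (NNReal.coe_nonneg _),
    ← ENNReal.ofReal_rpow_of_nonneg (norm_nonneg _) (by positivity), ofReal_norm]
  simp

end Scalar

section Fractional

variable {I : Type*} [Fintype I] (A : FinFamily (volume : Measure ℝ) I)

theorem lintegral_kernel_coef {k : ℝ → ℝ≥0∞} (hk : Measurable k) (c g : I → ℂ) :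
    ∫⁻ s, ∫⁻ s', k (s - s') * (‖A.coef s c‖ₑ * ‖A.coef s' g‖ₑ) = ∑ i, ∑ i',
      (∫⁻ s, ∫⁻ s', k (s - s') * ((A.set i).indicator 1 s * (A.set i').indicator 1 s')) *
        (‖c i‖ₑ * ‖g i'‖ₑ) := by
  have hi : ∀ i, Measurable ((A.set i).indicator (1 : ℝ → ℝ≥0∞)) := fun i ↦
    measurable_one.indicator (A.meas i)
  have h1 : ∀ (c : I → ℂ) s, ‖A.coef s c‖ₑ = ∑ i, (A.set i).indicator 1 s * ‖c i‖ₑ := by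
    intro c s
    refine (A.apply_coef (fun _ x ↦ ‖x‖ₑ) (by simp) c s).trans
      (Finset.sum_congr rfl fun i _ ↦ ?_)
    by_cases h : s ∈ A.set i <;> simp [h]
  have h2 : ∀ i i', Measurable fun p : ℝ × ℝ ↦
      k (p.1 - p.2) * ((A.set i).indicator 1 p.1 * (A.set i').indicator 1 p.2) := by
    intro i i'
    have := hi i
    have := hi i'
    fun_prop
  have h3 : ∀ s s', k (s - s') * (‖A.coef s c‖ₑ * ‖A.coef s' g‖ₑ) = ∑ i, ∑ i',
      (k (s - s') * ((A.set i).indicator 1 s * (A.set i').indicator 1 s')) *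
        (‖c i‖ₑ * ‖g i'‖ₑ) := by
    intro s s'
    rw [h1, h1, Finset.sum_mul_sum, Finset.mul_sum]
    refine Finset.sum_congr rfl fun i _ ↦ ?_
    rw [Finset.mul_sum]
    refine Finset.sum_congr rfl fun i' _ ↦ ?_
    ring
  simp_rw [h3]
  have h4 : ∀ s i i', ∫⁻ s', (k (s - s') * ((A.set i).indicator 1 s * (A.set i').indicator 1 s')) *
        (‖c i‖ₑ * ‖g i'‖ₑ) = (∫⁻ s', k (s - s') * ((A.set i).indicator 1 s *
        (A.set i').indicator 1 s')) * (‖c i‖ₑ * ‖g i'‖ₑ) := fun s i i' ↦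
    lintegral_mul_const _ ((h2 i i').comp measurable_prodMk_left)
  have h5 : ∀ s, ∫⁻ s', ∑ i, ∑ i', (k (s - s') * ((A.set i).indicator 1 s *
      (A.set i').indicator 1 s')) * (‖c i‖ₑ * ‖g i'‖ₑ) = ∑ i, ∑ i', (∫⁻ s', k (s - s') *
      ((A.set i).indicator 1 s * (A.set i').indicator 1 s')) * (‖c i‖ₑ * ‖g i'‖ₑ) := by
    intro s
    have hm : ∀ i i', Measurable fun s' ↦ (k (s - s') * ((A.set i).indicator 1 s *
      (A.set i').indicator 1 s')) * (‖c i‖ₑ * ‖g i'‖ₑ) := fun i i' ↦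
      ((h2 i i').comp measurable_prodMk_left).mul_const _
    rw [lintegral_finsetSum _ fun i _ ↦ Finset.measurable_fun_sum _ fun i' _ ↦ hm i i']
    refine Finset.sum_congr rfl fun i _ ↦ ?_
    rw [lintegral_finsetSum _ fun i' _ ↦ hm i i']
    exact Finset.sum_congr rfl fun i' _ ↦ h4 s i i'
  have hm : ∀ i i', Measurable fun s ↦ (∫⁻ s', k (s - s') *
      ((A.set i).indicator 1 s * (A.set i').indicator 1 s')) * (‖c i‖ₑ * ‖g i'‖ₑ) := fun i i' ↦
    ((h2 i i').lintegral_prod_right').mul_const _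
  rw [lintegral_congr h5, lintegral_finsetSum _ fun i _ ↦ Finset.measurable_fun_sum _
    fun i' _ ↦ hm i i']
  refine Finset.sum_congr rfl fun i _ ↦ ?_
  rw [lintegral_finsetSum _ fun i' _ ↦ hm i i']
  exact Finset.sum_congr rfl fun i' _ ↦ lintegral_mul_const _ (h2 i i').lintegral_prod_right'

end Fractional

theorem tsum_shell_indicator (γ : ℝ) {x : ℝ} (hx : x ≠ 0) :
    ∑' j, (shell j).indicator (decay γ) x = decay γ x := by
  obtain ⟨j, hj⟩ := mem_iUnion.1 (iUnion_shell.symm ▸ (show x ∈ ({0}ᶜ : Set ℝ) from hx))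
  rw [tsum_eq_single j, indicator_of_mem hj]
  intro j' hj'
  exact indicator_of_notMem (fun h ↦ (pairwise_disjoint_shell hj').le_bot ⟨h, hj⟩) _

/-- The Hardy–Littlewood–Sobolev inequality for the kernel `|s - s'|^{-γ}` on step functions. The
dyadic pieces of the kernel satisfy Young's inequality with exponents on both sides of the critical
one, so that their sum is bounded by `exists_sum_bilin_le`. -/
theorem exists_fractional_integral_le {γ : ℝ} (hγ0 : 0 < γ) (hγ1 : γ < 1) :
    ∃ C : ℝ, 0 ≤ C ∧ ∀ {I : Type} [Fintype I] (A : FinFamily (volume : Measure ℝ) I) (c : I → ℂ),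
      ∫⁻ s, ∫⁻ s', decay γ (s - s') * (‖A.coef s c‖ₑ * ‖A.coef s' c‖ₑ) ≤
        ENNReal.ofReal (C * wnorm A.weight (1 - γ / 2) c ^ 2) := by
  -- `ε` is so small that all exponents `1 - γ / 2 ± ε` lie in `[1 / 2, 1)`
  set ε := min γ (1 - γ) / 4 with hε
  have hm1 := min_le_left γ (1 - γ)
  have hm2 := min_le_right γ (1 - γ)
  have hm3 : 0 < min γ (1 - γ) := lt_min hγ0 (by linarith)
  have hε0 : 0 < ε := by positivity
  obtain ⟨C, hC, h⟩ := exists_sum_bilin_le (ρ := 1 - γ / 2) (σ := 1) hε0 one_pos (by linarith)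
  refine ⟨C * 4, by positivity, fun {I} _ A c ↦ ?_⟩
  let k : ℤ → ℝ → ℝ≥0∞ := fun j ↦ (shell j).indicator (decay γ)
  have hk : ∀ j, Measurable (k j) := fun j ↦ (measurable_decay γ).indicator (measurableSet_shell j)
  let G : ℤ → (I → ℂ) → (I → ℂ) → ℝ≥0∞ := fun j c g ↦
    ∫⁻ s, ∫⁻ s', k j (s - s') * (‖A.coef s c‖ₑ * ‖A.coef s' g‖ₑ)
  have hG : ∀ j {a b : ℝ}, 0 < a → a < 1 → 0 < b → b < 1 → 1 ≤ a + b → ∀ c g, G j c g ≤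
      ENNReal.ofReal (4 * 2 ^ (j * (2 - a - b - γ)) * wnorm A.weight a c * wnorm A.weight b g) := by
    intro j a b ha ha1 hb hb1 hab c g
    refine (lintegral_shell_le ha ha1 hb hb1 hab hγ0.le j (A.measurable_enorm_coef c)
      (A.measurable_enorm_coef g)).trans (le_of_eq ?_)
    have := wnorm_nonneg (v := A.weight) a c
    rw [A.lintegral_enorm_coef ha, A.lintegral_enorm_coef hb, ← ENNReal.ofReal_mul (by positivity),
      ← ENNReal.ofReal_mul (by positivity)]
  -- on step functions the `j`-th piece is a bilinear form with the matrix `K j`, whose bound for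
  -- nonnegative coefficients passes to complex ones
  let K : ℤ → I → I → ℝ≥0∞ := fun j i i' ↦
    ∫⁻ s, ∫⁻ s', k j (s - s') * ((A.set i).indicator 1 s * (A.set i').indicator 1 s')
  have hGK : ∀ j c g, G j c g = ∑ i, ∑ i', K j i i' * (‖c i‖ₑ * ‖g i'‖ₑ) := fun j c g ↦
    A.lintegral_kernel_coef (hk j) c g
  have hKtop : ∀ j i i', K j i i' ≠ ∞ := by
    classical
    intro j i i'
    have h1 : G j (Pi.single i 1) (Pi.single i' 1) ≠ ∞ := ne_top_of_le_ne_top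
      ENNReal.ofReal_ne_top (hG j (a := 1 / 2) (b := 1 / 2) (by norm_num) (by norm_num)
        (by norm_num) (by norm_num) (by norm_num) _ _)
    rw [hGK] at h1
    have h2 := ENNReal.sum_ne_top.1 (ENNReal.sum_ne_top.1 h1 i (Finset.mem_univ _)) i'
      (Finset.mem_univ _)
    simpa using h2
  let B : ℤ → (Unit → I → ℂ) →ₗ[ℂ] (Unit → I → ℂ) →ₗ[ℂ] ℂ := fun j ↦ LinearMap.mk₂ ℂ
    (fun c g ↦ ∑ i, ∑ i', ((K j i i').toReal : ℂ) * (c () i * g () i'))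
    (fun c c' g ↦ by simp [add_mul, mul_add, Finset.sum_add_distrib])
    (fun a c g ↦ by
      simp only [Pi.smul_apply, smul_eq_mul, Finset.mul_sum]
      exact Finset.sum_congr rfl fun i _ ↦ Finset.sum_congr rfl fun i' _ ↦ by ring)
    (fun c g g' ↦ by simp [mul_add, Finset.sum_add_distrib])
    (fun a c g ↦ by
      simp only [Pi.smul_apply, smul_eq_mul, Finset.mul_sum]
      exact Finset.sum_congr rfl fun i _ ↦ Finset.sum_congr rfl fun i' _ ↦ by ring)
  have hB : ∀ j c g, B j c g = ∑ i, ∑ i', ((K j i i').toReal : ℂ) * (c () i * g () i') :=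
    fun _ _ _ ↦ rfl
  have hKn : ∀ j i i', ‖((K j i i').toReal : ℂ)‖ₑ = K j i i' := by
    intro j i i'
    rw [← ofReal_norm, Complex.norm_of_nonneg ENNReal.toReal_nonneg,
      ENNReal.ofReal_toReal (hKtop j i i')]
  have hBG : ∀ j c g, ‖B j c g‖ₑ ≤ G j (c ()) (g ()) := by
    intro j c g
    rw [hB, hGK]
    refine (enorm_sum_le _ _).trans (Finset.sum_le_sum fun i _ ↦
      (enorm_sum_le _ _).trans (Finset.sum_le_sum fun i' _ ↦ ?_))
    rw [enorm_mul, enorm_mul, hKn]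
  let c' : Unit → I → ℂ := fun _ i ↦ (‖c i‖ : ℂ)
  have hBc : ∀ j, ENNReal.ofReal ‖B j c' c'‖ = G j c c := by
    intro j
    have : B j c' c' = ((∑ i, ∑ i', (K j i i').toReal * (‖c i‖ * ‖c i'‖) : ℝ) : ℂ) := by
      rw [hB]; push_cast; rfl
    rw [this, Complex.norm_of_nonneg (by positivity), hGK, ENNReal.ofReal_sum_of_nonneg
      fun i _ ↦ by positivity]
    refine Finset.sum_congr rfl fun i _ ↦ ?_
    rw [ENNReal.ofReal_sum_of_nonneg fun i' _ ↦ by positivity]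
    refine Finset.sum_congr rfl fun i' _ ↦ ?_
    rw [ENNReal.ofReal_mul (by positivity), ENNReal.ofReal_mul (by positivity), ofReal_norm,
      ofReal_norm, ENNReal.ofReal_toReal (hKtop j i i')]
  have hw : wnorm A.weight (1 - γ / 2) (c' ()) = wnorm A.weight (1 - γ / 2) c := by
    simp [wnorm, c']
  have hsum := h (I := Unit) (K := I) (I' := Unit) (K' := I) (fun _ ↦ 1) A.weight (fun _ ↦ 1)
    A.weight B 4 (by norm_num) ?_
  · have h1 : ∀ s, ∫⁻ s', decay γ (s - s') * (‖A.coef s c‖ₑ * ‖A.coef s' c‖ₑ) =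
        ∑' j, ∫⁻ s', k j (s - s') * (‖A.coef s c‖ₑ * ‖A.coef s' c‖ₑ) := by
      intro s
      have := A.measurable_enorm_coef c
      rw [← lintegral_tsum fun j ↦ by have := hk j; fun_prop]
      apply lintegral_congr_ae
      have hae : ∀ᵐ s' : ℝ, s' ≠ s := by simp [ae_iff]
      filter_upwards [hae] with s' hs'
      rw [ENNReal.tsum_mul_right, tsum_shell_indicator γ (sub_ne_zero.2 hs'.symm)]
    rw [lintegral_congr h1, lintegral_tsum fun j ↦ ?_]
    · change ∑' j, G j c c ≤ _
      rw [ENNReal.tsum_eq_iSup_sum]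
      refine iSup_le fun J ↦ ?_
      simp_rw [← hBc]
      rw [← ENNReal.ofReal_sum_of_nonneg fun _ _ ↦ norm_nonneg _]
      apply ENNReal.ofReal_le_ofReal
      refine (hsum J c' c').trans (le_of_eq ?_)
      rw [mixedNorm_unit (by norm_num)]
      change _ * wnorm _ _ (c' ()) * wnorm _ _ (c' ()) = _
      rw [hw]; ring
    · have := A.measurable_enorm_coef c
      exact (Measurable.lintegral_prod_right' (f := fun p : ℝ × ℝ ↦ k j (p.1 - p.2) *
        (‖A.coef p.1 c‖ₑ * ‖A.coef p.2 c‖ₑ)) (((hk j).comp (measurable_fst.sub measurable_snd)).mul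
        ((this.comp measurable_fst).mul (this.comp measurable_snd)))).aemeasurable
  · intro j δ₁ δ₂ h1 h2 c g
    have hb : ∀ δ, δ = ε ∨ δ = -ε → 1 / 2 ≤ 1 - γ / 2 - δ ∧ 1 - γ / 2 - δ < 1 := by
      rintro δ (rfl | rfl) <;> constructor <;> linarith
    obtain ⟨h1, h1'⟩ := hb δ₁ h1
    obtain ⟨h2, h2'⟩ := hb δ₂ h2
    have h3 := (hBG j c g).trans (hG j (a := 1 - γ / 2 - δ₁) (b := 1 - γ / 2 - δ₂) (by linarith)
      h1' (by linarith) h2' (by linarith) _ _)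
    rw [mixedNorm_unit (by norm_num), mixedNorm_unit (by norm_num)]
    have := wnorm_nonneg (v := A.weight) (1 - γ / 2 - δ₁) (c ())
    have := wnorm_nonneg (v := A.weight) (1 - γ / 2 - δ₂) (g ())
    rw [← ofReal_norm, ENNReal.ofReal_le_ofReal_iff (by positivity)] at h3
    refine h3.trans (le_of_eq ?_)
    congr 4
    ring

section Evolution

variable {d : ℕ} {I κ : Type*} [Fintype I] [Fintype κ] (A : FinFamily (volume : Measure ℝ) I)
  (E : FinFamily (volume : Measure (Rd d)) κ)

/-- The dispersive bound for the evolution of data supported at times `s` with `|t - s| ≥ m`,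
interpolated with a bound in `L²`. -/
theorem norm_inner_evolve_le {m t : ℝ} (hm : 0 < m) (hA : ∀ i, ∀ s ∈ A.set i, m ≤ |t - s|)
    {π₁ ρ₁ M₁ θ : ℝ} (hπ₁ : 0 < π₁) (hρ₁ : 0 < ρ₁) (hM₁ : 0 ≤ M₁)
    (h₁ : ∀ c, ‖evolve A E t c‖ ≤ M₁ * mixedNorm A.weight E.weight π₁ ρ₁ c)
    (hθ : θ ∈ Icc (0 : ℝ) 1) {κ' : Type*} [Fintype κ']
    (E' : FinFamily (volume : Measure (Rd d)) κ') (c : I → κ → ℂ) (g : κ' → ℂ) :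
    ‖inner ℂ (E'.vec g) (evolve A E t c)‖ ≤
      (dispersiveConst d * m ^ (-((d : ℝ) / 2))) ^ (1 - θ) * M₁ ^ θ *
        mixedNorm A.weight E.weight (1 - θ + θ * π₁) (1 - θ + θ * ρ₁) c *
        wnorm E'.weight (1 - θ / 2) g := by
  have hD := dispersiveConst_pos d
  let B : (I → κ → ℂ) →ₗ[ℂ] (Unit → κ' → ℂ) →ₗ[ℂ] ℂ := LinearMap.mk₂ ℂ
    (fun c g ↦ inner ℂ (E'.vec (star (g ()))) (evolve A E t c))
    (fun c c' g ↦ by simp [inner_add_right])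
    (fun a c g ↦ by simp [inner_smul_right])
    (fun c g g' ↦ by simp [inner_add_left])
    (fun a c g ↦ by simp only [Pi.smul_apply, star_vec_smul, inner_smul_left]; simp)
  have hB : ∀ c g, B c g = inner ℂ (E'.vec (star (g ()))) (evolve A E t c) := fun _ _ ↦ rfl
  have h := bilin_interpolation (u := A.weight) (v := E.weight) (u' := fun _ : Unit ↦ 1)
    (v' := E'.weight) B (π₀ := 1) (π₁ := π₁) (ρ₀ := 1) (ρ₁ := ρ₁) (π₀' := 1) (π₁' := 1)
    (ρ₀' := 1) (ρ₁' := 1 / 2) (M₀ := dispersiveConst d * m ^ (-((d : ℝ) / 2))) (M₁ := M₁)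
    hθ (by positivity) hM₁ (by norm_num) hπ₁ (by norm_num) hρ₁ (by norm_num) (by norm_num)
    (by norm_num) (by norm_num) ?_ ?_ c (fun _ ↦ star g)
  · rw [hB, star_star, mixedNorm_unit (by linarith), wnorm_star] at h
    refine h.trans (le_of_eq ?_)
    simp only [mul_one]
    congr 2
    ring
  · intro c g
    rw [hB, mixedNorm_unit one_pos]
    have hN := mixedNorm_nonneg (u := A.weight) (v := E.weight) 1 1 c
    have hW := wnorm_nonneg (v := E'.weight) 1 (g default)
    rw [inner_evolve]
    set b := dispersiveConst d * m ^ (-((d : ℝ) / 2)) * wnorm E'.weight 1 (g default) with hb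
    have hb0 : 0 ≤ b := by positivity
    have hs := lintegral_size A E one_pos one_pos c
    simp only [inv_one, ENNReal.rpow_one] at hs
    have h2 : ‖∫ s, inner ℂ (E'.vec (star (g ()))) (l2Propagator d (t - s) (E.vec (A.coef s c)))‖ₑ ≤
        ENNReal.ofReal (b * mixedNorm A.weight E.weight 1 1 c) := by
      refine (enorm_integral_le_lintegral_enorm _).trans ?_
      rw [ENNReal.ofReal_mul hb0, ← hs, ← lintegral_const_mul' _ _ ENNReal.ofReal_ne_top]
      refine lintegral_mono fun s ↦ ?_
      by_cases hi : ∃ i, s ∈ A.set i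
      · obtain ⟨i, hi⟩ := hi
        have hms := hA i s hi
        rw [size, ← ENNReal.ofReal_mul hb0, ← ofReal_norm]
        apply ENNReal.ofReal_le_ofReal
        refine (norm_inner_vec_le_one E E' (abs_pos.1 (hm.trans_le hms)) _ _).trans ?_
        have := wnorm_nonneg (v := E.weight) 1 (A.coef s c)
        rw [wnorm_star, hb]
        gcongr ?_ * ?_ * ?_ * ?_
        exact Real.rpow_le_rpow_of_nonpos hm hms (by simp only [neg_nonpos]; positivity)
      · push Not at hi
        simp [A.coef_of_notMem hi]
    rw [← ofReal_norm, ENNReal.ofReal_le_ofReal_iff (by positivity)] at h2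
    refine h2.trans (le_of_eq ?_)
    rw [hb]; ring
  · intro c g
    rw [hB, mixedNorm_unit one_pos]
    refine (norm_inner_le_norm _ _).trans ?_
    have := wnorm_nonneg (v := E'.weight) (1 / 2) (g default)
    rw [norm_vec, wnorm_star, mul_comm]
    exact mul_le_mul_of_nonneg_right (h₁ c) this

end Evolution

end FinFamily

/-! ### The `TT*` form on dyadic strips -/

namespace FinFamily

section Pairing

variable {d : ℕ} {I κ : Type*} [Fintype I] [Fintype κ] (A : FinFamily (volume : Measure ℝ) I)
  (E : FinFamily (volume : Measure (Rd d)) κ)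

/-- The pairing of `e^{i(s-s')Δ} F(s')` with `G(s)` at the pair of times `p = (s, s')`, for step
functions `F` and `G` with coefficients `c` and `g`. -/
def pairing (c g : I → κ → ℂ) (p : ℝ × ℝ) : ℂ :=
  inner ℂ (E.vec (A.coef p.1 g)) (l2Propagator d (p.1 - p.2) (E.vec (A.coef p.2 c)))

theorem integrable_pairing (c g : I → κ → ℂ) : Integrable (pairing A E c g) := by
  have h : pairing A E c g = fun p ↦ ∑ i, ∑ i', (A.set i ×ˢ A.set i').indicator
      (fun p ↦ inner ℂ (E.vec (g i)) (l2Propagator d (p.1 - p.2) (E.vec (c i')))) p := by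
    funext p
    rw [pairing, A.apply_coef (fun s x ↦ inner ℂ (E.vec x)
      (l2Propagator d (s - p.2) (E.vec (A.coef p.2 c)))) (by simp)]
    refine Finset.sum_congr rfl fun i _ ↦ ?_
    by_cases hi : p.1 ∈ A.set i
    · rw [indicator_of_mem hi, A.apply_coef (fun s x ↦ inner ℂ (E.vec (g i))
        (l2Propagator d (p.1 - s) (E.vec x))) (by simp)]
      refine Finset.sum_congr rfl fun i' _ ↦ ?_
      by_cases hi' : p.2 ∈ A.set i'
      · rw [indicator_of_mem hi', indicator_of_mem (show p ∈ A.set i ×ˢ A.set i' from ⟨hi, hi'⟩)]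
      · rw [indicator_of_notMem hi', indicator_of_notMem fun h ↦ hi' h.2]
    · rw [indicator_of_notMem hi]
      exact (Finset.sum_eq_zero fun i' _ ↦ indicator_of_notMem (fun h ↦ hi h.1) _).symm
  rw [h]
  refine integrable_finsetSum _ fun i _ ↦ integrable_finsetSum _ fun i' _ ↦
    (integrable_indicator_iff ((A.meas i).prod (A.meas i'))).2 ?_
  have hc : Continuous fun p : ℝ × ℝ ↦
      inner ℂ (E.vec (g i)) (l2Propagator d (p.1 - p.2) (E.vec (c i'))) :=
    continuous_const.inner ((continuous_l2Propagator _).comp (continuous_fst.sub continuous_snd))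
  have hfin : volume (A.set i ×ˢ A.set i') ≠ ∞ := by
    rw [Measure.volume_eq_prod, Measure.prod_prod]
    exact ENNReal.mul_ne_top (A.fin i) (A.fin i')
  refine Measure.integrableOn_of_bounded (M := ‖E.vec (g i)‖ * ‖E.vec (c i')‖) hfin
    hc.aestronglyMeasurable (Filter.Eventually.of_forall fun s ↦ ?_)
  refine (norm_inner_le_norm _ _).trans ?_
  rw [LinearIsometryEquiv.norm_map]

/-- The pairs of times whose difference lies in a dyadic shell. -/
def strip (j : ℤ) : Set (ℝ × ℝ) := {p | p.1 - p.2 ∈ shell j}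

theorem measurableSet_strip (j : ℤ) : MeasurableSet (strip j) :=
  (measurable_fst.sub measurable_snd) (measurableSet_shell j)

/-- The part of the `TT*` form over a dyadic strip. -/
def stripForm (j : ℤ) : (I → κ → ℂ) →ₗ[ℂ] (I → κ → ℂ) →ₗ[ℂ] ℂ :=
  LinearMap.mk₂ ℂ (fun c g ↦ ∫ p in strip j, pairing A E c (star g) p)
    (fun c c' g ↦ by
      rw [← integral_add (integrable_pairing A E _ _).integrableOn
        (integrable_pairing A E _ _).integrableOn]
      simp [pairing, inner_add_right])
    (fun a c g ↦ by
      rw [← integral_smul]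
      simp [pairing, inner_smul_right])
    (fun c g g' ↦ by
      rw [← integral_add (integrable_pairing A E _ _).integrableOn
        (integrable_pairing A E _ _).integrableOn]
      simp [pairing, inner_add_left])
    (fun a c g ↦ by
      rw [← integral_smul]
      simp only [pairing, star_smul, map_smul, inner_smul_left]
      simp)

theorem stripForm_apply (j : ℤ) (c g : I → κ → ℂ) :
    stripForm A E j c g = ∫ p in strip j, pairing A E c (star g) p := rfl

theorem mixedNorm_star (u : I → ℝ≥0) (v : κ → ℝ≥0) (π ρ : ℝ) (c : I → κ → ℂ) :
    mixedNorm u v π ρ (star c) = mixedNorm u v π ρ c := by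
  simp only [mixedNorm, Pi.star_apply, wnorm_star]

/-- The form over a strip is symmetric up to conjugation, as a shell is symmetric about zero. -/
theorem norm_stripForm_star (j : ℤ) (c g : I → κ → ℂ) :
    ‖stripForm A E j (star g) (star c)‖ = ‖stripForm A E j c g‖ := by
  rw [stripForm_apply, stripForm_apply, star_star]
  have h := (Measure.measurePreserving_swap (μ := (volume : Measure ℝ))
    (ν := (volume : Measure ℝ))).setIntegral_preimage_emb
      MeasurableEquiv.prodComm.measurableEmbedding (pairing A E (star g) c) (strip j)
  have hs : Prod.swap ⁻¹' strip j = strip j := by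
    ext p
    simp only [strip, shell, mem_preimage, mem_ofPred_eq, Prod.fst_swap, Prod.snd_swap,
      abs_sub_comm p.1]
  rw [← Measure.volume_eq_prod, hs] at h
  rw [← h, ← RCLike.norm_conj, ← integral_conj]
  congr 2
  funext p
  rw [pairing, pairing, inner_conj_symm, inner_l2Propagator]
  simp

/-- The dispersive estimate together with Young's inequality in time, at equal exponents on both
sides. -/
theorem norm_stripForm_le {ρ : ℝ} (hρ : ρ ∈ Icc (1 / 2 : ℝ) 1) (j : ℤ) (c g : I → κ → ℂ) :
    ‖stripForm A E j c g‖ ≤ dispersiveConst d ^ (2 * ρ - 1) *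
      (4 * 2 ^ (j * (1 - d * (ρ - 1 / 2)))) * mixedNorm A.weight E.weight (1 / 2) ρ c *
        mixedNorm A.weight E.weight (1 / 2) ρ g := by
  have hD := dispersiveConst_pos d
  have hρ0 : 0 < ρ := by linarith [hρ.1]
  have hc := mixedNorm_nonneg (u := A.weight) (v := E.weight) (1 / 2) ρ c
  have hg := mixedNorm_nonneg (u := A.weight) (v := E.weight) (1 / 2) ρ g
  have hγ : 0 ≤ d * (ρ - 1 / 2) := mul_nonneg (by positivity) (by linarith [hρ.1])
  have hY := lintegral_shell_le (a := 1 / 2) (b := 1 / 2) (by norm_num) (by norm_num)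
    (by norm_num) (by norm_num) (by norm_num) hγ j (measurable_size A E hρ0 (star g))
    (measurable_size A E hρ0 c)
  rw [lintegral_size A E hρ0 (by norm_num), lintegral_size A E hρ0 (by norm_num), mixedNorm_star,
    ← ENNReal.ofReal_mul (by positivity), ← ENNReal.ofReal_mul (by positivity)] at hY
  have h1 : ‖stripForm A E j c g‖ₑ ≤ ENNReal.ofReal (dispersiveConst d ^ (2 * ρ - 1)) *
      ∫⁻ s, ∫⁻ t, (shell j).indicator (decay (d * (ρ - 1 / 2))) (s - t) *
        (size A E ρ (star g) s * size A E ρ c t) := by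
    rw [stripForm_apply]
    refine (enorm_integral_le_lintegral_enorm _).trans ?_
    rw [← lintegral_indicator (measurableSet_strip j), Measure.volume_eq_prod]
    refine (lintegral_prod_le _).trans ?_
    rw [← lintegral_const_mul' _ _ ENNReal.ofReal_ne_top]
    refine lintegral_mono fun s ↦ ?_
    rw [← lintegral_const_mul' _ _ ENNReal.ofReal_ne_top]
    refine lintegral_mono fun t ↦ ?_
    by_cases h : s - t ∈ shell j
    · rw [indicator_of_mem (show (s, t) ∈ strip j from h), indicator_of_mem h, decay, size, size,
        ← ENNReal.ofReal_mul (wnorm_nonneg _ _), ← ENNReal.ofReal_mul (by positivity),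
        ← ENNReal.ofReal_mul (by positivity), ← ofReal_norm]
      apply ENNReal.ofReal_le_ofReal
      have h0 : s - t ≠ 0 := fun h0 ↦ by
        have := iUnion_shell ▸ mem_iUnion.2 ⟨j, h⟩
        exact this h0
      refine (norm_inner_vec_le E E h0 hρ _ _).trans (le_of_eq ?_)
      ring
    · rw [indicator_of_notMem (show (s, t) ∉ strip j from h)]
      exact zero_le
  have h2 := h1.trans (mul_le_mul_right hY _)
  rw [← ENNReal.ofReal_mul (by positivity), ← ofReal_norm,
    ENNReal.ofReal_le_ofReal_iff (by positivity)] at h2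
  refine h2.trans (le_of_eq ?_)
  rw [show (2 : ℝ) - 1 / 2 - 1 / 2 = 1 by norm_num]
  ring

theorem size_restrict {S : Set ℝ} (hS : MeasurableSet S) {ρ : ℝ} (hρ : 0 < ρ) (c : I → κ → ℂ)
    (s : ℝ) : size (A.restrict hS) E ρ c s = S.indicator (size A E ρ c) s := by
  classical
  rw [size, A.coef_restrict hS]
  by_cases h : s ∈ S <;> simp [h, size, wnorm_zero hρ]

/-- Hölder's inequality in time. -/
theorem mixedNorm_le_rpow_mul {W : Set ℝ} {m : ℝ} (hm : 0 ≤ m) (hA : ∀ i, A.set i ⊆ W)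
    (hWm : MeasurableSet W) (hW : volume W ≤ ENNReal.ofReal m) {π ρ : ℝ} (hπ : 1 / 2 ≤ π)
    (hρ : 0 < ρ) (c : I → κ → ℂ) :
    mixedNorm A.weight E.weight π ρ c ≤
      m ^ (π - 1 / 2) * mixedNorm A.weight E.weight (1 / 2) ρ c := by
  have hc := mixedNorm_nonneg (u := A.weight) (v := E.weight) (1 / 2) ρ c
  have hπ0 : 0 < π := by linarith
  rw [← ENNReal.ofReal_le_ofReal_iff (by positivity), ENNReal.ofReal_mul (by positivity),
    ← lintegral_size A E hρ hπ0, ← lintegral_size A E hρ (by norm_num),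
    ← ENNReal.ofReal_rpow_of_nonneg hm (by linarith)]
  have hms := measurable_size A E hρ c
  have h0 : ∫⁻ s, size A E ρ c s ^ π⁻¹ =
      ∫⁻ s in W, (size A E ρ c s ^ (1 / 2 : ℝ)⁻¹) ^ (1 / (2 * π)) *
      (fun _ ↦ 1) s ^ (1 - 1 / (2 * π)) := by
    rw [← lintegral_indicator hWm]
    refine lintegral_congr fun s ↦ ?_
    by_cases hs : s ∈ W
    · rw [indicator_of_mem hs, ENNReal.one_rpow, mul_one, ← ENNReal.rpow_mul]
      congr 1
      field_simp
    · rw [indicator_of_notMem hs, size, A.coef_of_notMem fun i hi ↦ hs (hA i hi), wnorm_zero hρ]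
      simp [hπ0]
  have h1 := ENNReal.lintegral_mul_norm_pow_le (μ := volume.restrict W)
    (f := fun s ↦ size A E ρ c s ^ (1 / 2 : ℝ)⁻¹) (g := fun _ ↦ 1) (hms.pow_const _).aemeasurable
    aemeasurable_const (p := 1 / (2 * π)) (q := 1 - 1 / (2 * π)) (by positivity)
    (by rw [sub_nonneg, div_le_one (by positivity)]; linarith) (by ring)
  rw [← h0] at h1
  have h2 : ∫⁻ s in W, size A E ρ c s ^ (1 / 2 : ℝ)⁻¹ ≤ ∫⁻ s, size A E ρ c s ^ (1 / 2 : ℝ)⁻¹ :=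
    setLIntegral_le_lintegral _ _
  rw [lintegral_const, one_mul, Measure.restrict_apply_univ] at h1
  calc _ ≤ ((∫⁻ s, size A E ρ c s ^ (1 / 2 : ℝ)⁻¹) ^ (1 / (2 * π)) *
        ENNReal.ofReal m ^ (1 - 1 / (2 * π))) ^ π := by
        refine ENNReal.rpow_le_rpow (h1.trans ?_) hπ0.le
        gcongr
        rw [sub_nonneg, div_le_one (by positivity)]; linarith
    _ = _ := by
        rw [ENNReal.mul_rpow_of_nonneg _ _ hπ0.le, ← ENNReal.rpow_mul, ← ENNReal.rpow_mul, mul_comm]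
        congr 2
        · field_simp
        · field_simp

end Pairing

end FinFamily

namespace FinFamily

section Endpoint

variable {d : ℕ} {I κ : Type*} [Fintype I] [Fintype κ] (A : FinFamily (volume : Measure ℝ) I)
  (E : FinFamily (volume : Measure (Rd d)) κ)

/-- The times at a dyadic distance from `t`. -/
def window (j : ℤ) (t : ℝ) : Set ℝ := {s | t - s ∈ shell j}

theorem measurableSet_window (j : ℤ) (t : ℝ) : MeasurableSet (window j t) :=
  (measurable_const.sub measurable_id) (measurableSet_shell j)

theorem volume_window_le (j : ℤ) (t : ℝ) : volume (window j t) ≤ ENNReal.ofReal (4 * 2 ^ j) := by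
  refine le_of_eq_of_le ?_ (volume_shell_le j)
  exact (Measure.measurePreserving_sub_left volume t).measure_preimage
    (measurableSet_shell j).nullMeasurableSet

/-- A bound for the evolution over the windows bounds the dyadic piece of the `TT*` form. -/
theorem norm_stripForm_le_of_window {j : ℤ} {K ρ₁ ρ₂ : ℝ} (hK : 0 ≤ K) (hρ₁ : 0 < ρ₁)
    (hρ₂ : 0 < ρ₂)
    (h : ∀ t (c : I → κ → ℂ) (g : κ → ℂ),
      ‖inner ℂ (E.vec g) (evolve (A.restrict (measurableSet_window j t)) E t c)‖ ≤
        K * mixedNorm (A.restrict (measurableSet_window j t)).weight E.weight (1 / 2) ρ₁ c *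
          wnorm E.weight ρ₂ g) (c g : I → κ → ℂ) :
    ‖stripForm A E j c g‖ ≤ K * (4 * 2 ^ j) ^ (1 / 2 : ℝ) *
      mixedNorm A.weight E.weight (1 / 2) ρ₁ c * mixedNorm A.weight E.weight (1 / 2) ρ₂ g := by
  classical
  have hc := mixedNorm_nonneg (u := A.weight) (v := E.weight) (1 / 2) ρ₁ c
  have hg := mixedNorm_nonneg (u := A.weight) (v := E.weight) (1 / 2) ρ₂ g
  have hcm := measurable_size A E hρ₁ c
  have hgm := measurable_size A E hρ₂ (star g)
  have h1 : stripForm A E j c g = ∫ t, inner ℂ (E.vec (A.coef t (star g)))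
      (evolve (A.restrict (measurableSet_window j t)) E t c) := by
    rw [stripForm_apply, ← integral_indicator (measurableSet_strip j), Measure.volume_eq_prod,
      integral_prod _ ((integrable_pairing A E c (star g)).indicator (measurableSet_strip j))]
    congr 1
    funext t
    rw [inner_evolve]
    congr 1
    funext s
    rw [A.coef_restrict (measurableSet_window j t)]
    by_cases hs : s ∈ window j t
    · rw [if_pos hs, indicator_of_mem (show (t, s) ∈ strip j from hs), pairing]
    · rw [if_neg hs, indicator_of_notMem (show (t, s) ∉ strip j from hs)]
      simp
  let f : ℝ → ℝ → ℝ≥0∞ := fun t s ↦ (window j t).indicator (size A E ρ₁ c) s ^ (1 / 2 : ℝ)⁻¹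
  have hfm : Measurable (Function.uncurry f) := by
    have : Function.uncurry f = fun p ↦
        (strip j).indicator (fun p ↦ size A E ρ₁ c p.2) p ^ (1 / 2 : ℝ)⁻¹ := by
      funext p
      by_cases hp : p ∈ strip j
      · simp only [Function.uncurry, f]
        rw [indicator_of_mem hp, indicator_of_mem (show p.2 ∈ window j p.1 from hp)]
      · simp only [Function.uncurry, f]
        rw [indicator_of_notMem hp, indicator_of_notMem (show p.2 ∉ window j p.1 from hp)]
    rw [this]
    exact ((hcm.comp measurable_snd).indicator (measurableSet_strip j)).pow_const _
  have h2 : ‖stripForm A E j c g‖ₑ ≤ ENNReal.ofReal K *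
      ∫⁻ t, (∫⁻ s, f t s) ^ (1 / 2 : ℝ) * (size A E ρ₂ (star g) t ^ (2 : ℝ)) ^ (1 / 2 : ℝ) := by
    rw [h1, ← lintegral_const_mul' _ _ ENNReal.ofReal_ne_top]
    refine (enorm_integral_le_lintegral_enorm _).trans (lintegral_mono fun t ↦ ?_)
    have h3 := lintegral_size (A.restrict (measurableSet_window j t)) E hρ₁
      (show (0 : ℝ) < 1 / 2 by norm_num) c
    simp_rw [A.size_restrict E (measurableSet_window j t) hρ₁ c] at h3
    simp only [f]
    rw [h3, ← ENNReal.rpow_mul, show (2 : ℝ) * (1 / 2) = 1 by norm_num, ENNReal.rpow_one, size,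
      ← ENNReal.ofReal_mul (mixedNorm_nonneg _ _ _), ← ENNReal.ofReal_mul hK, ← ofReal_norm]
    apply ENNReal.ofReal_le_ofReal
    refine (h t c _).trans (le_of_eq (by ring))
  have h4 := ENNReal.lintegral_mul_norm_pow_le (μ := volume) (f := fun t ↦ ∫⁻ s, f t s)
    (g := fun t ↦ size A E ρ₂ (star g) t ^ (2 : ℝ)) hfm.lintegral_prod_right'.aemeasurable
    (hgm.pow_const _).aemeasurable (p := 1 / 2) (q := 1 / 2) (by norm_num) (by norm_num)
    (by norm_num)
  have h5 : ∫⁻ t, ∫⁻ s, f t s ≤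
      ENNReal.ofReal (4 * 2 ^ j) * ∫⁻ s, size A E ρ₁ c s ^ (1 / 2 : ℝ)⁻¹ := by
    rw [lintegral_lintegral_swap hfm.aemeasurable, ← lintegral_const_mul _ (hcm.pow_const _)]
    refine lintegral_mono fun s ↦ ?_
    have hms : MeasurableSet {t | t - s ∈ shell j} :=
      (measurable_id.sub measurable_const) (measurableSet_shell j)
    have : ∀ t, f t s = {t | t - s ∈ shell j}.indicator
        (fun _ ↦ size A E ρ₁ c s ^ (1 / 2 : ℝ)⁻¹) t := by
      intro t
      by_cases ht : t - s ∈ shell j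
      · simp only [f]
        rw [indicator_of_mem (show s ∈ window j t from ht),
          indicator_of_mem (show t ∈ {t | t - s ∈ shell j} from ht)]
      · simp only [f]
        rw [indicator_of_notMem (show s ∉ window j t from ht),
          indicator_of_notMem (show t ∉ {t | t - s ∈ shell j} from ht)]
        simp
    rw [lintegral_congr this, lintegral_indicator hms, setLIntegral_const, mul_comm]
    gcongr
    refine le_of_eq_of_le ?_ (volume_shell_le j)
    exact (measurePreserving_sub_right volume s).measure_preimage
      (measurableSet_shell j).nullMeasurableSet
  have h6 := lintegral_size A E hρ₂ (show (0 : ℝ) < 1 / 2 by norm_num) (star g)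
  rw [mixedNorm_star, show (1 / 2 : ℝ)⁻¹ = 2 by norm_num] at h6
  rw [h6] at h4
  have h7 := h2.trans (mul_le_mul_right (h4.trans (mul_le_mul_left
    (ENNReal.rpow_le_rpow h5 (by norm_num)) _)) _)
  rw [ENNReal.mul_rpow_of_nonneg _ _ (by norm_num), lintegral_size A E hρ₁ (by norm_num),
    ENNReal.ofReal_rpow_of_nonneg (by positivity) (by norm_num),
    ← ENNReal.ofReal_mul (by positivity), ← ENNReal.ofReal_mul (by positivity),
    ← ENNReal.ofReal_mul (by positivity), ← ofReal_norm,
    ENNReal.ofReal_le_ofReal_iff (by positivity)] at h7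
  exact h7.trans (le_of_eq (by ring))

/-- The squared norm of the evolution is the sum of the dyadic pieces of the `TT*` form. -/
theorem hasSum_stripForm (c : I → κ → ℂ) :
    HasSum (fun j ↦ stripForm A E j c (star c)) ((‖evolve A E 0 c‖ ^ 2 : ℝ) : ℂ) := by
  have h1 : ((‖evolve A E 0 c‖ ^ 2 : ℝ) : ℂ) = ∫ p, pairing A E c c p := by
    have h2 := inner_self_eq_norm_sq_to_K (𝕜 := ℂ) (evolve A E 0 c)
    push_cast
    refine (h2.symm.trans (inner_evolve A E 0 c _)).trans ?_
    rw [Measure.volume_eq_prod, integral_prod_symm _ (integrable_pairing A E c c)]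
    congr 1
    funext s
    rw [← inner_conj_symm, inner_evolve, ← integral_conj]
    congr 1
    funext s'
    rw [inner_conj_symm, inner_l2Propagator_l2Propagator, pairing]
    congr 3
    ring
  have hd : Pairwise (Function.onFun Disjoint strip) := fun i j hij ↦
    Set.disjoint_left.2 fun p hi hj ↦ (pairwise_disjoint_shell hij).le_bot ⟨hi, hj⟩
  have h3 := hasSum_integral_iUnion (μ := volume) measurableSet_strip hd
    (integrable_pairing A E c c).integrableOn
  have h4 : ∫ p in ⋃ j, strip j, pairing A E c c p = ∫ p, pairing A E c c p := by
    rw [← setIntegral_univ (μ := volume)]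
    refine setIntegral_congr_set (ae_eq_univ.2 ?_)
    have hm : MeasurableSet (⋃ j, strip j)ᶜ := (MeasurableSet.iUnion measurableSet_strip).compl
    rw [Measure.volume_eq_prod, Measure.measure_prod_null hm]
    refine Filter.Eventually.of_forall fun s ↦ ?_
    refine measure_mono_null (t := {s}) (fun s' hs' ↦ ?_) (by simp)
    by_contra hne
    obtain ⟨j, hj⟩ := mem_iUnion.1 (iUnion_shell.symm ▸
      (show s - s' ∈ ({0}ᶜ : Set ℝ) from sub_ne_zero.2 (Ne.symm hne)))
    exact hs' (mem_iUnion.2 ⟨j, hj⟩)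
  rw [h1, ← h4]
  simpa only [stripForm_apply, star_star] using h3

end Endpoint

end FinFamily

/-! ### Strichartz estimates -/

namespace FinFamily

section Strichartz

variable {d : ℕ}

/-- The mixed corner estimates for the `TT*` form: the dispersive bound on a window, interpolated
with the local `L²` bound on it. The exponents are chosen such that the powers of `2 ^ j` cancel. -/
theorem exists_norm_stripForm_le {ρ₁ ε : ℝ} (hρ₁ : 0 < ρ₁) (hγ : d * (1 / 2 - ρ₁) = 1)
    (hε : 0 < ε) (hε' : ε * (1 + 2 * ρ₁) < ρ₁ * (1 - 2 * ρ₁)) :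
    ∃ M : ℝ, 0 ≤ M ∧ ∀ {I κ : Type} [Fintype I] [Fintype κ]
      (A : FinFamily (volume : Measure ℝ) I) (E : FinFamily (volume : Measure (Rd d)) κ)
      (j : ℤ) (c g : I → κ → ℂ), ‖stripForm A E j c g‖ ≤
        M * mixedNorm A.weight E.weight (1 / 2) (1 - ρ₁ + ε) c *
          mixedNorm A.weight E.weight (1 / 2) (1 - ρ₁ - ε) g := by
  have hD := dispersiveConst_pos d
  have hρ₁2 : ρ₁ < 1 / 2 := by
    by_contra! h
    have : (d : ℝ) * (1 / 2 - ρ₁) ≤ 0 :=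
      mul_nonpos_of_nonneg_of_nonpos (by positivity) (by linarith)
    linarith
  have hd0 : (0 : ℝ) < d := by
    rcases (Nat.cast_nonneg d : (0 : ℝ) ≤ d).eq_or_lt with h | h
    · rw [← h] at hγ; simp at hγ
    · exact h
  have hερ : ε < ρ₁ := by nlinarith
  -- `1 - ρ₁ + ε = (1 - θ) + θ (1 - η)` and `1 - ρ₁ - ε = 1 - θ / 2`, as the interpolation between
  -- the exponents `(1, 1)` and `(1 - η, 1 / 2)` requires; `η > ρ₁` makes the local estimate subcritical
  set θ := 2 * (ρ₁ + ε) with hθ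
  set η := (ρ₁ - ε) / θ with hη
  have hθ0 : 0 < θ := by positivity
  have hθ1 : θ ≤ 1 := by nlinarith
  have hθη : θ * η = ρ₁ - ε := by rw [hη]; field_simp
  have hη0 : 0 < η := div_pos (by linarith) hθ0
  have hη1 : η < 1 / 2 := by rw [hη, div_lt_iff₀ hθ0]; linarith
  have hηρ : ρ₁ < η := by rw [hη, lt_div_iff₀ hθ0, hθ]; nlinarith
  set γ := d * (1 - η - 1 / 2) with hγd
  have hγ1 : γ < 1 := by rw [hγd, ← hγ]; exact mul_lt_mul_of_pos_left (by linarith) hd0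
  set b := dispersiveConst d ^ (2 * (1 - η) - 1) * (2 / (1 - γ)) with hb
  have hb0 : 0 < b := by
    have : 0 < 1 - γ := by linarith
    positivity
  refine ⟨(dispersiveConst d * 4 ^ ((d : ℝ) / 2)) ^ (1 - θ) * (b ^ (1 / 2 : ℝ)) ^ θ,
    by positivity, fun {I κ} _ _ A E j c g ↦ ?_⟩
  set Y : ℝ := 4 * 2 ^ j with hY
  have hY0 : 0 < Y := by positivity
  set M₁ := (dispersiveConst d ^ (2 * (1 - η) - 1) * (2 * Y ^ (1 - γ) / (1 - γ))) ^ (1 / 2 : ℝ)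
    with hM₁
  have hM₁' : M₁ = b ^ (1 / 2 : ℝ) * Y ^ ((1 - γ) / 2) := by
    rw [hM₁, show dispersiveConst d ^ (2 * (1 - η) - 1) * (2 * Y ^ (1 - γ) / (1 - γ)) =
      b * Y ^ (1 - γ) by rw [hb]; ring, Real.mul_rpow hb0.le (by positivity),
      ← Real.rpow_mul hY0.le]
    congr 2; ring
  have hM₁0 : 0 ≤ M₁ := by rw [hM₁']; positivity
  have hK : ∀ t (c : I → κ → ℂ) (g : κ → ℂ),
      ‖inner ℂ (E.vec g) (evolve (A.restrict (measurableSet_window j t)) E t c)‖ ≤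
        ((dispersiveConst d * (2 ^ j : ℝ) ^ (-((d : ℝ) / 2))) ^ (1 - θ) * M₁ ^ θ *
          Y ^ (1 / 2 - θ / 2)) *
        mixedNorm (A.restrict (measurableSet_window j t)).weight E.weight (1 / 2) (1 - ρ₁ + ε) c *
          wnorm E.weight (1 - ρ₁ - ε) g := by
    intro t c g
    have hloc := norm_evolve_le_local (A.restrict (measurableSet_window j t)) E (ρ := 1 - η)
      (L := Y) ⟨by linarith, by linarith⟩ hγ1 hY0 (fun i i' s hs s' hs' ↦ by
        have h1 := hs.2.2
        have h2 := hs'.2.2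
        rw [zpow_add_one₀ two_ne_zero] at h1 h2
        have h3 := abs_sub_le s t s'
        rw [abs_sub_comm s t] at h3
        rw [hY]; linarith) t
    have h1 := norm_inner_evolve_le (A.restrict (measurableSet_window j t)) E (m := 2 ^ j) (t := t)
      (by positivity) (fun i s hs ↦ hs.2.1) (π₁ := 1 / 2) (by norm_num)
      (by linarith : 0 < 1 - η) hM₁0 hloc (θ := θ) ⟨hθ0.le, hθ1⟩ E c g
    have e1 : 1 - θ + θ * (1 - η) = 1 - ρ₁ + ε := by linarith
    have e2 : 1 - θ / 2 = 1 - ρ₁ - ε := by rw [hθ]; ring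
    rw [e1, e2] at h1
    have h2 := mixedNorm_le_rpow_mul (A.restrict (measurableSet_window j t)) E (W := window j t)
      hY0.le (fun i ↦ inter_subset_right) (measurableSet_window j t) (volume_window_le j t)
      (π := 1 - θ + θ * (1 / 2)) (ρ := 1 - ρ₁ + ε) (by linarith) (by linarith) c
    rw [show 1 - θ + θ * (1 / 2) - 1 / 2 = 1 / 2 - θ / 2 by ring] at h2
    have hw := wnorm_nonneg (v := E.weight) (1 - ρ₁ - ε) g
    calc _ ≤ _ := h1
      _ ≤ (dispersiveConst d * (2 ^ j : ℝ) ^ (-((d : ℝ) / 2))) ^ (1 - θ) * M₁ ^ θ *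
          (Y ^ (1 / 2 - θ / 2) * mixedNorm (A.restrict (measurableSet_window j t)).weight E.weight
            (1 / 2) (1 - ρ₁ + ε) c) * wnorm E.weight (1 - ρ₁ - ε) g := by gcongr
      _ = _ := by ring
  refine (norm_stripForm_le_of_window A E (by positivity) (by linarith) (by linarith) hK c g).trans
    (le_of_eq ?_)
  congr 2
  have e3 : (2 ^ j : ℝ) = Y / 4 := by rw [hY]; ring
  have e4 : (2 ^ j : ℝ) ^ (-((d : ℝ) / 2)) = 4 ^ ((d : ℝ) / 2) * Y ^ (-((d : ℝ) / 2)) := by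
    rw [e3, Real.div_rpow hY0.le (by norm_num), Real.rpow_neg (by norm_num : (0 : ℝ) ≤ 4),
      div_inv_eq_mul, mul_comm]
  rw [e4, ← hY, hM₁', ← mul_assoc,
    Real.mul_rpow (x := dispersiveConst d * 4 ^ ((d : ℝ) / 2)) (by positivity) (by positivity),
    Real.mul_rpow (x := b ^ (1 / 2 : ℝ)) (by positivity) (by positivity),
    ← Real.rpow_mul hY0.le, ← Real.rpow_mul hY0.le]
  -- by `d (1 / 2 - ρ₁) = 1` all powers of the length of the window cancel
  have e5 : Y ^ (-((d : ℝ) / 2) * (1 - θ)) * Y ^ ((1 - γ) / 2 * θ) * Y ^ (1 / 2 - θ / 2) *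
      Y ^ (1 / 2 : ℝ) = 1 := by
    rw [← Real.rpow_add hY0, ← Real.rpow_add hY0, ← Real.rpow_add hY0]
    have : -((d : ℝ) / 2) * (1 - θ) + (1 - γ) / 2 * θ + (1 / 2 - θ / 2) + 1 / 2 = 0 := by
      have h1 : θ * γ = d * (θ / 2 - (ρ₁ - ε)) := by rw [hγd, ← hθη]; ring
      have h2 : (d : ℝ) * θ = 2 * d * ρ₁ + 2 * d * ε := by rw [hθ]; ring
      nlinarith
    rw [this, Real.rpow_zero]
  calc _ = (dispersiveConst d * 4 ^ ((d : ℝ) / 2)) ^ (1 - θ) * (b ^ (1 / 2 : ℝ)) ^ θ *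
        (Y ^ (-((d : ℝ) / 2) * (1 - θ)) * Y ^ ((1 - γ) / 2 * θ) * Y ^ (1 / 2 - θ / 2) *
      Y ^ (1 / 2 : ℝ)) := by ring
    _ = _ := by rw [e5, mul_one]

/-- The endpoint Strichartz estimate of Keel and Tao: four corner estimates for the dyadic pieces of
the `TT*` form, summed by `exists_sum_bilin_le`. -/
theorem exists_norm_evolve_le_endpoint {ρ₁ : ℝ} (hρ₁ : 0 < ρ₁) (hγ : d * (1 / 2 - ρ₁) = 1) :
    ∃ C : ℝ, 0 ≤ C ∧ ∀ {I κ : Type} [Fintype I] [Fintype κ]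
      (A : FinFamily (volume : Measure ℝ) I) (E : FinFamily (volume : Measure (Rd d)) κ)
      (c : I → κ → ℂ), ‖evolve A E 0 c‖ ≤ C * mixedNorm A.weight E.weight (1 / 2) (1 - ρ₁) c := by
  have hD := dispersiveConst_pos d
  have hρ₁2 : ρ₁ < 1 / 2 := by
    by_contra! h
    have : (d : ℝ) * (1 / 2 - ρ₁) ≤ 0 :=
      mul_nonpos_of_nonneg_of_nonpos (by positivity) (by linarith)
    linarith
  have hd0 : (0 : ℝ) < d := by
    rcases (Nat.cast_nonneg d : (0 : ℝ) ≤ d).eq_or_lt with h | h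
    · rw [← h] at hγ; simp at hγ
    · exact h
  set ε := ρ₁ * (1 - 2 * ρ₁) / 4 with hε
  have hε0 : 0 < ε := by have : 0 < 1 - 2 * ρ₁ := by linarith
                         positivity
  obtain ⟨M, hM, hcorner⟩ := exists_norm_stripForm_le (d := d) hρ₁ hγ hε0 (by nlinarith)
  obtain ⟨C, hC, h⟩ := exists_sum_bilin_le (ρ := 1 - ρ₁) (ε := ε) (σ := d / 2) hε0 (by positivity)
    (by nlinarith)
  set Ms : ℝ → ℝ := fun δ ↦ dispersiveConst d ^ (2 * (1 - ρ₁ - δ) - 1) * 4 with hMs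
  have hMs0 : ∀ δ, 0 ≤ Ms δ := fun δ ↦ by positivity
  set M' := M + Ms ε + Ms (-ε) with hM'
  have hM'0 : 0 ≤ M' := add_nonneg (add_nonneg hM (hMs0 _)) (hMs0 _)
  refine ⟨√(C * M'), Real.sqrt_nonneg _, fun {I κ} _ _ A E c ↦ ?_⟩
  have hN := mixedNorm_nonneg (u := A.weight) (v := E.weight) (1 / 2) (1 - ρ₁) c
  -- equal deviations: dispersion alone
  have hsame : ∀ (j : ℤ) (δ : ℝ), δ = ε ∨ δ = -ε → ∀ c g : I → κ → ℂ, ‖stripForm A E j c g‖ ≤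
      M' * 2 ^ (j * (d / 2 * (δ + δ))) * mixedNorm A.weight E.weight (1 / 2) (1 - ρ₁ - δ) c *
        mixedNorm A.weight E.weight (1 / 2) (1 - ρ₁ - δ) g := by
    intro j δ hδ c g
    have hδ1 : 1 - ρ₁ - δ ∈ Icc (1 / 2 : ℝ) 1 := by
      rcases hδ with rfl | rfl <;> constructor <;> nlinarith
    have hMδ : Ms δ ≤ M' := by
      have := hMs0 ε
      have := hMs0 (-ε)
      rcases hδ with rfl | rfl <;> linarith
    have h1 := norm_stripForm_le A E hδ1 j c g
    rw [show 1 - d * (1 - ρ₁ - δ - 1 / 2) = d / 2 * (δ + δ) by linarith] at h1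
    have hc := mixedNorm_nonneg (u := A.weight) (v := E.weight) (1 / 2) (1 - ρ₁ - δ) c
    have hg := mixedNorm_nonneg (u := A.weight) (v := E.weight) (1 / 2) (1 - ρ₁ - δ) g
    refine h1.trans ?_
    rw [← mul_assoc]
    gcongr
  -- opposite deviations: the mixed corner estimates
  have hopp : ∀ (j : ℤ) (c g : I → κ → ℂ), ‖stripForm A E j c g‖ ≤
      M' * mixedNorm A.weight E.weight (1 / 2) (1 - ρ₁ + ε) c *
        mixedNorm A.weight E.weight (1 / 2) (1 - ρ₁ - ε) g := by
    intro j c g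
    have hMM : M ≤ M' := by
      have := hMs0 ε
      have := hMs0 (-ε)
      linarith
    have hc := mixedNorm_nonneg (u := A.weight) (v := E.weight) (1 / 2) (1 - ρ₁ + ε) c
    have hg := mixedNorm_nonneg (u := A.weight) (v := E.weight) (1 / 2) (1 - ρ₁ - ε) g
    refine (hcorner A E j c g).trans ?_
    gcongr
  have hsum := h A.weight E.weight A.weight E.weight (stripForm A E) M' hM'0 ?_
  · have h1 : ‖evolve A E 0 c‖ ^ 2 ≤
        C * M' * mixedNorm A.weight E.weight (1 / 2) (1 - ρ₁) c ^ 2 := by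
      have h2 := (hasSum_stripForm A E c).norm
      rw [Complex.norm_of_nonneg (by positivity)] at h2
      refine le_of_tendsto h2 (Filter.Eventually.of_forall fun J ↦ ?_)
      refine (norm_sum_le _ _).trans ((hsum J c (star c)).trans (le_of_eq ?_))
      rw [mixedNorm_star]; ring
    refine abs_le_of_sq_le_sq' ?_ (by positivity) |>.2
    rwa [mul_pow, Real.sq_sqrt (by positivity)]
  · rintro j δ₁ δ₂ (rfl | rfl) (rfl | rfl) c g
    · exact hsame j ε (Or.inl rfl) c g
    · rw [add_neg_cancel, mul_zero, mul_zero, Real.rpow_zero, mul_one, sub_neg_eq_add,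
        ← norm_stripForm_star]
      refine (hopp j _ _).trans (le_of_eq ?_)
      rw [mixedNorm_star, mixedNorm_star]; ring
    · rw [neg_add_cancel, mul_zero, mul_zero, Real.rpow_zero, mul_one, sub_neg_eq_add]
      exact hopp j c g
    · exact hsame j (-ε) (Or.inr rfl) c g

/-- The Strichartz estimates, in dual form: the trivial one with exponent `1` in time, those
obtained from fractional integration, and the endpoint. -/
theorem exists_norm_evolve_le (hd : d ≠ 0) {ρ₁ : ℝ} (hρ₁ : ρ₁ ∈ Icc (0 : ℝ) (1 / 2))
    (hγ : d * (1 / 2 - ρ₁) < 1 ∨ d * (1 / 2 - ρ₁) = 1 ∧ 0 < ρ₁) :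
    ∃ C : ℝ, 0 ≤ C ∧ ∀ {I κ : Type} [Fintype I] [Fintype κ]
      (A : FinFamily (volume : Measure ℝ) I) (E : FinFamily (volume : Measure (Rd d)) κ)
      (t : ℝ) (c : I → κ → ℂ), ‖evolve A E t c‖ ≤
        C * mixedNorm A.weight E.weight (1 - d * (1 / 2 - ρ₁) / 2) (1 - ρ₁) c := by
  have hD := dispersiveConst_pos d
  have hd0 : (0 : ℝ) < d := by exact_mod_cast Nat.pos_of_ne_zero hd
  -- `ρ₁ = 1 / 2` is the triangle inequality in `L²`; below it `TT*` and fractional integration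
  -- apply, up to the endpoint
  rcases hγ with hγ | ⟨hγ, hρ₁0⟩
  · rcases hρ₁.2.eq_or_lt with rfl | hlt
    · refine ⟨1, zero_le_one, fun {I κ} _ _ A E t c ↦ ?_⟩
      have hs := lintegral_size A E (ρ := 1 / 2) (by norm_num) one_pos c
      simp only [inv_one, ENNReal.rpow_one] at hs
      rw [sub_self, mul_zero, zero_div, sub_zero, show (1 : ℝ) - 1 / 2 = 1 / 2 by norm_num, one_mul,
        ← ENNReal.ofReal_le_ofReal_iff (mixedNorm_nonneg _ _ _), ← hs, ofReal_norm, evolve_apply]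
      refine (enorm_integral_le_lintegral_enorm _).trans (lintegral_mono fun s ↦ ?_)
      rw [← ofReal_norm, LinearIsometryEquiv.norm_map, norm_vec, size]
    · set γ := d * (1 / 2 - ρ₁) with hγd
      have hγ0 : 0 < γ := mul_pos hd0 (by linarith)
      obtain ⟨C, hC, h⟩ := exists_fractional_integral_le hγ0 hγ
      set b := dispersiveConst d ^ (2 * (1 - ρ₁) - 1) with hb
      refine ⟨√(b * C), Real.sqrt_nonneg _, fun {I κ} _ _ A E t c ↦ ?_⟩
      have hN := mixedNorm_nonneg (u := A.weight) (v := E.weight) (1 - γ / 2) (1 - ρ₁) c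
      have hρ0 : 0 < 1 - ρ₁ := by linarith
      have h1 := ofReal_sq_norm_evolve_le_decay A E (ρ := 1 - ρ₁)
        ⟨by linarith, by linarith [hρ₁.1]⟩ t c
      rw [show d * (1 - ρ₁ - 1 / 2) = γ by rw [hγd]; ring] at h1
      let w : I → ℂ := fun i ↦ (wnorm E.weight (1 - ρ₁) (c i) : ℂ)
      have hw : ∀ s, size A E (1 - ρ₁) c s = ‖A.coef s w‖ₑ := by
        intro s
        by_cases hi : ∃ i, s ∈ A.set i
        · obtain ⟨i, hi⟩ := hi
          rw [size, A.coef_of_mem hi, A.coef_of_mem hi, ← ofReal_norm,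
            Complex.norm_of_nonneg (wnorm_nonneg _ _)]
        · push Not at hi
          rw [size, A.coef_of_notMem hi, A.coef_of_notMem hi, wnorm_zero hρ0]
          simp
      have hw' : wnorm A.weight (1 - γ / 2) w =
          mixedNorm A.weight E.weight (1 - γ / 2) (1 - ρ₁) c := by
        simp only [wnorm.eq_def A.weight, mixedNorm, w,
          Complex.norm_of_nonneg (wnorm_nonneg _ _)]
      simp_rw [hw] at h1
      have h2 := h1.trans (mul_le_mul_right (h A w) _)
      rw [hw', ← ENNReal.ofReal_mul (by positivity),
        ENNReal.ofReal_le_ofReal_iff (by positivity)] at h2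
      refine abs_le_of_sq_le_sq' ?_ (by positivity) |>.2
      rwa [mul_pow, Real.sq_sqrt (by positivity), mul_assoc]
  · obtain ⟨C, hC, h⟩ := exists_norm_evolve_le_endpoint hρ₁0 hγ
    refine ⟨C, hC, fun {I κ} _ _ A E t c ↦ ?_⟩
    rw [hγ, norm_evolve]
    norm_num at h ⊢
    exact h A E c

/-- The inhomogeneous estimate for data supported at distance at least `m` in time: the dispersive
bound interpolated with a dual Strichartz estimate. The parameter of the interpolation is `2ρ`, as
the exponent on the side of `g` has to be `1 - ρ`; so the Strichartz estimate needed has the inverse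
exponent `ρ₁` with `2ρρ₁ = ρt`, and the acceptability of the exponents says that it is
admissible. -/
theorem exists_norm_inner_evolve_le (hd : d ≠ 0) {ρ ρt : ℝ} (hρ : ρ ≤ 1 / 2) (hρt : 0 ≤ ρt)
    (hle : ρt ≤ ρ) (h : d * (ρ - ρt) ≤ 2 * ρ) (h' : d * (ρ - ρt) = 2 * ρ → 0 < ρ → 0 < ρt) :
    ∃ C : ℝ, 0 ≤ C ∧ ∀ {I κ κ' : Type} [Fintype I] [Fintype κ] [Fintype κ']
      (A : FinFamily (volume : Measure ℝ) I) (E : FinFamily (volume : Measure (Rd d)) κ)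
      (E' : FinFamily (volume : Measure (Rd d)) κ') {m t : ℝ}, 0 < m →
      (∀ i, ∀ s ∈ A.set i, m ≤ |t - s|) → ∀ (c : I → κ → ℂ) (g : κ' → ℂ),
        ‖inner ℂ (E'.vec g) (evolve A E t c)‖ ≤ C * m ^ (-(d * (1 / 2 - ρ))) *
          mixedNorm A.weight E.weight (1 - d / 2 * (ρ - ρt)) (1 - ρt) c *
            wnorm E'.weight (1 - ρ) g := by
  have hD := dispersiveConst_pos d
  obtain ⟨ρ₁, hρ₁, hρρ, hγ⟩ : ∃ ρ₁ : ℝ, ρ₁ ∈ Icc (0 : ℝ) (1 / 2) ∧ 2 * ρ * ρ₁ = ρt ∧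
      (d * (1 / 2 - ρ₁) < 1 ∨ d * (1 / 2 - ρ₁) = 1 ∧ 0 < ρ₁) := by
    rcases (hρt.trans hle).eq_or_lt with h0 | h0
    -- for `ρ = 0` the Strichartz estimate has weight zero; `ρ₁ = 1 / 2` is admissible
    · exact ⟨1 / 2, ⟨by norm_num, le_rfl⟩, by linarith, Or.inl (by norm_num)⟩
    · have he : 2 * ρ * (ρt / (2 * ρ)) = ρt := by field_simp
      refine ⟨ρt / (2 * ρ), ⟨by positivity, ?_⟩, he, ?_⟩
      · rw [div_le_iff₀ (by positivity)]; linarith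
      · have e1 : 2 * ρ * (d * (1 / 2 - ρt / (2 * ρ))) = d * (ρ - ρt) := by field_simp
        rcases h.eq_or_lt with h1 | h1
        · refine Or.inr ⟨?_, div_pos (h' h1 h0) (by positivity)⟩
          rw [h1] at e1
          exact mul_left_cancel₀ (by positivity : 2 * ρ ≠ 0) (by linarith)
        · left
          rw [← e1] at h1
          by_contra! h2
          nlinarith
  obtain ⟨C, hC, hS⟩ := exists_norm_evolve_le hd hρ₁ hγ
  have hρ0 : 0 ≤ ρ := hρt.trans hle
  refine ⟨dispersiveConst d ^ (1 - 2 * ρ) * C ^ (2 * ρ), by positivity,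
    fun {I κ κ'} _ _ _ A E E' {m t} hm hA c g ↦ ?_⟩
  have h1 := norm_inner_evolve_le A E hm hA (π₁ := 1 - d * (1 / 2 - ρ₁) / 2) (ρ₁ := 1 - ρ₁)
    (by rcases hγ with h | h <;> linarith) (by linarith [hρ₁.2]) hC (hS A E t) (θ := 2 * ρ)
    ⟨by positivity, by linarith⟩ E' c g
  refine h1.trans (le_of_eq ?_)
  rw [Real.mul_rpow hD.le (by positivity), ← Real.rpow_mul hm.le]
  rw [show 1 - 2 * ρ + 2 * ρ * (1 - d * (1 / 2 - ρ₁) / 2) = 1 - d / 2 * (ρ - ρt) by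
      rw [← hρρ]; ring,
    show 1 - 2 * ρ + 2 * ρ * (1 - ρ₁) = 1 - ρt by rw [← hρρ]; ring,
    show 1 - 2 * ρ / 2 = 1 - ρ by ring,
    show -((d : ℝ) / 2) * (1 - 2 * ρ) = -(d * (1 / 2 - ρ)) by ring]
  ring

end Strichartz

end FinFamily

/-! ### Step functions and duality in Lebesgue spaces -/

namespace FinFamily

section OfSimpleFunc

variable {α β : Type*} [MeasurableSpace α] {μ : Measure α} [Zero β]

open Classical in
/-- The nonzero values of a simple function. -/
abbrev Values (g : SimpleFunc α β) : Type _ := {y // y ∈ g.range.erase 0}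

/-- The level sets of a simple function that vanishes outside a set of finite measure. -/
def ofSimpleFunc (g : SimpleFunc α β) (hg : g.FinMeasSupp μ) : FinFamily μ (Values g) where
  set y := g ⁻¹' {y.1}
  meas y := g.measurableSet_fiber _
  fin y := by
    classical
    exact (hg.meas_preimage_singleton_ne_zero (Finset.ne_of_mem_erase y.2)).ne
  disj y y' h := Set.disjoint_left.2 fun x hx hx' ↦ h (Subtype.ext (hx.symm.trans hx'))

theorem coef_ofSimpleFunc (g : SimpleFunc α β) (hg : g.FinMeasSupp μ) {M : Type*}
    [AddCommGroup M] [Module ℂ M] (L : β → M) (hL : L 0 = 0) (x : α) :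
    (ofSimpleFunc g hg).coef x (fun y ↦ L y.1) = L (g x) := by
  classical
  by_cases h : g x = 0
  · rw [h, hL]
    refine coef_of_notMem _ (fun y hy ↦ Finset.ne_of_mem_erase y.2 ?_) _
    exact (show g x = y.1 from hy).symm.trans h
  · exact coef_of_mem _ (i := (⟨g x, Finset.mem_erase.2 ⟨h, g.mem_range_self x⟩⟩ : Values g))
      (show g x ∈ ({g x} : Set β) from rfl) _

end OfSimpleFunc

section Approximation

variable {d : ℕ}

theorem coeFn_vec {κ : Type*} [Fintype κ] (E : FinFamily (volume : Measure (Rd d)) κ) (x : κ → ℂ) :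
    E.vec x =ᵐ[volume] fun y ↦ E.coef y x := by
  rw [vec_apply]
  have h : ∀ᵐ y, ∀ k, (x k • indicatorConstLp 2 (E.meas k) (E.fin k) (1 : ℂ)) y =
      (E.set k).indicator (fun _ ↦ x k) y := by
    refine ae_all_iff.2 fun k ↦ ?_
    filter_upwards [Lp.coeFn_smul (x k) (indicatorConstLp 2 (E.meas k) (E.fin k) (1 : ℂ)),
      indicatorConstLp_coeFn (p := 2) (hs := E.meas k) (hμs := E.fin k) (c := (1 : ℂ))]
      with y h1 h2
    rw [h1, Pi.smul_apply, h2]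
    by_cases hy : y ∈ E.set k <;> simp [hy]
  filter_upwards [Lp.coeFn_finsetSum Finset.univ
    fun k ↦ x k • indicatorConstLp 2 (E.meas k) (E.fin k) (1 : ℂ), h] with y h1 h2
  rw [h1, Finset.sum_apply, Finset.sum_congr rfl fun k _ ↦ h2 k]
  exact (E.apply_coef (fun _ z ↦ z) (fun _ ↦ rfl) x y).symm

theorem memLp_coef {α : Type*} [MeasurableSpace α] {μ : Measure α} {κ : Type*} [Fintype κ]
    (E : FinFamily μ κ) (x : κ → ℂ) (p : ℝ≥0∞) : MemLp (fun y ↦ E.coef y x) p μ := by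
  have h : (fun y ↦ E.coef y x) = fun y ↦ ∑ k, (E.set k).indicator (fun _ ↦ x k) y :=
    funext fun y ↦ E.apply_coef (fun _ z ↦ z) (fun _ ↦ rfl) x y
  rw [h]
  exact memLp_finsetSum _ fun k _ ↦ memLp_indicator_const p (E.meas k) _ (Or.inr (E.fin k))

theorem eLpNorm_coef {α : Type*} [MeasurableSpace α] {μ : Measure α} {κ : Type*} [Fintype κ]
    (E : FinFamily μ κ) (x : κ → ℂ) {p : ℝ≥0∞} (hp0 : p ≠ 0) (hp : p ≠ ∞) :
    eLpNorm (fun y ↦ E.coef y x) p μ = ENNReal.ofReal (wnorm E.weight (p⁻¹).toReal x) := by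
  have hpos : 0 < (p⁻¹).toReal := ENNReal.toReal_pos (by simpa) (by simpa)
  rw [← E.lintegral_enorm_coef hpos, eLpNorm_eq_lintegral_rpow_enorm_toReal hp0 hp,
    ENNReal.toReal_inv, inv_inv, one_div]

/-- Finitely many functions are approximated by step functions over a common family. -/
theorem exists_coef_approx {α : Type*} [MeasurableSpace α] {μ : Measure α} {I : Type} [Fintype I]
    {f : I → α → ℂ} (hf : ∀ i, StronglyMeasurable (f i)) {p p' : ℝ≥0∞} (hp : p ≠ ∞) (hp' : p' ≠ ∞)
    (hp0 : p ≠ 0)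
    (h : ∀ i, MemLp (f i) p μ) (h' : ∀ i, MemLp (f i) p' μ) {ε : ℝ≥0∞} (hε : ε ≠ 0) :
    ∃ (κ : Type) (_ : Fintype κ) (E : FinFamily μ κ) (c : I → κ → ℂ), ∀ i,
      eLpNorm (fun x ↦ E.coef x (c i) - f i x) p μ ≤ ε ∧
        eLpNorm (fun x ↦ E.coef x (c i) - f i x) p' μ ≤ ε := by
  let Φ : α → I → ℂ := fun x i ↦ f i x
  have hΦ : Measurable Φ := measurable_pi_lambda _ fun i ↦ (hf i).measurable
  have hm : MemLp Φ p μ := memLp_pi_iff.2 h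
  have hm' : MemLp Φ p' μ := memLp_pi_iff.2 h'
  have h1 := SimpleFunc.tendsto_approxOn_range_Lp_eLpNorm (μ := μ) hp hΦ hm.2
  have h2 := SimpleFunc.tendsto_approxOn_range_Lp_eLpNorm (μ := μ) hp' hΦ hm'.2
  have hε' := pos_iff_ne_zero.2 hε
  obtain ⟨n, hn1, hn2⟩ := ((h1.eventually (gt_mem_nhds hε')).and
    (h2.eventually (gt_mem_nhds hε'))).exists
  set G := SimpleFunc.approxOn Φ hΦ (range Φ ∪ {0}) 0 (by simp) n
  have hG : G.FinMeasSupp μ := (SimpleFunc.memLp_iff_finMeasSupp hp0 hp).1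
    (SimpleFunc.memLp_approxOn_range hΦ hm n)
  refine ⟨Values G, inferInstance, ofSimpleFunc G hG, fun i y ↦ y.1 i, fun i ↦ ?_⟩
  have hc : ∀ x, (ofSimpleFunc G hG).coef x (fun y ↦ y.1 i) = G x i := fun x ↦
    coef_ofSimpleFunc G hG (fun y : I → ℂ ↦ y i) rfl x
  simp_rw [hc]
  have hle : ∀ q, eLpNorm (fun x ↦ G x i - f i x) q μ ≤ eLpNorm (⇑G - Φ) q μ := fun q ↦
    eLpNorm_mono fun x ↦ norm_le_pi_norm ((⇑G - Φ) x) i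
  exact ⟨(hle p).trans hn1.le, (hle p').trans hn2.le⟩

end Approximation

section Duality

variable {d : ℕ}

/-- Hölder's inequality. -/
theorem lintegral_enorm_mul_enorm_le {α M N : Type*} [MeasurableSpace α] {μ : Measure α}
    [NormedAddCommGroup M] [NormedAddCommGroup N] {p q : ℝ≥0∞} [ENNReal.HolderConjugate p q]
    {f : α → M} {g : α → N} (hf : AEStronglyMeasurable f μ) (hg : AEStronglyMeasurable g μ) :
    ∫⁻ x, ‖f x‖ₑ * ‖g x‖ₑ ∂μ ≤ eLpNorm f p μ * eLpNorm g q μ := by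
  have h := eLpNorm_smul_le_mul_eLpNorm (p := p) (q := q) (r := 1) hg.norm hf.norm
  rw [eLpNorm_one_eq_lintegral_enorm, eLpNorm_norm, eLpNorm_norm] at h
  simpa [enorm_smul] using h

theorem enorm_integral_mul_le {α : Type*} [MeasurableSpace α] {μ : Measure α} {p q : ℝ≥0∞}
    [ENNReal.HolderConjugate p q] {f g : α → ℂ} (hf : AEStronglyMeasurable f μ)
    (hg : AEStronglyMeasurable g μ) :
    ‖∫ x, f x * g x ∂μ‖ₑ ≤ eLpNorm f p μ * eLpNorm g q μ := by
  refine (enorm_integral_le_lintegral_enorm _).trans ?_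
  simpa only [enorm_mul] using lintegral_enorm_mul_enorm_le (p := p) (q := q) hf hg

/-- The norm of `L^r` is attained against step functions. For `r = ∞` this is Lebesgue's
differentiation theorem, for `r < ∞` one tests against approximations of `|v|^{r-2} v`. -/
theorem eLpNorm_le_of_forall_coef {r r' : ℝ≥0∞} [hr : ENNReal.HolderConjugate r r'] (hr1 : r ≠ 1)
    {v : Rd d → ℂ} (hv : MemLp v r volume) {K : ℝ} (hK : 0 ≤ K)
    (h : ∀ {κ : Type} [Fintype κ] (E : FinFamily (volume : Measure (Rd d)) κ) (g : κ → ℂ),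
      ‖∫ x, star (E.coef x g) * v x‖ ≤ K * wnorm E.weight (r'⁻¹).toReal g) :
    eLpNorm v r volume ≤ ENNReal.ofReal K := by
  rcases eq_or_ne r ∞ with rfl | hrt
  · obtain rfl : r' = 1 := by
      have := hr.inv_add_inv_eq_one
      simpa using this
    have hloc : LocallyIntegrable v volume := hv.locallyIntegrable le_top
    have hae := IsUnifLocDoublingMeasure.ae_tendsto_average (volume : Measure (Rd d)) hloc 1
    rw [eLpNorm_exponent_top]
    refine eLpNormEssSup_le_of_ae_bound ?_
    filter_upwards [hae] with x hx
    have hlim := hx (l := nhdsWithin (0 : ℝ) (Ioi 0)) (fun _ ↦ x) id Filter.tendsto_id (by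
      filter_upwards [self_mem_nhdsWithin] with δ hδ
      exact Metric.mem_closedBall_self (by simpa using (le_of_lt hδ)))
    refine le_of_tendsto hlim.norm ?_
    filter_upwards [self_mem_nhdsWithin] with δ hδ
    have hfin : volume (Metric.closedBall x δ) ≠ ∞ := measure_closedBall_lt_top.ne
    have h1 := h (κ := Unit) ⟨fun _ ↦ Metric.closedBall x δ, fun _ ↦ measurableSet_closedBall,
      fun _ ↦ hfin, fun i j hij ↦ (hij rfl).elim⟩ (fun _ ↦ 1)
    have h2 : ∀ y, star ((⟨fun _ ↦ Metric.closedBall x δ, fun _ ↦ measurableSet_closedBall,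
        fun _ ↦ hfin, fun i j hij ↦ (hij rfl).elim⟩ : FinFamily (volume : Measure (Rd d)) Unit).coef
        y (fun _ ↦ (1 : ℂ))) * v y = (Metric.closedBall x δ).indicator v y := by
      intro y
      rw [apply_coef _ (fun _ z ↦ star z * v y) (by simp)]
      by_cases hy : y ∈ Metric.closedBall x δ <;> simp [hy]
    rw [integral_congr_ae (Filter.Eventually.of_forall h2),
      integral_indicator measurableSet_closedBall, inv_one, ENNReal.toReal_one, wnorm_one] at h1
    simp only [Finset.univ_unique, Finset.sum_singleton, norm_one, mul_one, coe_weight] at h1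
    rw [setAverage_eq, norm_smul, norm_inv, Real.norm_of_nonneg measureReal_nonneg]
    have hpos : 0 < volume.real (Metric.closedBall x δ) :=
      ENNReal.toReal_pos (Metric.measure_closedBall_pos volume x hδ).ne' hfin
    refine (inv_mul_le_iff₀ hpos).2 ?_
    rw [mul_comm]
    exact h1
  · wlog hvm : StronglyMeasurable v generalizing v
    · have hvv := hv.1.ae_eq_mk
      rw [eLpNorm_congr_ae hvv]
      refine this (v := hv.1.mk v) ((memLp_congr_ae hvv).1 hv) (fun E g ↦ ?_)
        hv.1.stronglyMeasurable_mk
      refine le_of_eq_of_le ?_ (h E g)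
      congr 1
      refine integral_congr_ae ?_
      filter_upwards [hvv] with x hx
      rw [hx]
    have hr0 : r ≠ 0 := hr.ne_zero
    have hr'0 : r' ≠ 0 := hr.symm.ne_zero
    have hr't : r' ≠ ∞ := by
      rintro rfl
      apply hr1
      have := hr.inv_add_inv_eq_one
      simpa using this
    set p := r.toReal with hp
    have hp1 : 1 < p := by
      have h1 : (1 : ℝ≥0∞) < r := lt_of_le_of_ne hr.one_le (Ne.symm hr1)
      simpa [hp] using (ENNReal.toReal_lt_toReal (by simp) hrt).2 h1
    have hpr : (r'⁻¹).toReal = 1 - p⁻¹ := by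
      have h1 := congrArg ENNReal.toReal hr.inv_add_inv_eq_one
      rw [ENNReal.toReal_add (by simpa) (by simpa), ENNReal.toReal_one, ENNReal.toReal_inv r,
        ← hp] at h1
      linarith
    -- the extremal function `|v| ^ (p - 2) v` of Hölder's inequality; `hstep` tests `v` against
    -- step functions within `ε` of it
    let w : Rd d → ℂ := fun x ↦ ((‖v x‖ ^ (p - 2) : ℝ) : ℂ) * v x
    have hwm : StronglyMeasurable w := by
      refine StronglyMeasurable.mul ?_ hvm
      exact (Complex.continuous_ofReal.measurable.comp
        (hvm.norm.measurable.pow_const _)).stronglyMeasurable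
    have hwv : ∀ x, star (w x) * v x = ((‖v x‖ ^ p : ℝ) : ℂ) := by
      intro x
      rcases eq_or_ne (v x) 0 with h0 | h0
      · simp [w, h0, (zero_lt_one.trans hp1).ne']
      · have : star (w x) * v x = ((‖v x‖ ^ (p - 2) : ℝ) : ℂ) * (star (v x) * v x) := by
          simp only [w, star_mul', Complex.star_def, Complex.conj_ofReal]; ring
        rw [this, Complex.star_def, Complex.conj_mul', ← Complex.ofReal_pow, ← Complex.ofReal_mul]
        congr 1
        rw [← Real.rpow_natCast, ← Real.rpow_add (norm_pos_iff.2 h0)]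
        congr 1; push_cast; ring
    have hwn : ∀ x, ‖w x‖ₑ = ‖v x‖ₑ ^ (p - 1) := by
      intro x
      rw [← ofReal_norm, ← ofReal_norm, ENNReal.ofReal_rpow_of_nonneg (norm_nonneg _) (by linarith)]
      congr 1
      rcases eq_or_ne (v x) 0 with h0 | h0
      · simp [w, h0, (sub_pos.2 hp1).ne']
      · simp only [w]
        rw [norm_mul, Complex.norm_of_nonneg (by positivity)]
        nth_rewrite 2 [← Real.rpow_one ‖v x‖]
        rw [← Real.rpow_add (norm_pos_iff.2 h0)]
        congr 1; ring
    set N := ∫⁻ x, ‖v x‖ₑ ^ p with hN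
    have hNv : eLpNorm v r volume = N ^ p⁻¹ := by
      rw [eLpNorm_eq_lintegral_rpow_enorm_toReal hr0 hrt, one_div]
    have hNt : N ≠ ∞ := by
      have := hv.2
      rw [hNv] at this
      exact fun h ↦ by
        rw [h, ENNReal.top_rpow_of_pos (by positivity)] at this
        exact this.ne rfl
    have hNw : eLpNorm w r' volume = N ^ (1 - p⁻¹) := by
      rw [eLpNorm_eq_lintegral_rpow_enorm_toReal hr'0 hr't, one_div, ← ENNReal.toReal_inv, hpr]
      congr 1
      refine lintegral_congr fun x ↦ ?_
      rw [hwn, ← ENNReal.rpow_mul]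
      congr 1
      have : r'.toReal = (1 - p⁻¹)⁻¹ := by rw [← hpr, ENNReal.toReal_inv, inv_inv]
      have hp2 : p - 1 ≠ 0 := by linarith
      rw [this]; field_simp
    have hwL : MemLp w r' volume := ⟨hwm.aestronglyMeasurable, by
      rw [hNw]
      exact (ENNReal.rpow_lt_top_of_nonneg (by
        rw [sub_nonneg]; exact inv_le_one_of_one_le₀ hp1.le) hNt)⟩
    have hNint : ‖∫ x, star (w x) * v x‖ₑ = N := by
      simp_rw [hwv]
      rw [integral_complex_ofReal, ← ofReal_norm, Complex.norm_of_nonneg (by positivity),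
        ofReal_integral_eq_lintegral_ofReal]
      · refine lintegral_congr fun x ↦ ?_
        rw [← ENNReal.ofReal_rpow_of_nonneg (norm_nonneg _) (by linarith), ofReal_norm]
      · have := hv.integrable_norm_rpow hr0 hrt
        exact this
      · exact Filter.Eventually.of_forall fun x ↦ by positivity
    have hstar : ∀ {f : Rd d → ℂ} {q : ℝ≥0∞}, eLpNorm (fun x ↦ star (f x)) q volume =
        eLpNorm f q volume := fun {f q} ↦ eLpNorm_congr_norm_ae (by simp)
    have hstep : ∀ ε : ℝ≥0, 0 < ε →
        N ≤ ENNReal.ofReal K * (N ^ (1 - p⁻¹) + ε) + ε * eLpNorm v r volume := by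
      intro ε hε
      obtain ⟨κ, _, E, c, hc⟩ := exists_coef_approx (I := Unit) (f := fun _ ↦ w) (fun _ ↦ hwm) hr't
        hr't hr'0 (fun _ ↦ hwL) (fun _ ↦ hwL) (ε := ε) (by exact_mod_cast hε.ne')
      have hE := E.memLp_coef (c ()) r'
      have hd : MemLp (fun x ↦ E.coef x (c ()) - w x) r' volume := hE.sub hwL
      have hi1 : Integrable (fun x ↦ star (E.coef x (c ())) * v x) volume :=
        memLp_one_iff_integrable.1 (hv.mul' hE.star)
      have hi2 : Integrable (fun x ↦ star (E.coef x (c ()) - w x) * v x) volume :=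
        memLp_one_iff_integrable.1 (hv.mul' hd.star)
      have hsplit : ∫ x, star (w x) * v x =
          (∫ x, star (E.coef x (c ())) * v x) - ∫ x, star (E.coef x (c ()) - w x) * v x := by
        rw [← integral_sub hi1 hi2]
        congr 1
        funext x
        rw [star_sub]; ring
      have h1 : ‖∫ x, star (E.coef x (c ())) * v x‖ₑ ≤
          ENNReal.ofReal K * eLpNorm (fun x ↦ E.coef x (c ())) r' volume := by
        rw [E.eLpNorm_coef _ hr'0 hr't, ← ENNReal.ofReal_mul hK, ← ofReal_norm]
        exact ENNReal.ofReal_le_ofReal (h E _)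
      have h2 : ‖∫ x, star (E.coef x (c ()) - w x) * v x‖ₑ ≤ ε * eLpNorm v r volume := by
        refine (enorm_integral_mul_le (p := r') (q := r) hd.star.1 hv.1).trans ?_
        gcongr
        exact hstar.le.trans (hc ()).1
      have h3 : eLpNorm (fun x ↦ E.coef x (c ())) r' volume ≤ N ^ (1 - p⁻¹) + ε := by
        rw [← hNw, add_comm]
        have : (fun x ↦ E.coef x (c ())) = (fun x ↦ E.coef x (c ()) - w x) + w := by
          funext x; simp
        rw [this]
        refine (eLpNorm_add_le hd.1 hwL.1 hr.symm.one_le).trans ?_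
        gcongr
        exact (hc ()).1
      calc N = ‖(∫ x, star (E.coef x (c ())) * v x) -
            ∫ x, star (E.coef x (c ()) - w x) * v x‖ₑ := by rw [← hsplit, hNint]
        _ ≤ _ := enorm_sub_le.trans (add_le_add (h1.trans (by gcongr)) h2)
    have hlim : N ≤ ENNReal.ofReal K * N ^ (1 - p⁻¹) := by
      have hvt := hv.2.ne
      have ht : Filter.Tendsto (fun ε : ℝ≥0 ↦ ENNReal.ofReal K * (N ^ (1 - p⁻¹) + ε) +
          ε * eLpNorm v r volume) (nhdsWithin 0 (Ioi 0))
          (nhds (ENNReal.ofReal K * (N ^ (1 - p⁻¹) + (0 : ℝ≥0)) +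
            ((0 : ℝ≥0) : ℝ≥0∞) * eLpNorm v r volume)) := by
        refine Filter.Tendsto.mono_left (Continuous.tendsto ?_ 0) nhdsWithin_le_nhds
        have c1 : Continuous fun ε : ℝ≥0 ↦ (ε : ℝ≥0∞) := ENNReal.continuous_coe
        exact ((ENNReal.continuous_const_mul ENNReal.ofReal_ne_top).comp
          (continuous_const.add c1)).add ((ENNReal.continuous_mul_const hvt).comp c1)
      have := ge_of_tendsto ht (by
        filter_upwards [self_mem_nhdsWithin] with ε hε using hstep ε hε)
      simpa using this
    rw [hNv]
    rcases eq_or_ne N 0 with h0 | h0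
    · rw [h0, ENNReal.zero_rpow_of_pos (by positivity)]; exact zero_le
    · have e1 : N ^ p⁻¹ * N ^ (1 - p⁻¹) = N := by
        rw [← ENNReal.rpow_add _ _ h0 hNt]; simp
      have hne : N ^ (1 - p⁻¹) ≠ 0 := by simp [ENNReal.rpow_eq_zero_iff, h0, hNt]
      have hnt : N ^ (1 - p⁻¹) ≠ ∞ := by simp [ENNReal.rpow_eq_top_iff, h0, hNt]
      exact (ENNReal.mul_le_mul_iff_left hne hnt).1 (e1.trans_le hlim)

end Duality

end FinFamily

/-! ### From step functions to Schwartz-valued simple functions -/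

namespace FinFamily

section SchwartzValued

variable {d : ℕ} {I : Type} [Fintype I] (A : FinFamily (volume : Measure ℝ) I)

/-- The evolution of a step function with values in `L²`. -/
theorem integrable_l2Propagator_coef (t : ℝ) (x : I → L2d d) :
    Integrable fun s ↦ l2Propagator d (t - s) (A.coef s x) :=
  A.integrable_apply_coef (fun s x ↦ l2Propagator d (t - s) x) (by simp)
    (fun _ ↦ (continuous_l2Propagator _).comp (continuous_const.sub continuous_id))
    (fun x ↦ ⟨‖x‖, fun _ ↦ (LinearIsometryEquiv.norm_map _ _).le⟩) x

theorem norm_integral_l2Propagator_coef_sub_le (t : ℝ) (x y : I → L2d d) :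
    ‖(∫ s, l2Propagator d (t - s) (A.coef s x)) - ∫ s, l2Propagator d (t - s) (A.coef s y)‖ ≤
      ∑ i, A.weight i * ‖x i - y i‖ := by
  rw [← integral_sub (A.integrable_l2Propagator_coef t x) (A.integrable_l2Propagator_coef t y),
    ← ENNReal.ofReal_le_ofReal_iff (by positivity), ofReal_norm]
  refine (enorm_integral_le_lintegral_enorm _).trans (le_of_eq ?_)
  have h : ∀ s, ‖l2Propagator d (t - s) (A.coef s x) - l2Propagator d (t - s) (A.coef s y)‖ₑ =
      ‖A.coef s (x - y)‖ₑ := by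
    intro s
    rw [← map_sub, ← map_sub, ← ofReal_norm, LinearIsometryEquiv.norm_map, ofReal_norm]
  rw [lintegral_congr h, A.lintegral_coef (fun z ↦ ‖z‖ₑ) enorm_zero,
    ENNReal.ofReal_sum_of_nonneg fun i _ ↦ by positivity]
  refine Finset.sum_congr rfl fun i _ ↦ ?_
  rw [ENNReal.ofReal_mul (NNReal.coe_nonneg _), ofReal_norm]
  simp

/-- An estimate for step functions in time and space extends to step functions in time with values
in the Schwartz space, by approximation in `L²` and in `L^p`. -/
theorem norm_inner_integral_le {t K π : ℝ} (hK : 0 ≤ K) (hπ : 0 < π) {p : ℝ≥0∞} [Fact (1 ≤ p)]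
    (hp : p ≠ ∞) {κ' : Type} [Fintype κ'] (E' : FinFamily (volume : Measure (Rd d)) κ')
    (g : κ' → ℂ) {B : ℝ} (hB : 0 ≤ B)
    (h : ∀ {κ : Type} [Fintype κ] (E : FinFamily (volume : Measure (Rd d)) κ) (c : I → κ → ℂ),
      ‖inner ℂ (E'.vec g) (evolve A E t c)‖ ≤
        K * mixedNorm A.weight E.weight π (p⁻¹).toReal c * B) (f : I → 𝓢(Rd d, ℂ)) :
    ‖inner ℂ (E'.vec g) (∫ s, l2Propagator d (t - s) (A.coef s fun i ↦ (f i).toLp 2 volume))‖ ≤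
      K * (∑ i, A.weight i * ‖(f i).toLp p volume‖ ^ π⁻¹) ^ π * B := by
  have hp1 : 1 ≤ p := Fact.out
  have hp0 : p ≠ 0 := (zero_lt_one.trans_le hp1).ne'
  set Ψ : ℝ → ℝ := fun ε ↦ K * (∑ i, A.weight i * (‖(f i).toLp p volume‖ + ε) ^ π⁻¹) ^ π * B +
    ‖E'.vec g‖ * ∑ i, A.weight i * ε with hΨ
  have hstep : ∀ ε : ℝ, 0 < ε → ‖inner ℂ (E'.vec g)
      (∫ s, l2Propagator d (t - s) (A.coef s fun i ↦ (f i).toLp 2 volume))‖ ≤ Ψ ε := by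
    intro ε hε
    obtain ⟨κ, _, E, c, hc⟩ := exists_coef_approx (μ := (volume : Measure (Rd d)))
      (f := fun i ↦ ⇑(f i)) (fun i ↦ (f i).continuous.stronglyMeasurable) ENNReal.ofNat_ne_top hp
      two_ne_zero (fun i ↦ (f i).memLp 2) (fun i ↦ (f i).memLp p) (ε := ENNReal.ofReal ε)
      (by simpa using hε)
    have hev : evolve A E t c =
        ∫ s, l2Propagator d (t - s) (A.coef s fun i ↦ E.vec (c i)) := by
      rw [evolve_apply]
      congr 1
      funext s
      rw [A.map_coef]
    have h2 : ∀ i, ‖(f i).toLp 2 volume - E.vec (c i)‖ ≤ ε := by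
      intro i
      rw [norm_sub_rev, Lp.norm_def]
      refine ENNReal.toReal_le_of_le_ofReal hε.le (le_of_eq_of_le (eLpNorm_congr_ae ?_) (hc i).1)
      filter_upwards [Lp.coeFn_sub (E.vec (c i)) ((f i).toLp 2 volume), E.coeFn_vec (c i),
        (f i).coeFn_toLp 2 volume] with x h1 h2 h3
      rw [h1, Pi.sub_apply, h2, h3]
    have hw : ∀ i, wnorm E.weight (p⁻¹).toReal (c i) ≤ ‖(f i).toLp p volume‖ + ε := by
      intro i
      rw [← ENNReal.ofReal_le_ofReal_iff (by positivity), ← E.eLpNorm_coef _ hp0 hp,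
        ENNReal.ofReal_add (norm_nonneg _) hε.le, SchwartzMap.norm_toLp,
        ENNReal.ofReal_toReal ((f i).memLp p volume).2.ne, add_comm]
      have : (fun x ↦ E.coef x (c i)) = (fun x ↦ E.coef x (c i) - f i x) + ⇑(f i) := by
        funext x; simp
      rw [this]
      refine (eLpNorm_add_le ((E.memLp_coef (c i) p).1.sub ((f i).memLp p).1) ((f i).memLp p).1
        hp1).trans ?_
      gcongr
      exact (hc i).2
    have hm : mixedNorm A.weight E.weight π (p⁻¹).toReal c ≤
        (∑ i, A.weight i * (‖(f i).toLp p volume‖ + ε) ^ π⁻¹) ^ π := by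
      unfold mixedNorm
      refine Real.rpow_le_rpow (mixedSum_nonneg _ _ _) (Finset.sum_le_sum fun i _ ↦ ?_) hπ.le
      exact mul_le_mul_of_nonneg_left (Real.rpow_le_rpow (wnorm_nonneg _ _) (hw i)
        (by positivity)) (NNReal.coe_nonneg _)
    calc _ = ‖inner ℂ (E'.vec g) (evolve A E t c) + inner ℂ (E'.vec g)
          ((∫ s, l2Propagator d (t - s) (A.coef s fun i ↦ (f i).toLp 2 volume)) -
            evolve A E t c)‖ := by rw [← inner_add_right, add_sub_cancel]
      _ ≤ ‖inner ℂ (E'.vec g) (evolve A E t c)‖ + ‖inner ℂ (E'.vec g)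
          ((∫ s, l2Propagator d (t - s) (A.coef s fun i ↦ (f i).toLp 2 volume)) -
            evolve A E t c)‖ := norm_add_le _ _
      _ ≤ Ψ ε := by
          rw [hΨ]
          refine add_le_add ((h E c).trans (by gcongr)) ((norm_inner_le_norm _ _).trans ?_)
          refine mul_le_mul_of_nonneg_left ?_ (norm_nonneg _)
          rw [hev]
          refine (A.norm_integral_l2Propagator_coef_sub_le t _ _).trans
            (Finset.sum_le_sum fun i _ ↦ ?_)
          exact mul_le_mul_of_nonneg_left (h2 i) (NNReal.coe_nonneg _)
  have hcont : Continuous Ψ := by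
    rw [hΨ]
    have h1 : ∀ i, Continuous fun ε : ℝ ↦ (‖(f i).toLp p volume‖ + ε) ^ π⁻¹ := fun i ↦
      (continuous_const.add continuous_id).rpow_const fun _ ↦ Or.inr (by positivity)
    have h2 : Continuous fun ε : ℝ ↦
        (∑ i, (A.weight i : ℝ) * (‖(f i).toLp p volume‖ + ε) ^ π⁻¹) ^ π :=
      (continuous_finsetSum _ fun i _ ↦ continuous_const.mul (h1 i)).rpow_const
        fun _ ↦ Or.inr hπ.le
    fun_prop
  have hlim := (hcont.tendsto 0).mono_left (nhdsWithin_le_nhds (s := Ioi (0 : ℝ)))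
  have := ge_of_tendsto hlim (by filter_upwards [self_mem_nhdsWithin] with ε hε using hstep ε hε)
  simpa [hΨ] using this

end SchwartzValued

end FinFamily

section Duhamel

open FinFamily

variable {d : ℕ} {r : ℝ≥0∞} [Fact (1 ≤ r)]

theorem integrable_schwartzPropagator_toLp (hr : 2 ≤ r) (G : SimpleFunc ℝ 𝓢(Rd d, ℂ))
    (hG : G.FinMeasSupp volume) (t : ℝ) :
    Integrable fun s ↦ (schwartzPropagator d (t - s) (G s)).toLp r volume := by
  have h := (ofSimpleFunc G hG).integrable_apply_coef
    (fun s φ ↦ (schwartzPropagator d (t - s) φ).toLp r volume)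
    (fun s ↦ by rw [map_zero]; exact map_zero (SchwartzMap.toLpCLM ℂ ℂ r volume))
    (fun φ ↦ (continuous_schwartzPropagator_toLp φ hr).comp (continuous_const.sub continuous_id))
    (fun φ ↦ ?_) (fun y ↦ y.1)
  · simpa only [coef_ofSimpleFunc G hG (fun y ↦ y) rfl] using h
  · obtain ⟨C, hC, h⟩ := exists_norm_schwartzPropagator_toLp_le φ hr
    refine ⟨C, fun s ↦ (h _).trans (mul_le_of_le_one_right hC ?_)⟩
    have h1 := two_mul_inv_toReal_le_one hr
    refine Real.rpow_le_one_of_one_le_of_nonpos (by linarith [abs_nonneg (t - s)]) ?_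
    rw [neg_nonpos]
    exact mul_nonneg (Nat.cast_nonneg d) (by linarith)

/-- An estimate for step functions supported at times in `S` bounds the corresponding part of the
Duhamel integral. -/
theorem enorm_setIntegral_schwartzPropagator_le (hr : 2 ≤ r) {p : ℝ≥0∞} [Fact (1 ≤ p)] (hp : p ≠ ∞)
    {S : Set ℝ} (hS : MeasurableSet S) {t K π : ℝ} (hK : 0 ≤ K) (hπ : 0 < π)
    (h : ∀ {I κ κ' : Type} [Fintype I] [Fintype κ] [Fintype κ']
      (A : FinFamily (volume : Measure ℝ) I) (E : FinFamily (volume : Measure (Rd d)) κ)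
      (E' : FinFamily (volume : Measure (Rd d)) κ'), (∀ i, A.set i ⊆ S) →
      ∀ (c : I → κ → ℂ) (g : κ' → ℂ), ‖inner ℂ (E'.vec g) (evolve A E t c)‖ ≤
        K * mixedNorm A.weight E.weight π (p⁻¹).toReal c *
          wnorm E'.weight (1 - (r⁻¹).toReal) g)
    (G : SimpleFunc ℝ 𝓢(Rd d, ℂ)) (hG : G.FinMeasSupp volume) :
    ‖∫ s in S, (schwartzPropagator d (t - s) (G s)).toLp r volume‖ₑ ≤
      ENNReal.ofReal K * (∫⁻ s in S, ‖(G s).toLp p volume‖ₑ ^ π⁻¹) ^ π := by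
  classical
  have hr1 : 1 ≤ r := Fact.out
  have hconj := ENNReal.HolderConjugate.inv_one_sub_inv' hr1
  set r' : ℝ≥0∞ := (1 - r⁻¹)⁻¹ with hr'
  have : Fact (1 ≤ r') := ⟨hconj.symm.one_le⟩
  have hr'inv : (r'⁻¹).toReal = 1 - (r⁻¹).toReal := by
    rw [hr', inv_inv, ENNReal.toReal_sub_of_le (ENNReal.inv_le_one.2 hr1) (by simp),
      ENNReal.toReal_one]
  let A := (ofSimpleFunc G hG).restrict hS
  let f : Values G → 𝓢(Rd d, ℂ) := fun y ↦ y.1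
  have hA : ∀ s, A.coef s f = if s ∈ S then G s else 0 := by
    intro s
    rw [(ofSimpleFunc G hG).coef_restrict hS, coef_ofSimpleFunc G hG (fun y ↦ y) rfl]
  have hA' : ∀ (q : ℝ≥0∞) [Fact (1 ≤ q)] s, A.coef s (fun i ↦ (f i).toLp q volume) =
      S.indicator (fun s ↦ (G s).toLp q volume) s := by
    intro q _ s
    have h1 := A.map_coef (SchwartzMap.toLpCLM ℂ ℂ q volume).toLinearMap f s
    refine h1.symm.trans ?_
    rw [hA]
    by_cases hs : s ∈ S
    · rw [if_pos hs, indicator_of_mem hs]; rfl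
    · rw [if_neg hs, indicator_of_notMem hs, map_zero]
  have hsum0 : 0 ≤ ∑ i, (A.weight i : ℝ) * ‖(f i).toLp p volume‖ ^ π⁻¹ := by positivity
  have hsum : (∫⁻ s in S, ‖(G s).toLp p volume‖ₑ ^ π⁻¹) ^ π =
      ENNReal.ofReal ((∑ i, A.weight i * ‖(f i).toLp p volume‖ ^ π⁻¹) ^ π) := by
    rw [← ENNReal.ofReal_rpow_of_nonneg hsum0 hπ.le,
      ENNReal.ofReal_sum_of_nonneg fun i _ ↦ by positivity]
    congr 1
    have h1 := A.lintegral_coef (fun z : Lp ℂ p (volume : Measure (Rd d)) ↦ ‖z‖ₑ ^ π⁻¹)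
      (by simp [hπ]) fun i ↦ (f i).toLp p volume
    rw [← lintegral_indicator hS]
    refine Eq.trans (lintegral_congr fun s ↦ ?_) (h1.trans (Finset.sum_congr rfl fun i _ ↦ ?_))
    · rw [hA']
      by_cases hs : s ∈ S
      · rw [indicator_of_mem hs, indicator_of_mem hs]
      · rw [indicator_of_notMem hs, indicator_of_notMem hs]; simp [hπ]
    · rw [ENNReal.ofReal_mul (NNReal.coe_nonneg _),
        ← ENNReal.ofReal_rpow_of_nonneg (norm_nonneg _) (by positivity), ofReal_norm]
      simp
  have hint := (integrable_schwartzPropagator_toLp hr G hG t).integrableOn (s := S)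
  set v := ∫ s in S, (schwartzPropagator d (t - s) (G s)).toLp r volume with hv
  rw [hsum, ← ENNReal.ofReal_mul hK, Lp.enorm_def]
  refine eLpNorm_le_of_forall_coef (r' := r') (by rintro rfl; exact absurd hr (by norm_num))
    (Lp.memLp v) (by positivity) fun {κ'} _ E' g ↦ ?_
  have hwm : MemLp (fun x ↦ star (E'.coef x g)) r' volume := (E'.memLp_coef g r').star
  let L : Lp ℂ r (volume : Measure (Rd d)) →L[ℂ] ℂ :=
    (ContinuousLinearMap.mul ℂ ℂ).lpPairing volume r' r (hwm.toLp _)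
  have hL : ∀ u : Lp ℂ r (volume : Measure (Rd d)), L u = ∫ x, star (E'.coef x g) * u x := by
    intro u
    refine (ContinuousLinearMap.lpPairing_eq_integral _ _ _).trans (integral_congr_ae ?_)
    filter_upwards [hwm.coeFn_toLp] with x hx
    rw [hx]; rfl
  have hLs : ∀ φ : 𝓢(Rd d, ℂ), L (φ.toLp r volume) = inner ℂ (E'.vec g) (φ.toLp 2 volume) := by
    intro φ
    rw [hL, L2.inner_def]
    refine integral_congr_ae ?_
    filter_upwards [φ.coeFn_toLp r volume, φ.coeFn_toLp 2 volume, E'.coeFn_vec g] with x h1 h2 h3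
    rw [h1, h2, h3, RCLike.inner_apply, mul_comm]; rfl
  rw [← hL, hv, ← L.integral_comp_comm hint, hr'inv]
  simp_rw [hLs, ← l2Propagator_toLp]
  have h2 := norm_inner_integral_le A (t := t) hK hπ hp E' g
    (wnorm_nonneg (1 - (r⁻¹).toReal) g) (fun {κ} _ E c ↦ h A E E' (fun i ↦ inter_subset_right) c g) f
  refine le_of_eq_of_le ?_ h2
  congr 1
  rw [← integral_inner (A.integrable_l2Propagator_coef t _), ← integral_indicator hS]
  congr 1
  funext s
  rw [hA']
  by_cases hs : s ∈ S
  · rw [indicator_of_mem hs, indicator_of_mem hs]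
  · rw [indicator_of_notMem hs, indicator_of_notMem hs]; simp

end Duhamel

/-! ### Weak-type bound for dyadic sums -/

/-- The times before `t` at a dyadic distance from `t`. -/
def pastWindow (j : ℤ) (t : ℝ) : Set ℝ := Ioc (t - 2 ^ (j + 1)) (t - 2 ^ j)

theorem mem_pastWindow {j : ℤ} {s t : ℝ} :
    s ∈ pastWindow j t ↔ t - s ∈ Ico ((2 : ℝ) ^ j) (2 ^ (j + 1)) := by
  rw [pastWindow, mem_Ioc, mem_Ico]
  constructor <;> rintro ⟨h1, h2⟩ <;> constructor <;> linarith

theorem measurableSet_pastWindow (j : ℤ) (t : ℝ) : MeasurableSet (pastWindow j t) :=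
  measurableSet_Ioc

theorem pairwise_disjoint_pastWindow (t : ℝ) :
    Pairwise (Function.onFun Disjoint fun j ↦ pastWindow j t) := by
  intro i j hij
  have h : ∀ {j s}, s ∈ pastWindow j t → t - s ∈ shell j := fun {j s} hs ↦ by
    rw [mem_pastWindow] at hs
    have h0 : 0 < t - s := lt_of_lt_of_le (by positivity) hs.1
    rw [shell, mem_ofPred_eq, abs_of_pos h0]
    exact hs
  exact Set.disjoint_left.2 fun s hi hj ↦
    Set.disjoint_left.1 (pairwise_disjoint_shell hij) (h hi) (h hj)

theorem iUnion_pastWindow (t : ℝ) : ⋃ j, pastWindow j t = Iio t := by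
  ext s
  rw [mem_iUnion, mem_Iio]
  constructor
  · rintro ⟨j, hj⟩
    have := lt_of_lt_of_le (by positivity) (mem_pastWindow.1 hj).1
    linarith
  · intro hs
    obtain ⟨j, hj⟩ := exists_mem_Ico_zpow (sub_pos.2 hs) (one_lt_two (α := ℝ))
    exact ⟨j, mem_pastWindow.2 hj⟩

/-- The sum over dyadic time windows of the local norms in `L^{1/π}`, weighted by the decay
`2^{-ja}` of the propagator. -/
def dyadicSum (a π : ℝ) (f : ℝ → ℝ≥0∞) (t : ℝ) : ℝ≥0∞ :=
  ∑' j : ℤ, ENNReal.ofReal (2 ^ (-(j * a))) * (∫⁻ s in pastWindow j t, f s ^ π⁻¹) ^ π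

theorem dyadicSum_congr_ae {a π : ℝ} {f g : ℝ → ℝ≥0∞} (h : f =ᵐ[volume] g) (t : ℝ) :
    dyadicSum a π f t = dyadicSum a π g t := by
  unfold dyadicSum
  congr 1
  funext j
  congr 2
  refine lintegral_congr_ae ?_
  filter_upwards [ae_restrict_of_ae h] with s hs
  rw [hs]

theorem dyadicSum_mono {a π : ℝ} (hπ : 0 < π) {f g : ℝ → ℝ≥0∞} (h : ∀ s, f s ≤ g s) (t : ℝ) :
    dyadicSum a π f t ≤ dyadicSum a π g t := by
  unfold dyadicSum
  gcongr with j s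
  exact h s

/-- Minkowski's inequality on each window. -/
theorem dyadicSum_add_le {a π : ℝ} (hπ : 0 < π) (hπ1 : π ≤ 1) {f g : ℝ → ℝ≥0∞}
    (hf : AEMeasurable f) (hg : AEMeasurable g) (t : ℝ) :
    dyadicSum a π (f + g) t ≤ dyadicSum a π f t + dyadicSum a π g t := by
  unfold dyadicSum
  rw [← ENNReal.tsum_add]
  refine ENNReal.tsum_le_tsum fun j ↦ ?_
  rw [← mul_add]
  gcongr
  have h := ENNReal.lintegral_Lp_add_le (μ := volume.restrict (pastWindow j t)) (p := π⁻¹)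
    hf.restrict hg.restrict ((one_le_inv₀ hπ).2 hπ1)
  simpa using h

theorem summable_two_rpow_abs {δ : ℝ} (hδ : 0 < δ) :
    Summable fun j : ℤ ↦ (2 : ℝ) ^ (-(|(j : ℝ)| * δ)) := by
  have h1 : (2 : ℝ) ^ (-δ) < 1 := Real.rpow_lt_one_of_one_lt_of_neg one_lt_two (by linarith)
  have h2 := summable_geometric_of_lt_one (by positivity) h1
  have h3 : ∀ n : ℕ, ((2 : ℝ) ^ (-δ)) ^ n = 2 ^ (-((n : ℝ) * δ)) := fun n ↦ by
    rw [← Real.rpow_natCast, ← Real.rpow_mul zero_le_two]; congr 1; ring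
  simp_rw [h3] at h2
  refine Summable.of_nat_of_neg ?_ ?_
  · simpa using h2
  · simpa using h2

theorem measurable_pastWindow_indicator {f : ℝ → ℝ≥0∞} (hf : Measurable f) (j : ℤ) :
    Measurable (Function.uncurry fun t s ↦ (pastWindow j t).indicator f s) := by
  have hm : MeasurableSet {p : ℝ × ℝ | p.1 - p.2 ∈ Ico ((2 : ℝ) ^ j) (2 ^ (j + 1))} :=
    (measurable_fst.sub measurable_snd) measurableSet_Ico
  have h1 : (Function.uncurry fun t s ↦ (pastWindow j t).indicator f s) =
      {p : ℝ × ℝ | p.1 - p.2 ∈ Ico ((2 : ℝ) ^ j) (2 ^ (j + 1))}.indicator fun p ↦ f p.2 := by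
    funext p
    simp only [Function.uncurry, indicator, mem_pastWindow, mem_ofPred_eq]
  rw [h1]
  exact (hf.comp measurable_snd).indicator hm

/-- By Tonelli's theorem, as each `s` lies in the windows of a set of times of measure `2 ^ j`. -/
theorem lintegral_lintegral_pastWindow {f : ℝ → ℝ≥0∞} (hf : Measurable f) (j : ℤ) :
    ∫⁻ t, ∫⁻ s in pastWindow j t, f s = ENNReal.ofReal (2 ^ j) * ∫⁻ s, f s := by
  simp_rw [← lintegral_indicator (measurableSet_pastWindow j _)]
  rw [lintegral_lintegral_swap (measurable_pastWindow_indicator hf j).aemeasurable,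
    ← lintegral_const_mul _ hf]
  refine lintegral_congr fun s ↦ ?_
  have h2 : ∀ t, (pastWindow j t).indicator f s =
      (Ico (s + 2 ^ j) (s + 2 ^ (j + 1))).indicator (fun _ ↦ f s) t := fun t ↦ by
    have : s ∈ pastWindow j t ↔ t ∈ Ico (s + 2 ^ j) (s + 2 ^ (j + 1)) := by
      rw [mem_pastWindow, mem_Ico, mem_Ico]
      constructor <;> rintro ⟨h1, h2⟩ <;> constructor <;> linarith
    simp only [indicator, this]
  rw [lintegral_congr h2, lintegral_indicator measurableSet_Ico, setLIntegral_const,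
    Real.volume_Ico, mul_comm]
  congr 2
  rw [zpow_add_one₀ two_ne_zero]; ring

theorem measurable_setLIntegral_pastWindow {f : ℝ → ℝ≥0∞} (hf : Measurable f) (j : ℤ) :
    Measurable fun t ↦ ∫⁻ s in pastWindow j t, f s := by
  simp_rw [← lintegral_indicator (measurableSet_pastWindow j _)]
  exact (measurable_pastWindow_indicator hf j).lintegral_prod_right'

/-- The dyadic sum maps `L^{1/π}` to weak `L^{1/a}`: the terms with `j` large are bounded pointwise,
the others in `L^{1/π}`, and the threshold `J` balances the two. A geometric factor is gained on
either side of `J`, because `0 < a < π`. -/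
theorem exists_weak_dyadicSum_le {a π : ℝ} (ha : 0 < a) (haπ : a < π) :
    ∃ C : ℝ≥0, ∀ f : ℝ → ℝ≥0∞, Measurable f → ∀ l : ℝ≥0,
      (l : ℝ≥0∞) * volume {t | (l : ℝ≥0∞) < dyadicSum a π f t} ^ a ≤
        C * (∫⁻ s, f s ^ π⁻¹) ^ π := by
  have hπ : 0 < π := ha.trans haπ
  -- the thresholds `c j` below decay at the rate `δ ≤ a`, so that they are met for `j > J`; for
  -- `j ≤ J` this rate is paid from `π - a`, and the rate `β` remains
  set δ := min a (π - a) / 2 with hδ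
  have hm1 := min_le_left a (π - a)
  have hm2 := min_le_right a (π - a)
  have hm3 : 0 < min a (π - a) := lt_min ha (by linarith)
  have hδ0 : 0 < δ := by positivity
  have hδa : δ ≤ a := by linarith
  set β := (π - a - δ) / π with hβ
  have hβ0 : 0 < β := div_pos (by linarith) hπ
  have hS := summable_two_rpow_abs hδ0
  have hS' := summable_two_rpow_abs hβ0
  set S := ∑' j : ℤ, (2 : ℝ) ^ (-(|(j : ℝ)| * δ)) with hSd
  set S' := ∑' j : ℤ, (2 : ℝ) ^ (-(|(j : ℝ)| * β)) with hSd'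
  have hS0 : 0 < S := hS.tsum_pos (fun _ ↦ by positivity) 0 (by positivity)
  have hS0' : 0 < S' := hS'.tsum_pos (fun _ ↦ by positivity) 0 (by positivity)
  refine ⟨((2 * S') ^ a * S).toNNReal, fun f hf l ↦ ?_⟩
  have hfm : Measurable fun s ↦ f s ^ π⁻¹ := hf.pow_const _
  have hCpos : 0 < (2 * S') ^ a * S := by positivity
  change _ ≤ ENNReal.ofReal ((2 * S') ^ a * S) * _
  set N := (∫⁻ s, f s ^ π⁻¹) ^ π with hN
  rcases eq_or_ne l 0 with rfl | hl
  · simp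
  have hl0 : 0 < (l : ℝ) := by exact_mod_cast pos_iff_ne_zero.2 hl
  rcases eq_or_ne N ∞ with hNt | hNt
  · rw [hNt, ENNReal.mul_top (by simpa using hCpos)]; exact le_top
  have hwin : ∀ j t, (∫⁻ s in pastWindow j t, f s ^ π⁻¹) ^ π ≤ N := fun j t ↦
    ENNReal.rpow_le_rpow (setLIntegral_le_lintegral _ _) hπ.le
  rcases eq_or_ne N 0 with hN0 | hN0
  · have : ∀ t, dyadicSum a π f t = 0 := fun t ↦ by
      refine ENNReal.tsum_eq_zero.2 fun j ↦ ?_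
      rw [le_zero_iff.1 ((hwin j t).trans hN0.le), mul_zero]
    simp [this, ha]
  obtain ⟨n, hn0, hNn⟩ : ∃ n : ℝ, 0 < n ∧ N = ENNReal.ofReal n :=
    ⟨N.toReal, ENNReal.toReal_pos hN0 hNt, (ENNReal.ofReal_toReal hNt).symm⟩
  have hle : (l : ℝ≥0∞) = ENNReal.ofReal l := by simp
  set X := n * S / l with hX
  have hX0 : 0 < X := by positivity
  obtain ⟨J', hJ1, hJ2⟩ := exists_mem_Ioc_zpow (Real.rpow_pos_of_pos hX0 a⁻¹)
    (one_lt_two (α := ℝ))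
  set J := J' + 1 with hJ
  -- the threshold `J` satisfies `X ≤ 2 ^ (J a)` and `2 ^ J ≤ 2 X ^ (1 / a)`
  have hJX : X ≤ 2 ^ (J * a) := by
    rw [← Real.rpow_intCast] at hJ2
    have := Real.rpow_le_rpow (by positivity) hJ2 ha.le
    rwa [← Real.rpow_mul hX0.le, inv_mul_cancel₀ ha.ne', Real.rpow_one,
      ← Real.rpow_mul zero_le_two] at this
  have hJX' : (2 : ℝ) ^ (J : ℝ) ≤ 2 * X ^ a⁻¹ := by
    rw [Real.rpow_intCast, hJ, zpow_add_one₀ two_ne_zero]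
    linarith
  let b : ℤ → ℝ → ℝ≥0∞ := fun j t ↦
    ENNReal.ofReal (2 ^ (-(j * a))) * (∫⁻ s in pastWindow j t, f s ^ π⁻¹) ^ π
  -- thresholds with sum `l`: if `l` is exceeded by the sum, some term exceeds its threshold
  let c : ℤ → ℝ := fun j ↦ l / S * 2 ^ (-(|(j : ℝ) - J| * δ))
  have hc0 : ∀ j, 0 < c j := fun j ↦ by positivity
  have hcsum : ∑' j, ENNReal.ofReal (c j) = l := by
    have h1 : Summable fun j : ℤ ↦ (2 : ℝ) ^ (-(|(j : ℝ) - J| * δ)) := by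
      have := (Equiv.subRight J).summable_iff.2 hS
      simpa [Function.comp_def] using this
    have h2 : ∑' j : ℤ, (2 : ℝ) ^ (-(|(j : ℝ) - J| * δ)) = S := by
      have := (Equiv.subRight J).tsum_eq fun j : ℤ ↦ (2 : ℝ) ^ (-(|(j : ℝ)| * δ))
      simpa using this
    rw [← ENNReal.ofReal_tsum_of_nonneg (fun j ↦ (hc0 j).le) (h1.mul_left _), tsum_mul_left, h2,
      div_mul_cancel₀ _ hS0.ne', hle]
  have hbig : ∀ j, J < j → ∀ t, b j t ≤ ENNReal.ofReal (c j) := by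
    intro j hj t
    have hj' : (0 : ℝ) < j - J := by
      have : (J : ℝ) < j := by exact_mod_cast hj
      linarith
    refine (mul_le_mul_right (hwin j t) _).trans ?_
    rw [hNn, ← ENNReal.ofReal_mul (by positivity)]
    apply ENNReal.ofReal_le_ofReal
    have h1 : n = X * (l / S) := by rw [hX]; field_simp
    calc (2 : ℝ) ^ (-(j * a)) * n = l / S * (2 ^ (-(j * a)) * X) := by
          nth_rewrite 1 [h1]; ring
      _ ≤ l / S * (2 ^ (-(j * a)) * 2 ^ (J * a)) := by gcongr
      _ = l / S * 2 ^ (-((j - J) * a)) := by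
          rw [← Real.rpow_add two_pos]; congr 2; ring
      _ ≤ c j := by
          simp only [c]
          rw [abs_of_pos hj']
          gcongr
          exact one_le_two
  have hsub : {t | (l : ℝ≥0∞) < dyadicSum a π f t} ⊆
      ⋃ j, {t | j ≤ J ∧ ENNReal.ofReal (c j) ≤ b j t} := by
    intro t ht
    by_contra hnot
    simp only [mem_iUnion, mem_ofPred_eq, not_exists, not_and, not_le] at hnot
    refine absurd (show (l : ℝ≥0∞) < dyadicSum a π f t from ht) (not_lt.2 ?_)
    rw [← hcsum]
    refine ENNReal.tsum_le_tsum fun j ↦ ?_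
    rcases le_or_gt j J with hj | hj
    · exact (hnot j hj).le
    · exact hbig j hj t
  -- Chebyshev's inequality for the term `j ≤ J`
  have hmeas : ∀ j, volume {t | j ≤ J ∧ ENNReal.ofReal (c j) ≤ b j t} ≤
      ENNReal.ofReal (2 * X ^ a⁻¹ * 2 ^ (-(|(j : ℝ) - J| * β))) := by
    intro j
    by_cases hj : j ≤ J
    swap
    · simp [hj]
    have hj' : (0 : ℝ) ≤ J - j := by
      have : (j : ℝ) ≤ J := by exact_mod_cast hj
      linarith
    have hset : {t | j ≤ J ∧ ENNReal.ofReal (c j) ≤ b j t} ⊆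
        {t | ENNReal.ofReal (c j) ^ π⁻¹ ≤ b j t ^ π⁻¹} := fun t ht ↦
      ENNReal.rpow_le_rpow ht.2 (by positivity)
    refine (measure_mono hset).trans ?_
    have hbm : Measurable fun t ↦ b j t ^ π⁻¹ :=
      (((measurable_setLIntegral_pastWindow hfm j).pow_const _).const_mul _).pow_const _
    have hcp : ENNReal.ofReal (c j) ^ π⁻¹ = ENNReal.ofReal (c j ^ π⁻¹) :=
      ENNReal.ofReal_rpow_of_pos (hc0 j)
    have hch := meas_ge_le_lintegral_div (μ := volume) hbm.aemeasurable
      (ε := ENNReal.ofReal (c j) ^ π⁻¹) (by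
        rw [hcp]; simpa using Real.rpow_pos_of_pos (hc0 j) _) (by rw [hcp]; simp)
    refine hch.trans ?_
    have hint : ∫⁻ t, b j t ^ π⁻¹ =
        ENNReal.ofReal ((2 ^ (-(j * a))) ^ π⁻¹ * (2 ^ j * n ^ π⁻¹)) := by
      have h1 : ∀ t, b j t ^ π⁻¹ = ENNReal.ofReal ((2 ^ (-(j * a))) ^ π⁻¹) *
          ∫⁻ s in pastWindow j t, f s ^ π⁻¹ := by
        intro t
        rw [ENNReal.mul_rpow_of_nonneg _ _ (by positivity), ← ENNReal.rpow_mul,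
          mul_inv_cancel₀ hπ.ne', ENNReal.rpow_one,
          ENNReal.ofReal_rpow_of_nonneg (by positivity) (by positivity)]
      have h2 : ∫⁻ s, f s ^ π⁻¹ = ENNReal.ofReal (n ^ π⁻¹) := by
        rw [← ENNReal.ofReal_rpow_of_pos hn0, ← hNn, hN, ← ENNReal.rpow_mul,
          mul_inv_cancel₀ hπ.ne', ENNReal.rpow_one]
      rw [lintegral_congr h1, lintegral_const_mul _ (measurable_setLIntegral_pastWindow hfm j),
        lintegral_lintegral_pastWindow hfm, h2, ← ENNReal.ofReal_mul (by positivity),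
        ← ENNReal.ofReal_mul (by positivity)]
    rw [hint, hcp, ← ENNReal.ofReal_div_of_pos (Real.rpow_pos_of_pos (hc0 j) _)]
    apply ENNReal.ofReal_le_ofReal
    have e1 : c j ^ π⁻¹ = (l / S) ^ π⁻¹ * 2 ^ (-((J - j) * δ / π)) := by
      simp only [c]
      rw [Real.mul_rpow (by positivity) (by positivity), ← Real.rpow_mul zero_le_two,
        abs_sub_comm, abs_of_nonneg hj']
      congr 2
      field_simp
    have e2 : ((2 : ℝ) ^ (-(j * a))) ^ π⁻¹ = 2 ^ (-(j * a / π)) := by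
      rw [← Real.rpow_mul zero_le_two]; congr 1; field_simp
    have e3 : n ^ π⁻¹ = X ^ π⁻¹ * (l / S) ^ π⁻¹ := by
      rw [← Real.mul_rpow (by positivity) (by positivity)]
      congr 1; rw [hX]; field_simp
    have e4 : (2 : ℝ) ^ j = 2 ^ (j : ℝ) := (Real.rpow_intCast 2 j).symm
    have e5 : (2 : ℝ) ^ (-(j * a / π)) * 2 ^ (j : ℝ) =
        2 ^ (-((J - j) * δ / π)) * (2 ^ (J * (1 - a / π)) * 2 ^ (-(|(j : ℝ) - J| * β))) := by
      rw [← Real.rpow_add two_pos, ← Real.rpow_add two_pos, ← Real.rpow_add two_pos,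
        abs_sub_comm, abs_of_nonneg hj', hβ]
      congr 1
      field_simp
      ring
    rw [div_le_iff₀ (Real.rpow_pos_of_pos (hc0 j) _), e1, e2, e3, e4]
    have hexp : 0 ≤ 1 - a / π := by rw [sub_nonneg, div_le_one hπ]; exact haπ.le
    have e6 : (2 : ℝ) ^ (J * (1 - a / π)) ≤ 2 * X ^ (a⁻¹ - π⁻¹) := by
      rw [Real.rpow_mul zero_le_two]
      refine (Real.rpow_le_rpow (by positivity) hJX' hexp).trans ?_
      rw [Real.mul_rpow zero_le_two (by positivity), ← Real.rpow_mul hX0.le]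
      have h2 : (2 : ℝ) ^ (1 - a / π) ≤ 2 := by
        have : 0 < a / π := by positivity
        simpa using Real.rpow_le_rpow_of_exponent_le (x := 2) (by norm_num)
          (show 1 - a / π ≤ 1 by linarith)
      have h3 : a⁻¹ * (1 - a / π) = a⁻¹ - π⁻¹ := by field_simp
      rw [h3]
      gcongr
    have e7 : X ^ a⁻¹ = X ^ (a⁻¹ - π⁻¹) * X ^ π⁻¹ := by
      rw [← Real.rpow_add hX0]; congr 1; ring
    calc _ = (2 : ℝ) ^ (-(j * a / π)) * 2 ^ (j : ℝ) * (X ^ π⁻¹ * (l / S) ^ π⁻¹) := by ring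
      _ = 2 ^ (J * (1 - a / π)) * (2 ^ (-((J - j) * δ / π)) * 2 ^ (-(|(j : ℝ) - J| * β)) *
          (X ^ π⁻¹ * (l / S) ^ π⁻¹)) := by rw [e5]; ring
      _ ≤ 2 * X ^ (a⁻¹ - π⁻¹) * (2 ^ (-((J - j) * δ / π)) * 2 ^ (-(|(j : ℝ) - J| * β)) *
          (X ^ π⁻¹ * (l / S) ^ π⁻¹)) := by gcongr
      _ = _ := by rw [e7]; ring
  have hfin : volume {t | (l : ℝ≥0∞) < dyadicSum a π f t} ≤
      ENNReal.ofReal (2 * S' * X ^ a⁻¹) := by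
    refine (measure_mono hsub).trans ((measure_iUnion_le _).trans
      ((ENNReal.tsum_le_tsum hmeas).trans (le_of_eq ?_)))
    have h1 : Summable fun j : ℤ ↦ (2 : ℝ) ^ (-(|(j : ℝ) - J| * β)) := by
      have := (Equiv.subRight J).summable_iff.2 hS'
      simpa [Function.comp_def] using this
    have h2 : ∑' j : ℤ, (2 : ℝ) ^ (-(|(j : ℝ) - J| * β)) = S' := by
      have := (Equiv.subRight J).tsum_eq fun j : ℤ ↦ (2 : ℝ) ^ (-(|(j : ℝ)| * β))
      simpa using this
    rw [← ENNReal.ofReal_tsum_of_nonneg (fun j ↦ by positivity) (h1.mul_left _), tsum_mul_left, h2]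
    congr 1; ring
  calc _ ≤ (l : ℝ≥0∞) * ENNReal.ofReal (2 * S' * X ^ a⁻¹) ^ a := by gcongr
    _ = ENNReal.ofReal (l * ((2 * S') ^ a * X)) := by
        rw [ENNReal.ofReal_rpow_of_nonneg (by positivity) ha.le,
          Real.mul_rpow (by positivity) (by positivity), ← Real.rpow_mul hX0.le,
          inv_mul_cancel₀ ha.ne', Real.rpow_one, hle, ← ENNReal.ofReal_mul (NNReal.coe_nonneg l)]
    _ = _ := by
        rw [hNn, ← ENNReal.ofReal_mul hCpos.le]
        congr 1
        rw [hX]; field_simp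

/-! ### Weak Lebesgue spaces -/

/-- Monotonicity of the weak norm. The hypothesis `C ≠ 0` allows the levels to be divided by `C`. -/
theorem eWeakLpNorm_le_of_ae_le {α M : Type*} [MeasurableSpace α] {μ : Measure α}
    [NormedAddCommGroup M] {u : α → M} {h : α → ℝ≥0∞} {C : ℝ≥0} (hC : C ≠ 0) (q : ℝ≥0∞)
    (hu : ∀ᵐ x ∂μ, ‖u x‖ₑ ≤ C * h x) :
    eWeakLpNorm u q μ ≤ C * eWeakLpNorm h q μ := by
  unfold eWeakLpNorm
  split_ifs with hq
  · refine eLpNormEssSup_le_of_ae_enorm_bound ?_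
    filter_upwards [hu, ae_le_eLpNormEssSup (f := h) (μ := μ)] with x h1 h2
    exact h1.trans (mul_le_mul_right h2 _)
  · refine iSup_le fun c ↦ ?_
    refine le_trans ?_ (mul_le_mul_right (le_iSup (fun c : ℝ≥0 ↦
      (c : ℝ≥0∞) * μ {x | (c : ℝ≥0∞) < ‖h x‖ₑ} ^ (1 / q.toReal)) (c / C)) _)
    have hC' : (C : ℝ≥0∞) ≠ 0 := by exact_mod_cast hC
    have e1 : (c : ℝ≥0∞) = C * ((c / C : ℝ≥0) : ℝ≥0∞) := by
      rw [← ENNReal.coe_mul, mul_div_cancel₀ _ hC]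
    rw [← mul_assoc, ← e1]
    have hle : {x | (c : ℝ≥0∞) < ‖u x‖ₑ} ≤ᵐ[μ] {x | ((c / C : ℝ≥0) : ℝ≥0∞) < ‖h x‖ₑ} := by
      filter_upwards [hu] with x hx hcx
      have h1 : (c : ℝ≥0∞) < C * h x := lt_of_lt_of_le hcx hx
      rw [e1] at h1
      exact (ENNReal.mul_lt_mul_iff_right hC' ENNReal.coe_ne_top).1 h1
    exact mul_le_mul_right (ENNReal.rpow_le_rpow (measure_mono_ae hle) (by positivity)) _

/-- A sequence that is geometrically small in a weak Lebesgue space tends to zero almost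
everywhere, by the Borel–Cantelli lemma. -/
theorem ae_tendsto_zero_of_eWeakLpNorm_le {α : Type*} [MeasurableSpace α] {μ : Measure α}
    {h : ℕ → α → ℝ≥0∞} {q : ℝ≥0∞} (hq : 1 ≤ q) {C : ℝ≥0}
    (hh : ∀ n, eWeakLpNorm (h n) q μ ≤ C * ENNReal.ofReal ((1 / 4) ^ n)) :
    ∀ᵐ x ∂μ, Filter.Tendsto (fun n ↦ h n x) Filter.atTop (nhds 0) := by
  have hgeom : ∀ (K a : ℝ), 0 ≤ a → a < 1 →
      Filter.Tendsto (fun n : ℕ ↦ ENNReal.ofReal (K * a ^ n)) Filter.atTop (nhds 0) := by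
    intro K a ha0 ha1
    have := ENNReal.tendsto_ofReal ((tendsto_pow_atTop_nhds_zero_of_lt_one ha0 ha1).const_mul K)
    simpa using this
  rcases eq_or_ne q ∞ with rfl | hqt
  · have h1 : ∀ᵐ x ∂μ, ∀ n, h n x ≤ C * ENNReal.ofReal ((1 / 4) ^ n) := by
      refine ae_all_iff.2 fun n ↦ ?_
      have h2 := hh n
      rw [eWeakLpNorm, if_pos rfl] at h2
      filter_upwards [ae_le_eLpNormEssSup (f := h n) (μ := μ)] with x hx
      exact hx.trans h2
    filter_upwards [h1] with x hx
    have h3 := hgeom C (1 / 4) (by norm_num) (by norm_num)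
    refine tendsto_of_tendsto_of_tendsto_of_le_of_le tendsto_const_nhds h3 (fun _ ↦ zero_le)
      fun n ↦ (hx n).trans (le_of_eq ?_)
    rw [ENNReal.ofReal_mul (NNReal.coe_nonneg C), ENNReal.ofReal_coe_nnreal]
  · set p := q.toReal with hp
    have hp1 : 1 ≤ p := by simpa [hp] using ENNReal.toReal_mono hqt hq
    have hp0 : 0 < p := by linarith
    let s : ℕ → Set α := fun n ↦ {x | ENNReal.ofReal ((1 / 2) ^ n) < h n x}
    have hs : ∀ n, μ (s n) ≤ ENNReal.ofReal ((C : ℝ) ^ p * ((1 / 2) ^ p) ^ n) := by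
      intro n
      have h2 := hh n
      rw [eWeakLpNorm, if_neg hqt] at h2
      have h3 := (le_iSup (fun c : ℝ≥0 ↦ (c : ℝ≥0∞) * μ {x | (c : ℝ≥0∞) < ‖h n x‖ₑ} ^ (1 / p))
        ((1 / 2 : ℝ) ^ n).toNNReal).trans h2
      change ENNReal.ofReal ((1 / 2) ^ n) * μ (s n) ^ (1 / p) ≤ _ at h3
      have h4 : μ (s n) ^ (1 / p) ≤ ENNReal.ofReal (C * (1 / 2) ^ n) := by
        have e1 : (C : ℝ≥0∞) * ENNReal.ofReal ((1 / 4) ^ n) =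
            ENNReal.ofReal ((1 / 2) ^ n) * ENNReal.ofReal (C * (1 / 2) ^ n) := by
          rw [← ENNReal.ofReal_mul (by positivity), ← ENNReal.ofReal_coe_nnreal,
            ← ENNReal.ofReal_mul (NNReal.coe_nonneg C)]
          congr 1
          rw [show (1 / 4 : ℝ) = 1 / 2 * (1 / 2) by norm_num, mul_pow]; ring
        rw [e1] at h3
        refine (ENNReal.mul_le_mul_iff_right ?_ ENNReal.ofReal_ne_top).1 h3
        simp
      have h5 := ENNReal.rpow_le_rpow h4 hp0.le
      rw [← ENNReal.rpow_mul, one_div_mul_cancel hp0.ne', ENNReal.rpow_one,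
        ENNReal.ofReal_rpow_of_nonneg (by positivity) hp0.le] at h5
      refine h5.trans (le_of_eq ?_)
      congr 1
      rw [Real.mul_rpow (NNReal.coe_nonneg C) (by positivity), ← Real.rpow_natCast,
        ← Real.rpow_natCast, ← Real.rpow_mul (by norm_num), ← Real.rpow_mul (by norm_num), mul_comm p]
    have ha1 : ((1 : ℝ) / 2) ^ p < 1 := Real.rpow_lt_one (by norm_num) (by norm_num) hp0
    have hsum : ∑' n, μ (s n) ≠ ∞ := by
      refine ne_top_of_le_ne_top ?_ (ENNReal.tsum_le_tsum hs)
      rw [← ENNReal.ofReal_tsum_of_nonneg (fun n ↦ by positivity)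
        ((summable_geometric_of_lt_one (by positivity) ha1).mul_left _)]
      exact ENNReal.ofReal_ne_top
    filter_upwards [ae_eventually_notMem hsum] with x hx
    have h3 := hgeom 1 (1 / 2) (by norm_num) (by norm_num)
    refine tendsto_of_tendsto_of_tendsto_of_le_of_le' tendsto_const_nhds h3
      (Filter.Eventually.of_forall fun _ ↦ zero_le) ?_
    filter_upwards [hx] with n hn
    rw [one_mul]
    exact not_lt.1 hn

/-- The operator that controls the norm of the Duhamel integral: `dyadicSum a π` when there is
decay, and the norm of `L^{1/π}`, constant in `t`, when there is none (`q = ∞`). -/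
def duhamelControl (a π : ℝ) (f : ℝ → ℝ≥0∞) (t : ℝ) : ℝ≥0∞ :=
  if a = 0 then (∫⁻ s, f s ^ π⁻¹) ^ π else dyadicSum a π f t

theorem duhamelControl_congr_ae {a π : ℝ} {f g : ℝ → ℝ≥0∞} (h : f =ᵐ[volume] g) (t : ℝ) :
    duhamelControl a π f t = duhamelControl a π g t := by
  unfold duhamelControl
  rw [dyadicSum_congr_ae h]
  congr 2
  refine lintegral_congr_ae ?_
  filter_upwards [h] with s hs
  rw [hs]

theorem duhamelControl_le_add {a π : ℝ} (hπ : 0 < π) (hπ1 : π ≤ 1) {f g h : ℝ → ℝ≥0∞}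
    (hf : AEMeasurable f) (hg : AEMeasurable g) (hle : ∀ s, h s ≤ f s + g s) (t : ℝ) :
    duhamelControl a π h t ≤ duhamelControl a π f t + duhamelControl a π g t := by
  unfold duhamelControl
  split_ifs
  · have h1 := ENNReal.lintegral_Lp_add_le (μ := volume) (p := π⁻¹) hf hg
      ((one_le_inv₀ hπ).2 hπ1)
    simp only [one_div, inv_inv] at h1
    refine le_trans ?_ h1
    gcongr with s
    exact hle s
  · exact (dyadicSum_mono hπ hle t).trans (dyadicSum_add_le hπ hπ1 hf hg t)

theorem exists_eWeakLpNorm_duhamelControl_le {q : ℝ≥0∞} (hq : 1 ≤ q) {π : ℝ}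
    (haπ : (q⁻¹).toReal < π) :
    ∃ C : ℝ≥0, ∀ f : ℝ → ℝ≥0∞, AEMeasurable f →
      eWeakLpNorm (duhamelControl (q⁻¹).toReal π f) q volume ≤ C * (∫⁻ s, f s ^ π⁻¹) ^ π := by
  have hq0 : q ≠ 0 := (zero_lt_one.trans_le hq).ne'
  rcases eq_or_ne q ∞ with rfl | hqt
  · refine ⟨1, fun f _ ↦ ?_⟩
    rw [eWeakLpNorm, if_pos rfl]
    refine eLpNormEssSup_le_of_ae_enorm_bound (Filter.Eventually.of_forall fun t ↦ ?_)
    simp [duhamelControl]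
  · have ha : 0 < (q⁻¹).toReal := ENNReal.toReal_pos (by simpa) (by simpa)
    obtain ⟨C, hC⟩ := exists_weak_dyadicSum_le ha haπ
    refine ⟨C, fun f hf ↦ ?_⟩
    rw [eWeakLpNorm, if_neg hqt]
    refine iSup_le fun c ↦ ?_
    have h1 : ∀ t, ‖duhamelControl (q⁻¹).toReal π f t‖ₑ =
        dyadicSum (q⁻¹).toReal π (hf.mk f) t := fun t ↦ by
      rw [duhamelControl_congr_ae hf.ae_eq_mk, duhamelControl, if_neg ha.ne']; rfl
    have h2 : ∫⁻ s, f s ^ π⁻¹ = ∫⁻ s, hf.mk f s ^ π⁻¹ := by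
      refine lintegral_congr_ae ?_
      filter_upwards [hf.ae_eq_mk] with s hs
      rw [hs]
    simp_rw [h1]
    rw [h2, one_div, ← ENNReal.toReal_inv]
    exact hC _ hf.measurable_mk c

/-! ### The Duhamel integral of step functions -/

section Duhamel

open FinFamily

variable {d : ℕ} {r p : ℝ≥0∞} [Fact (1 ≤ r)] [Fact (1 ≤ p)]

/-- The Duhamel integral of a step function in time with values in the Schwartz space. -/
def stepDuhamel (r : ℝ≥0∞) [Fact (1 ≤ r)] (G : SimpleFunc ℝ 𝓢(Rd d, ℂ)) (t : ℝ) :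
    Lp ℂ r (volume : Measure (Rd d)) :=
  ∫ s in Iio t, (schwartzPropagator d (t - s) (G s)).toLp r volume

/-- The part of the Duhamel integral over each dyadic window of the past is estimated on its own,
and the estimates are summed. -/
theorem exists_enorm_stepDuhamel_le (hd : d ≠ 0) (hr : 2 ≤ r) (hp : p ≠ ∞) {ρ ρt : ℝ}
    (hρ : (r⁻¹).toReal = ρ) (hρt : (p⁻¹).toReal = 1 - ρt) (hρt0 : 0 ≤ ρt) (hle : ρt ≤ ρ)
    (h : d * (ρ - ρt) ≤ 2 * ρ) (h' : d * (ρ - ρt) = 2 * ρ → 0 < ρ → 0 < ρt)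
    (hπ : 0 < 1 - d / 2 * (ρ - ρt)) :
    ∃ C : ℝ≥0, ∀ (G : SimpleFunc ℝ 𝓢(Rd d, ℂ)), G.FinMeasSupp volume → ∀ t,
      ‖stepDuhamel r G t‖ₑ ≤ C * duhamelControl (d * (1 / 2 - ρ)) (1 - d / 2 * (ρ - ρt))
          (fun s ↦ ‖(G s).toLp p volume‖ₑ) t := by
  have hd0 : (0 : ℝ) < d := by exact_mod_cast Nat.pos_of_ne_zero hd
  have hρ2 : ρ ≤ 1 / 2 := by linarith [two_mul_inv_toReal_le_one hr]
  rcases hρ2.eq_or_lt with hρ2' | hρ2'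
  · subst hρ2'
    have hγ : d * (1 / 2 - ρt) < 1 ∨ d * (1 / 2 - ρt) = 1 ∧ 0 < ρt := by
      rcases h.eq_or_lt with he | hlt
      · exact Or.inr ⟨by linarith, h' he (by norm_num)⟩
      · exact Or.inl (by linarith)
    obtain ⟨C, hC, hS⟩ := exists_norm_evolve_le hd ⟨hρt0, hle⟩ hγ
    refine ⟨C.toNNReal, fun G hG t ↦ ?_⟩
    rw [duhamelControl, if_pos (by simp)]
    refine (enorm_setIntegral_schwartzPropagator_le hr hp measurableSet_Iio (t := t) hC hπ
      (fun {I κ κ'} _ _ _ A E E' _ c g ↦ ?_) G hG).trans ?_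
    · rw [hρ, hρt]
      refine (norm_inner_le_norm _ _).trans ?_
      have h1 := hS A E t c
      rw [show d * (1 / 2 - ρt) / 2 = d / 2 * (1 / 2 - ρt) by ring] at h1
      rw [norm_vec, mul_comm, show (1 : ℝ) - 1 / 2 = 1 / 2 by norm_num]
      exact mul_le_mul_of_nonneg_right h1 (wnorm_nonneg _ _)
    · gcongr
      · exact le_rfl
      · exact Measure.restrict_le_self
  · obtain ⟨C, hC, hS⟩ := exists_norm_inner_evolve_le hd hρ2 hρt0 hle h h'
    refine ⟨C.toNNReal, fun G hG t ↦ ?_⟩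
    have ha : (d : ℝ) * (1 / 2 - ρ) ≠ 0 := (mul_pos hd0 (by linarith)).ne'
    rw [duhamelControl, if_neg ha]
    have hint := (integrable_schwartzPropagator_toLp hr G hG t).integrableOn
      (s := ⋃ j, pastWindow j t)
    have hsum := hasSum_integral_iUnion (fun j ↦ measurableSet_pastWindow j t)
      (pairwise_disjoint_pastWindow t) hint
    rw [iUnion_pastWindow] at hsum
    rw [stepDuhamel, ← hsum.tsum_eq, dyadicSum, ← ENNReal.tsum_mul_left]
    refine enorm_tsum_le_tsum_enorm.trans (ENNReal.tsum_le_tsum fun j ↦ ?_)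
    have h2 : (0 : ℝ) < 2 ^ j := by positivity
    refine (enorm_setIntegral_schwartzPropagator_le hr hp (measurableSet_pastWindow j t) (t := t)
      (K := C * ((2 : ℝ) ^ j) ^ (-(d * (1 / 2 - ρ)))) (by positivity) hπ
      (fun {I κ κ'} _ _ _ A E E' hA c g ↦ ?_) G hG).trans (le_of_eq ?_)
    · rw [hρ, hρt]
      refine hS A E E' h2 (fun i s hs ↦ ?_) c g
      have := (mem_pastWindow.1 (hA i hs)).1
      exact this.trans (le_abs_self _)
    · rw [ENNReal.ofReal_mul hC, mul_assoc]
      congr 3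
      rw [← Real.rpow_intCast, ← Real.rpow_mul (by norm_num), mul_neg]

/-- The Duhamel integral of a step function is measurable in `t`, being the integral in `s` of a
jointly measurable function. -/
theorem aestronglyMeasurable_stepDuhamel (hr : 2 ≤ r) (G : SimpleFunc ℝ 𝓢(Rd d, ℂ)) :
    AEStronglyMeasurable (stepDuhamel r G) volume := by
  classical
  have h1 : stepDuhamel r G = fun t ↦
      ∫ s, ({x : ℝ × ℝ | x.2 < x.1}.indicator fun x ↦
        (schwartzPropagator d (x.1 - x.2) (G x.2)).toLp r volume) (t, s) := by
    funext t
    rw [stepDuhamel, ← integral_indicator measurableSet_Iio]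
    rfl
  rw [h1]
  refine (StronglyMeasurable.integral_prod_right' (ν := volume) (f := {x : ℝ × ℝ | x.2 < x.1}.indicator
    fun x ↦ (schwartzPropagator d (x.1 - x.2) (G x.2)).toLp r volume) ?_).aestronglyMeasurable
  refine StronglyMeasurable.indicator ?_ (measurableSet_lt measurable_snd measurable_fst)
  have h2 : (fun x : ℝ × ℝ ↦ (schwartzPropagator d (x.1 - x.2) (G x.2)).toLp r volume) =
      fun x ↦ ∑ φ ∈ G.range, (Prod.snd ⁻¹' (G ⁻¹' {φ})).indicator
        (fun x : ℝ × ℝ ↦ (schwartzPropagator d (x.1 - x.2) φ).toLp r volume) x := by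
    funext x
    rw [Finset.sum_eq_single (G x.2)]
    · rw [indicator_of_mem (by simp)]
    · intro φ _ hφ
      rw [indicator_of_notMem (by simpa using hφ.symm)]
    · intro h; exact absurd (G.mem_range_self _) h
  rw [h2]
  refine Finset.stronglyMeasurable_fun_sum _ fun φ _ ↦ StronglyMeasurable.indicator ?_ ?_
  · exact ((continuous_schwartzPropagator_toLp φ hr).comp
      (continuous_fst.sub continuous_snd)).stronglyMeasurable
  · exact measurable_snd (G.measurableSet_fiber _)

/-- Step functions in time with values in the Schwartz space approximate functions with values in
a Lebesgue space. -/
theorem exists_simpleFunc_schwartz_approx (hp : p ≠ ∞) {q : ℝ≥0∞} (hq0 : 1 ≤ q) (hq : q ≠ ∞)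
    {F : ℝ → Lp ℂ p (volume : Measure (Rd d))} (hF : MemLp F q volume) {ε : ℝ≥0∞} (hε : ε ≠ 0) :
    ∃ G : SimpleFunc ℝ 𝓢(Rd d, ℂ), G.FinMeasSupp volume ∧
      eLpNorm (fun s ↦ (G s).toLp p volume - F s) q volume ≤ ε := by
  classical
  have hε2 : ε / 2 ≠ 0 := (ENNReal.half_pos hε).ne'
  obtain ⟨g, hg, hgm⟩ := hF.exists_simpleFunc_eLpNorm_sub_lt hq hε2
  have hfin : g.FinMeasSupp volume := (SimpleFunc.memLp_iff_finMeasSupp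
    (zero_lt_one.trans_le hq0).ne' hq).1 hgm
  obtain ⟨δ, hδ, hδ'⟩ := ENNReal.exists_nnreal_pos_mul_lt
    (a := volume (Function.support g) ^ q.toReal⁻¹) (b := ε / 2)
    (ENNReal.rpow_ne_top_of_nonneg (by positivity) hfin.ne) hε2
  have happ : ∀ x : Lp ℂ p (volume : Measure (Rd d)), ∃ φ : 𝓢(Rd d, ℂ),
      ‖φ.toLp p volume - x‖ ≤ δ ∧ (x = 0 → φ = 0) := by
    intro x
    by_cases hx : x = 0
    · subst hx
      refine ⟨0, ?_, fun _ ↦ rfl⟩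
      have : (0 : 𝓢(Rd d, ℂ)).toLp p volume = 0 := map_zero (SchwartzMap.toLpCLM ℂ ℂ p volume)
      rw [this, sub_zero, norm_zero]; positivity
    · obtain ⟨φ, hφ⟩ := (SchwartzMap.denseRange_toLpCLM (E := Rd d) (F := ℂ) (p := p)
        (μ := volume) hp).exists_dist_lt x (ε := δ) (by exact_mod_cast hδ)
      refine ⟨φ, ?_, fun h ↦ absurd h hx⟩
      rw [dist_comm, dist_eq_norm] at hφ
      exact hφ.le
  choose φ hφ hφ0 using happ
  refine ⟨g.map φ, hfin.map (hφ0 0 rfl), ?_⟩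
  have hG0 : ∀ s, g s = 0 → (φ (g s)).toLp p volume - g s = 0 := by
    intro s hs
    rw [hφ0 _ hs, hs, sub_zero]
    exact map_zero (SchwartzMap.toLpCLM ℂ ℂ p volume)
  have h1 : eLpNorm (fun s ↦ (φ (g s)).toLp p volume - g s) q volume ≤ ε / 2 := by
    refine le_trans ?_ hδ'.le
    calc _ ≤ eLpNorm ((Function.support g).indicator fun _ ↦ (δ : ℝ)) q volume := by
          refine eLpNorm_mono fun s ↦ ?_
          by_cases hs : g s = 0
          · rw [hG0 s hs, norm_zero]; positivity
          · rw [indicator_of_mem (by exact hs), Real.norm_of_nonneg (NNReal.coe_nonneg δ)]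
            exact hφ _
      _ ≤ _ := by
          refine (eLpNorm_indicator_const_le _ _).trans (le_of_eq ?_)
          rw [one_div]
          simp
  have h2 : (fun s ↦ ((g.map φ) s).toLp p volume - F s) =
      (fun s ↦ (φ (g s)).toLp p volume - g s) + fun s ↦ g s - F s := by
    funext s
    simp
  have hm1 : AEStronglyMeasurable (fun s ↦ (φ (g s)).toLp p volume - g s) volume :=
    (g.map fun x ↦ (φ x).toLp p volume - x).aestronglyMeasurable
  rw [h2]
  refine (eLpNorm_add_le hm1 (g.aestronglyMeasurable.sub hF.1) hq0).trans ?_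
  rw [← ENNReal.add_halves ε]
  refine add_le_add h1 ?_
  rw [show (⇑g - F) = -(F - ⇑g) by simp, eLpNorm_neg]
  exact hg.le

end Duhamel

/-! ### Duhamel integrals in the weak sense -/

section Weak

variable {d : ℕ} {r p p' : ℝ≥0∞} [Fact (1 ≤ r)] [Fact (1 ≤ p)]

/-- Evaluation of a function in a Lebesgue space at a Schwartz function. -/
def schwartzPairing (p : ℝ≥0∞) [Fact (1 ≤ p)] (φ : 𝓢(Rd d, ℂ)) :
    Lp ℂ p (volume : Measure (Rd d)) →L[ℂ] ℂ :=
  (PointwiseConvergenceCLM.evalCLM (RingHom.id ℂ) ℂ φ).comp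
    (Lp.toTemperedDistributionCLM ℂ (volume : Measure (Rd d)) p)

theorem schwartzPairing_apply (φ : 𝓢(Rd d, ℂ)) (f : Lp ℂ p (volume : Measure (Rd d))) :
    schwartzPairing p φ f = Lp.toTemperedDistribution f φ := rfl

theorem toTemperedDistribution_sub (f g : Lp ℂ p (volume : Measure (Rd d))) (φ : 𝓢(Rd d, ℂ)) :
    Lp.toTemperedDistribution (f - g) φ =
      Lp.toTemperedDistribution f φ - Lp.toTemperedDistribution g φ :=
  map_sub (schwartzPairing p φ) f g

variable [Fact (1 ≤ p')] [ENNReal.HolderConjugate p' p]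

theorem enorm_toTemperedDistribution_le (f : Lp ℂ p (volume : Measure (Rd d))) (φ : 𝓢(Rd d, ℂ)) :
    ‖Lp.toTemperedDistribution f φ‖ₑ ≤ ‖f‖ₑ * ‖φ.toLp p' volume‖ₑ := by
  rw [Lp.toTemperedDistribution_apply, Lp.enorm_def, Lp.enorm_def,
    eLpNorm_congr_ae (φ.coeFn_toLp p' volume), mul_comm]
  exact FinFamily.enorm_integral_mul_le φ.continuous.aestronglyMeasurable (Lp.memLp f).1

theorem aestronglyMeasurable_pairing_schwartzPropagator (hp' : 2 ≤ p')
    {F : ℝ → Lp ℂ p (volume : Measure (Rd d))} (hF : AEStronglyMeasurable F volume) (t : ℝ)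
    (φ : 𝓢(Rd d, ℂ)) : AEStronglyMeasurable
      (fun s ↦ Lp.toTemperedDistribution (F s) (schwartzPropagator d (t - s) φ)) volume := by
  have h : ∀ s, Lp.toTemperedDistribution (F s) (schwartzPropagator d (t - s) φ) =
      (ContinuousLinearMap.mul ℂ ℂ).lpPairing volume p' p
        ((schwartzPropagator d (t - s) φ).toLp p' volume) (F s) := by
    intro s
    rw [Lp.toTemperedDistribution_apply, ContinuousLinearMap.lpPairing_eq_integral]
    refine integral_congr_ae ?_
    filter_upwards [(schwartzPropagator d (t - s) φ).coeFn_toLp p' volume] with x hx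
    rw [hx]; rfl
  simp_rw [h]
  exact ContinuousLinearMap.aestronglyMeasurable_comp₂ _
    ((continuous_schwartzPropagator_toLp φ hp').comp
      (continuous_const.sub continuous_id)).aestronglyMeasurable hF

/-- By the dispersive decay, the evolution of a Schwartz function lies in a mixed Lebesgue space. -/
theorem memLp_schwartzPropagator_toLp (hp' : 2 ≤ p') {q : ℝ≥0∞} (hq : q ≠ 0)
    (h : q = ∞ ∨ (q⁻¹).toReal < d * (1 / 2 - (p'⁻¹).toReal)) (t : ℝ) (φ : 𝓢(Rd d, ℂ)) :
    MemLp (fun s ↦ (schwartzPropagator d (t - s) φ).toLp p' volume) q volume := by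
  have hm : AEStronglyMeasurable
      (fun s ↦ (schwartzPropagator d (t - s) φ).toLp p' volume) volume :=
    ((continuous_schwartzPropagator_toLp φ hp').comp
      (continuous_const.sub continuous_id)).aestronglyMeasurable
  obtain ⟨C, hC, hb⟩ := exists_norm_schwartzPropagator_toLp_le φ hp'
  have h1 := two_mul_inv_toReal_le_one hp'
  rcases eq_or_ne q ∞ with rfl | hqt
  · refine memLp_top_of_bound hm C (Filter.Eventually.of_forall fun s ↦
      (hb _).trans (mul_le_of_le_one_right hC ?_))
    refine Real.rpow_le_one_of_one_le_of_nonpos (by linarith [abs_nonneg (t - s)]) ?_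
    rw [neg_nonpos]
    exact mul_nonneg (Nat.cast_nonneg d) (by linarith)
  · have h2 := h.resolve_left hqt
    have hq0 : 0 < q.toReal := ENNReal.toReal_pos hq hqt
    set b := (d : ℝ) * (1 / 2 - (p'⁻¹).toReal) with hbd
    have hb1 : 1 < b * q.toReal := by
      rw [ENNReal.toReal_inv] at h2
      exact (inv_lt_iff_one_lt_mul₀ hq0).1 h2
    have hi : Integrable fun s : ℝ ↦ (1 + ‖s‖) ^ (-(b * q.toReal)) :=
      integrable_one_add_norm (by simpa using hb1)
    have hmem : MemLp (fun s : ℝ ↦ C * (1 + |t - s|) ^ (-b)) q volume := by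
      refine MemLp.const_mul ?_ C
      rw [← integrable_norm_rpow_iff (Continuous.aestronglyMeasurable ?_) hq hqt]
      · refine (hi.comp_sub_left t).congr (Filter.Eventually.of_forall fun s ↦ ?_)
        have h0 : 0 ≤ 1 + |t - s| := by positivity
        simp only [Real.norm_eq_abs]
        rw [abs_of_nonneg (Real.rpow_nonneg h0 _), ← Real.rpow_mul h0, neg_mul]
      · refine Continuous.rpow_const (by fun_prop) fun s ↦ Or.inl ?_
        have h0 : 0 < 1 + |t - s| := by positivity
        exact h0.ne'
    refine hmem.mono hm (Filter.Eventually.of_forall fun s ↦ (hb (t - s)).trans (le_abs_self _))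

variable {q q' : ℝ≥0∞} [ENNReal.HolderConjugate q q']

theorem lintegral_enorm_pairing_schwartzPropagator_le (hp' : 2 ≤ p')
    {F : ℝ → Lp ℂ p (volume : Measure (Rd d))} (hF : AEStronglyMeasurable F volume) (t : ℝ)
    (φ : 𝓢(Rd d, ℂ)) :
    ∫⁻ s, ‖Lp.toTemperedDistribution (F s) (schwartzPropagator d (t - s) φ)‖ₑ ≤
      eLpNorm (fun s ↦ (schwartzPropagator d (t - s) φ).toLp p' volume) q volume *
        eLpNorm F q' volume := by
  refine (lintegral_mono fun s ↦ (enorm_toTemperedDistribution_le (p' := p') _ _).trans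
    (mul_comm _ _).le).trans ?_
  exact FinFamily.lintegral_enorm_mul_enorm_le ((continuous_schwartzPropagator_toLp φ hp').comp
      (continuous_const.sub continuous_id)).aestronglyMeasurable hF

theorem integrable_pairing_schwartzPropagator (hp' : 2 ≤ p')
    (h : q = ∞ ∨ (q⁻¹).toReal < d * (1 / 2 - (p'⁻¹).toReal))
    {F : ℝ → Lp ℂ p (volume : Measure (Rd d))} (hF : MemLp F q' volume) (t : ℝ)
    (φ : 𝓢(Rd d, ℂ)) :
    Integrable fun s ↦ Lp.toTemperedDistribution (F s) (schwartzPropagator d (t - s) φ) := by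
  refine ⟨aestronglyMeasurable_pairing_schwartzPropagator hp' hF.1 t φ, ?_⟩
  refine (lintegral_enorm_pairing_schwartzPropagator_le (q := q) (q' := q') hp' hF.1 t
    φ).trans_lt ?_
  exact ENNReal.mul_lt_top (memLp_schwartzPropagator_toLp hp' (ENNReal.HolderConjugate.ne_zero q q')
    h t φ).2 hF.2

/-- The Duhamel integral of a step function is a weak integral, since the propagator is its own
transpose. -/
theorem toTemperedDistribution_stepDuhamel (hr : 2 ≤ r) (G : SimpleFunc ℝ 𝓢(Rd d, ℂ))
    (hG : G.FinMeasSupp volume) (t : ℝ) (φ : 𝓢(Rd d, ℂ)) :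
    Lp.toTemperedDistribution (stepDuhamel r G t) φ =
      ∫ s in Iio t, Lp.toTemperedDistribution ((G s).toLp p volume)
        (schwartzPropagator d (t - s) φ) := by
  rw [← schwartzPairing_apply, stepDuhamel, ← ContinuousLinearMap.integral_comp_comm _
    (integrable_schwartzPropagator_toLp hr G hG t).integrableOn]
  refine integral_congr_ae (Filter.Eventually.of_forall fun s ↦ ?_)
  simp only [schwartzPairing_apply, Lp.toTemperedDistribution_toLp_eq,
    SchwartzMap.toTemperedDistributionCLM_apply_apply, smul_eq_mul]
  simp_rw [mul_comm (φ _), mul_comm (schwartzPropagator d (t - s) φ _)]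
  exact integral_schwartzPropagator_mul _ _ _

end Weak

/-! ### Passage to the limit -/

section Limit

open Filter Topology

variable {d : ℕ} {r p : ℝ≥0∞} [Fact (1 ≤ r)] [Fact (1 ≤ p)]

theorem stepDuhamel_sub (hr : 2 ≤ r) {G G' : SimpleFunc ℝ 𝓢(Rd d, ℂ)} (hG : G.FinMeasSupp volume)
    (hG' : G'.FinMeasSupp volume) (t : ℝ) :
    stepDuhamel r (G - G') t = stepDuhamel r G t - stepDuhamel r G' t := by
  unfold stepDuhamel
  rw [← integral_sub (integrable_schwartzPropagator_toLp hr G hG t).integrableOn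
    (integrable_schwartzPropagator_toLp hr G' hG' t).integrableOn]
  congr 1
  funext s
  rw [SimpleFunc.coe_sub, Pi.sub_apply, map_sub, toLp_sub]

/-- An a priori estimate for step functions allows one to pass to the limit: the Duhamel integral of
a general function is the pointwise limit almost everywhere of those of step functions. -/
theorem exists_isDuhamelIntegral {p' q qt qt' : ℝ≥0∞} [Fact (1 ≤ p')]
    [ENNReal.HolderConjugate p' p] [ENNReal.HolderConjugate qt qt'] (hr : 2 ≤ r) (hp : p ≠ ∞)
    (hp' : 2 ≤ p') (hq : 1 ≤ q) (hlt : (q⁻¹).toReal < (qt'⁻¹).toReal)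
    (hdecay : qt = ∞ ∨ (qt⁻¹).toReal < d * (1 / 2 - (p'⁻¹).toReal)) {K : ℝ≥0}
    (hK : ∀ (G : SimpleFunc ℝ 𝓢(Rd d, ℂ)), G.FinMeasSupp volume → ∀ t,
      ‖stepDuhamel r G t‖ₑ ≤ K * duhamelControl (q⁻¹).toReal (qt'⁻¹).toReal
        (fun s ↦ ‖(G s).toLp p volume‖ₑ) t) :
    ∃ C : ℝ≥0, ∀ F : ℝ → Lp ℂ p (volume : Measure (Rd d)), MemLp F qt' volume →
      ∃ u : ℝ → Lp ℂ r (volume : Measure (Rd d)),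
        AEStronglyMeasurable u volume ∧
        (∀ᵐ t : ℝ, IsDuhamelIntegral (fun s ↦ Lp.toTemperedDistribution (F s)) t
          (Lp.toTemperedDistribution (u t))) ∧
        eWeakLpNorm u q volume ≤ C * eLpNorm F qt' volume := by
  have hqt1 : 1 ≤ qt' := ENNReal.HolderConjugate.one_le qt' qt
  have hqt0 : qt' ≠ 0 := (zero_lt_one.trans_le hqt1).ne'
  set π := (qt'⁻¹).toReal with hπd
  have hπ : 0 < π := ENNReal.toReal_nonneg.trans_lt hlt
  have hqtt : qt' ≠ ∞ := by rintro rfl; simp [hπd] at hπ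
  have hπ1 : π ≤ 1 := by
    simpa [hπd] using ENNReal.toReal_mono ENNReal.one_ne_top (ENNReal.inv_le_one.2 hqt1)
  have hnorm : ∀ f : ℝ → Lp ℂ p (volume : Measure (Rd d)),
      (∫⁻ s, ‖f s‖ₑ ^ π⁻¹) ^ π = eLpNorm f qt' volume := by
    intro f
    rw [eLpNorm_eq_lintegral_rpow_enorm_toReal hqt0 hqtt, hπd, ENNReal.toReal_inv, inv_inv, one_div]
  obtain ⟨C, hC⟩ := exists_eWeakLpNorm_duhamelControl_le hq hlt
  -- `K + 1` rather than `K`, since `eWeakLpNorm_le_of_ae_le` needs a nonzero constant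
  refine ⟨(K + 1) * C, fun F hF ↦ ?_⟩
  have hε : ∀ n : ℕ, ENNReal.ofReal ((1 / 4) ^ n) ≠ 0 := fun n ↦ by simp
  -- errors of size `4 ^ (-n)` make the Borel–Cantelli lemma apply
  choose G hG hGF using fun n ↦ exists_simpleFunc_schwartz_approx hp hqt1 hqtt hF (hε n)
  set Θ := duhamelControl (q⁻¹).toReal π with hΘ
  let g : ℕ → ℝ → ℝ≥0∞ := fun n s ↦ ‖(G n s).toLp p volume - F s‖ₑ
  have hdm : ∀ n, AEStronglyMeasurable (fun s ↦ (G n s).toLp p volume - F s) volume := fun n ↦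
    ((G n).map fun φ : 𝓢(Rd d, ℂ) ↦ φ.toLp p volume).aestronglyMeasurable.sub hF.1
  have hgm : ∀ n, AEMeasurable (g n) := fun n ↦ (hdm n).enorm
  have hΘg : ∀ᵐ t : ℝ, Tendsto (fun n ↦ Θ (g n) t) atTop (𝓝 0) := by
    refine ae_tendsto_zero_of_eWeakLpNorm_le hq (C := C) fun n ↦ (hC _ (hgm n)).trans ?_
    rw [hnorm]
    gcongr
    exact hGF n
  have hKK : ∀ x : ℝ≥0∞, K * x ≤ (K + 1) * x := fun x ↦ by gcongr; exact le_self_add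
  -- differences of approximants
  have hdiff : ∀ n m t, ‖stepDuhamel r (G n) t - stepDuhamel r (G m) t‖ₑ ≤
      K * (Θ (g n) t + Θ (g m) t) := by
    intro n m t
    rw [← stepDuhamel_sub hr (hG n) (hG m)]
    have hsub : (G n - G m).FinMeasSupp volume := (hG n).map₂ (hG m) (sub_zero 0)
    refine (hK _ hsub t).trans ?_
    gcongr
    refine duhamelControl_le_add hπ hπ1 (hgm n) (hgm m) (fun s ↦ ?_) t
    rw [SimpleFunc.coe_sub, Pi.sub_apply, toLp_sub]
    have : (G n s).toLp p volume - (G m s).toLp p volume =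
        ((G n s).toLp p volume - F s) - ((G m s).toLp p volume - F s) := by abel
    rw [this]
    exact enorm_sub_le
  have hsize : ∀ n t, ‖stepDuhamel r (G n) t‖ₑ ≤ K * (Θ (fun s ↦ ‖F s‖ₑ) t + Θ (g n) t) := by
    intro n t
    refine (hK _ (hG n) t).trans ?_
    gcongr
    refine duhamelControl_le_add hπ hπ1 hF.1.enorm (hgm n) (fun s ↦ ?_) t
    have : (G n s).toLp p volume = F s + ((G n s).toLp p volume - F s) := by abel
    conv_lhs => rw [this]
    exact enorm_add_le _ _
  have hlim : ∀ᵐ t : ℝ, ∃ l, Tendsto (fun n ↦ stepDuhamel r (G n) t) atTop (𝓝 l) := by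
    filter_upwards [hΘg] with t ht
    refine cauchySeq_tendsto_of_complete (EMetric.cauchySeq_iff.2 fun ε hε ↦ ?_)
    have h1 : Tendsto (fun x : ℕ × ℕ ↦ K * (Θ (g x.1) t + Θ (g x.2) t)) (atTop ×ˢ atTop) (𝓝 0) := by
      have := ENNReal.Tendsto.const_mul (a := (K : ℝ≥0∞)) ((ht.comp tendsto_fst).add
        (ht.comp (tendsto_snd (f := atTop)))) (Or.inr ENNReal.coe_ne_top)
      simpa using this
    rw [prod_atTop_atTop_eq] at h1
    obtain ⟨⟨N, M⟩, hN⟩ := eventually_atTop.1 (h1.eventually_lt_const hε)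
    refine ⟨max N M, fun m hm n hn ↦ ?_⟩
    rw [edist_eq_enorm_sub]
    exact (hdiff m n t).trans_lt (hN (m, n)
      ⟨(le_max_left _ _).trans hm, (le_max_right _ _).trans hn⟩)
  obtain ⟨u, hum, hu⟩ := exists_stronglyMeasurable_limit_of_tendsto_ae
    (fun n ↦ aestronglyMeasurable_stepDuhamel hr (G n)) hlim
  refine ⟨u, hum.aestronglyMeasurable, ?_, ?_⟩
  · filter_upwards [hu] with t ht φ
    simp only [schrodingerPropagator_apply]
    have hint := integrable_pairing_schwartzPropagator (q := qt) hp' hdecay hF t φ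
    refine ⟨hint.integrableOn, ?_⟩
    have h1 := ((schwartzPairing r φ).continuous.tendsto _).comp ht
    refine tendsto_nhds_unique h1 ?_
    set B := eLpNorm (fun s ↦ (schwartzPropagator d (t - s) φ).toLp p' volume) qt volume with hB
    have hBt : B ≠ ∞ := (memLp_schwartzPropagator_toLp hp'
      (ENNReal.HolderConjugate.ne_zero qt qt') hdecay t φ).2.ne
    rw [tendsto_iff_edist_tendsto_0]
    have h2 : Tendsto (fun n : ℕ ↦ B * ENNReal.ofReal ((1 / 4) ^ n)) atTop (𝓝 0) := by
      have := ENNReal.Tendsto.const_mul (a := B) (ENNReal.tendsto_ofReal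
        (tendsto_pow_atTop_nhds_zero_of_lt_one (r := (1 / 4 : ℝ)) (by norm_num) (by norm_num)))
        (Or.inr hBt)
      simpa using this
    refine tendsto_of_tendsto_of_tendsto_of_le_of_le tendsto_const_nhds h2 (fun _ ↦ zero_le)
      fun n ↦ ?_
    have hGm : MemLp (fun s ↦ (G n s).toLp p volume) qt' volume := by
      have h3 : MemLp (fun s ↦ (G n s).toLp p volume - F s) qt' volume :=
        ⟨hdm n, (hGF n).trans_lt ENNReal.ofReal_lt_top⟩
      refine (h3.add hF).ae_eq (Eventually.of_forall fun s ↦ ?_)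
      simp
    simp only [Function.comp_apply]
    rw [schwartzPairing_apply,
      toTemperedDistribution_stepDuhamel (p := p) hr (G n) (hG n), edist_eq_enorm_sub,
      ← integral_sub (integrable_pairing_schwartzPropagator (q := qt) hp' hdecay hGm t
        φ).integrableOn hint.integrableOn]
    simp_rw [← toTemperedDistribution_sub]
    refine (enorm_integral_le_lintegral_enorm _).trans ((setLIntegral_le_lintegral _ _).trans ?_)
    refine (lintegral_enorm_pairing_schwartzPropagator_le (q := qt) (q' := qt') hp' (hdm n) t
      φ).trans ?_
    gcongr
    exact hGF n
  · have hbound : ∀ᵐ t : ℝ, ‖u t‖ₑ ≤ ((K + 1 : ℝ≥0) : ℝ≥0∞) * Θ (fun s ↦ ‖F s‖ₑ) t := by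
      filter_upwards [hu, hΘg] with t ht hΘt
      have h1 : Tendsto (fun n ↦ K * (Θ (fun s ↦ ‖F s‖ₑ) t + Θ (g n) t)) atTop
          (𝓝 (K * (Θ (fun s ↦ ‖F s‖ₑ) t + 0))) :=
        ENNReal.Tendsto.const_mul (tendsto_const_nhds.add hΘt) (Or.inr ENNReal.coe_ne_top)
      rw [add_zero] at h1
      refine (le_of_tendsto_of_tendsto' ht.enorm h1 fun n ↦ hsize n t).trans ?_
      rw [ENNReal.coe_add, ENNReal.coe_one]
      exact hKK _
    refine (eWeakLpNorm_le_of_ae_le (by positivity) q hbound).trans ?_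
    rw [ENNReal.coe_mul, mul_assoc]
    gcongr
    exact (hC _ hF.1.enorm).trans (le_of_eq (by rw [hnorm]))

end Limit

theorem corollary1p2 (d : ℕ) (q r qt rt qt' rt' : ℝ≥0∞)
    [Fact (1 ≤ r)] [Fact (1 ≤ rt')]
    (hq : 1 ≤ q) (hqt : ENNReal.HolderConjugate qt qt') (hrt : ENNReal.HolderConjugate rt rt')
    (hdim : (d = 1 ∧ 2 < r ∧ 2 < rt) ∨
      (d = 2 ∧ (2 < r ∧ r < ∞) ∧ (2 < rt ∧ rt < ∞)) ∨
      (3 ≤ d ∧ ((d : ℝ) - 2) * (r⁻¹).toReal ≤ d * (rt⁻¹).toReal ∧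
        ((d : ℝ) - 2) * (rt⁻¹).toReal ≤ d * (r⁻¹).toReal))
    (hcrit : (d : ℝ) * (1 / 2 - (r⁻¹).toReal) = (q⁻¹).toReal)
    (hlt : (q⁻¹).toReal < (qt'⁻¹).toReal)
    (hscale : (qt'⁻¹).toReal = 1 - (d : ℝ) / 2 * ((r⁻¹).toReal - (rt⁻¹).toReal))
    (hle : (rt⁻¹).toReal ≤ (r⁻¹).toReal) :
    ∃ C : ℝ≥0, ∀ F : ℝ → Lp ℂ rt' (volume : Measure (Rd d)), MemLp F qt' volume →
      ∃ u : ℝ → Lp ℂ r (volume : Measure (Rd d)),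
        AEStronglyMeasurable u volume ∧
        (∀ᵐ t : ℝ, IsDuhamelIntegral (fun s ↦ Lp.toTemperedDistribution (F s)) t
          (Lp.toTemperedDistribution (u t))) ∧
        eWeakLpNorm u q volume ≤ C * eLpNorm F qt' volume := by
  have hr1 : 1 ≤ r := Fact.out
  have hrt1 : 1 ≤ rt := ENNReal.HolderConjugate.one_le rt rt'
  have : Fact (1 ≤ rt) := ⟨hrt1⟩
  have hd : d ≠ 0 := by rcases hdim with h | h | h <;> omega
  have hd0 : (0 : ℝ) < d := by exact_mod_cast Nat.pos_of_ne_zero hd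
  set ρ := (r⁻¹).toReal with hρ
  set ρt := (rt⁻¹).toReal with hρt
  have hρt0 : 0 ≤ ρt := ENNReal.toReal_nonneg
  have hq0 : 0 ≤ (q⁻¹).toReal := ENNReal.toReal_nonneg
  have hρ2 : ρ ≤ 1 / 2 := by
    by_contra hcon
    have := mul_neg_of_pos_of_neg hd0 (show 1 / 2 - ρ < 0 by linarith)
    linarith
  have two_le : ∀ x : ℝ≥0∞, 1 ≤ x → (x⁻¹).toReal ≤ 1 / 2 → 2 ≤ x := by
    intro x hx1 hx
    rw [← ENNReal.inv_le_inv, ← ENNReal.toReal_le_toReal (by simp; positivity) (by simp)]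
    simpa using hx
  have hr : 2 ≤ r := two_le r hr1 hρ2
  have hrt2 : 2 ≤ rt := two_le rt hrt1 (hle.trans hρ2)
  have hrt'top : rt' ≠ ∞ := by
    rintro rfl
    have := ENNReal.HolderConjugate.inv_add_inv_eq_one rt ∞
    rw [ENNReal.inv_top, add_zero, ENNReal.inv_eq_one] at this
    rw [this] at hrt2
    norm_num at hrt2
  have hconj : ∀ x y : ℝ≥0∞, ENNReal.HolderConjugate x y →
      (x⁻¹).toReal + (y⁻¹).toReal = 1 := by
    intro x y hxy
    have hx : x⁻¹ ≠ ∞ := by simpa using ENNReal.HolderConjugate.ne_zero x y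
    have hy : y⁻¹ ≠ ∞ := by simpa using ENNReal.HolderConjugate.ne_zero y x
    rw [← ENNReal.toReal_add hx hy, ENNReal.HolderConjugate.inv_add_inv_eq_one x y,
      ENNReal.toReal_one]
  have hρt' := hconj rt rt' hrt
  have hqt'' := hconj qt qt' hqt
  have hπ : 0 < 1 - d / 2 * (ρ - ρt) := by rw [← hscale]; exact hq0.trans_lt hlt
  -- the admissibility conditions in terms of the reciprocals
  have hadm : d * (ρ - ρt) ≤ 2 * ρ ∧ (d * (ρ - ρt) = 2 * ρ → 0 < ρ → 0 < ρt) := by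
    rcases hdim with ⟨rfl, _, _⟩ | ⟨rfl, _, _, hfin⟩ | ⟨hd3, h3, _⟩
    · push_cast
      exact ⟨by linarith, fun _ _ ↦ by linarith⟩
    · have : 0 < ρt := ENNReal.toReal_pos (by simpa using hfin.ne) (by simpa using by positivity)
      push_cast
      exact ⟨by linarith, fun _ _ ↦ this⟩
    · refine ⟨by linarith, fun he hρ0 ↦ ?_⟩
      have h4 : (3 : ℝ) ≤ d := by exact_mod_cast hd3
      have h5 : 0 < ((d : ℝ) - 2) * ρ := mul_pos (by linarith) hρ0
      exact pos_of_mul_pos_right (h5.trans_le h3) hd0.le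
  -- the test function decays like `|t|^{-d(1/2-ρt)}`, and `1 / qt = d (ρ - ρt) / 2` is smaller, as
  -- `ρt < ρ ≤ 1 / 2`
  have hdecay : qt = ∞ ∨ (qt⁻¹).toReal < d * (1 / 2 - ρt) := by
    rw [or_iff_not_imp_left]
    intro hqtop
    have h1 : (qt⁻¹).toReal = d * ((ρ - ρt) / 2) := by linarith
    have h2 : 0 < (qt⁻¹).toReal := ENNReal.toReal_pos (by simpa using hqtop)
      (by simpa using ENNReal.HolderConjugate.ne_zero qt qt')
    have h3 : 0 < ρ - ρt := by
      rw [h1] at h2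
      linarith [pos_of_mul_pos_right h2 hd0.le]
    rw [h1]
    exact mul_lt_mul_of_pos_left (by linarith) hd0
  obtain ⟨K, hK⟩ := exists_enorm_stepDuhamel_le (d := d) (r := r) (p := rt') hd hr hrt'top hρ.symm
    (show ((rt'⁻¹).toReal) = 1 - ρt by linarith) hρt0 hle hadm.1 hadm.2 hπ
  rw [hcrit, ← hscale] at hK
  exact exists_isDuhamelIntegral hr hrt'top hrt2 hq hlt hdecay hK

end
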